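/- **Setting.** Let $E$ be a locally compact separable metric space and $\mu$ a positive Borel measure on $E$, finite on compacts, with full support. For a set $W$ of functions, $W_b$, $W_0$, $W_{0,b}$ denote the members of $W$ that are $\mu$-essentially bounded, have compact support, or both; $u\in W_{loc}$ means that on every relatively compact open set $u$ coincides $\mu$-a.e. with a member of $W$. Let $\mathcal E$ be the generalized Dirichlet form given by a (not necessarily symmetric) Dirichlet form $(\mathcal A,\mathcal V)$ on $L^2(E,\mu)$ and the generator $\Lambda$ of a sub-Markovian $C_0$-semigroup of contractions on $L^2(E,\mu)$ that restricts to a $C_0$-semigroup on $\mathcal V$: with $(\Lambda,\mathcal F)$ the closure of $\Lambda: D(\Lambda)\cap\mathcal V\to\mathcal V'$, $\mathcal E(u,v)=\mathcal A(u,v)-{}_{\mathcal V'}\langle\Lambda u,v\rangle_{\mathcal V}$ for $u\in\mathcal F$, $v\in\mathcal V$. Let $(T_t)_{t>0}$ be the associated sub-Markovian $C_0$-semigroup of contractions on $L^2(E,\mu)$, i.e. its resolvent $(G_\alpha)_{\alpha>0}$ satisfies $G_\alpha f\in\mathcal F$ and $\mathcal E(G_\alpha f,v)+\alpha(G_\alpha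 f,v)=(f,v)$ for all $f\in L^2(E,\mu)$, $v\in\mathcal V$; let $(\widehat T_t)_{t>0}$ be its adjoint. $(T_t)_{t>0}$ is extended to $L^\infty(E,\mu)$ by monotone limits and is called conservative if $T_t1=1$ $\mu$-a.e. for all $t>0$. Let $(\mathcal E^0,D(\mathcal E^0))$ be a symmetric strongly local regular Dirichlet form on $L^2(E,\mu)$ with carré du champ $\Gamma$, so that $\mathcal E^0(u,v)=\int_E\Gamma(u,v)\,d\mu$. Let $N:D(N)\to L^1_{loc}(E,\mu)$ be a linear operator with $D(\mathcal E^0)_b\subset D(N)$. Let $\rho\ge0$ be a continuous function on $E$, $E_r:=\{\rho<r\}$, and $V_n:=E_{4n}$, $n\ge1$. Fix $t>0$. Assume: * **(H1)** For $p=1$ or $p=2$ there are sub-Markovian $C_0$-semigroups of contractions $(\widehat T^n_s)_{s>0}$ on $L^p(V_n,\mu)$, with generators $(\widehat L^n,D(\widehat L^n))$, $n\ge1$, such that for every $s>0$ and every non-negative $f\in L^1(E,\mu)\cap L^\infty(E,\mu)$, $\widehat T^n_sf:=\widehat T^n_s(f1_{V_n})$ (extended by zero) increases $\mu$-a.e.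 to $\widehat T_sf$ as $n\to\infty$. * **(H2)** For each $n\ge1$, $D(\widehat L^n)_b\subset D(\mathcal E^0)_b$ (extending by zero), and $$-\int_{V_n}\widehat L^nv\,u\,d\mu=\int_E\Gamma(u,v)\,d\mu+\int_{V_n}u\,Nv\,d\mu$$ for all $v\in D(\widehat L^n)_b$ and all $u\in D(\mathcal E^0)_b$ with $u=0$ $\mu$-a.e. on $E\setminus V_n$. Moreover: if $v\in D(\mathcal E^0)_b$ is $\mu$-a.e. constant on a Borel set $B$, then $Nv=0$ $\mu$-a.e. on $B$; $\int_ENv\,d\mu=0$ for $v\in D(\mathcal E^0)_{0,b}$; and $N\varphi(v)=\varphi'(v)Nv$, $N(uv)=vNu+uNv$ for $u,v\in D(N)_b$ and bounded $\varphi\in C^1(\mathbb R)$ with bounded derivative, whenever $\varphi(v)$, respectively $uv$, belongs to $D(N)$. * **(H3)** $\rho\in D(\mathcal E^0)_{loc}$, every $E_r$, $r>0$, is relatively compact, and there is a compact set $K_0\subset E$ with $\Gamma(\rho,\rho),\,N(\rho)\in L^\infty_{loc}(E\setminus K_0,\mu)$. Here $\Gamma(\rho,\rho)$ and $N(\rho)$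 are defined locally: on a relatively compact open set they are $\Gamma(u,u)$ and $Nu$ for $u\in D(\mathcal E^0)_b$ with $u=\rho$ there. * **(H4)** For some compact $K_1\supset K_0$, the following set $D_0$ is dense in $L^1(E,\mu)$: $D_0$ consists of the $f\in L^\infty(E,\mu)$ with compact support such that $\widehat T^n_sf\in D(\widehat L^n)$ for all $n\ge k_f$ and all $s\in(0,t]$, where $k_f:=\min\{m\in\mathbb N:\operatorname{supp} f\subset E_m,\ K_1\subset E_m\}$. For a function $\phi$ on $[0,\infty)$ put $$\widehat A_n(\phi):=(\sqrt{a_n}+b_n)\,\mu(E_{4n}\setminus E_{2n})^{1/2}+\|N(\rho)\|_{L^2(E_{4n}\setminus E_{2n},\mu)},$$ $$a_n:=\operatorname*{ess\,sup}_{E_{4n}\setminus E_{2n}}\Gamma(\rho,\rho),\qquad b_n:=\operatorname*{ess\,sup}_{E_{4n}\setminus E_{2n}}\phi'(\rho)\,\Gamma(\rho,\rho).$$ **Claim.** Each of the following conditions implies that $(T_t)_{t>0}$ is conservative. (i) There are constants $M,C>0$, $0<\alpha<1$, $0\le\beta<2$ and a compact set $K\supset K_0$ such that $$\left|\Gamma(\rho,\rho)+\frac{(\rho+1)N(\rho)}{C(2-\beta)(\log(\rho+1))^{1-\beta}}\right|\le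 M(\rho+1)^2(\log(\rho+1))^\beta\quad\mu\text{-a.e. on }E\setminus K,$$ and, with $\phi(r)=C(\log(r+1))^{2-\beta}$, $\widehat A_n(\phi)\le n\exp\big(\alpha C(\log(n+1))^{2-\beta}\big)$ for all sufficiently large $n$. (ii) There are constants $M,C>0$, $0<\alpha<1$ and a compact set $K\supset K_0$ such that $$\left|\Gamma(\rho,\rho)+\frac1C(\rho+1)\log(\rho+1)N(\rho)\right|\le M(\rho+1)^2(\log(\rho+1))^2\quad\mu\text{-a.e. on }E\setminus K,$$ and, with $\phi(r)=C\log(\log(r+1)+1)$, $\widehat A_n(\phi)\le n\,(\log(n+1))^{C\alpha}$ for all sufficiently large $n$. (iii) There are constants $M,C>0$, $0<\alpha<2$ and a compact set $K\supset K_0$ such that $$\left|\Gamma(\rho,\rho)+\frac{N(\rho)}{C\rho}\right|\le M\quad\mu\text{-a.e. on }E\setminus K,$$ and, with $\phi(r)=Cr^2/2$, $\widehat A_n(\phi)\le n\exp(\alpha Cn^2)$ for all sufficiently large $n$. -/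

import Mathlib

open MeasureTheory Filter Topology Set
open scoped ENNReal InnerProductSpace

noncomputable section

/-! ### Contraction semigroups -/

/-- A strongly continuous semigroup of contractions `(T_t)_{t ≥ 0}` on a real Banach space
(the values at negative times play no role). -/
structure C0ContractionSemigroup (X : Type*) [NormedAddCommGroup X] [NormedSpace ℝ X] where
  op : ℝ → X →L[ℝ] X
  op_zero : op 0 = ContinuousLinearMap.id ℝ X
  op_add : ∀ s t : ℝ, 0 ≤ s → 0 ≤ t → op (s + t) = (op s).comp (op t)
  norm_le_one : ∀ t : ℝ, 0 ≤ t → ‖op t‖ ≤ 1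
  tendsto_zero : ∀ x : X, Tendsto (fun t => op t x) (𝓝[>] 0) (𝓝 x)

namespace C0ContractionSemigroup

variable {X : Type*} [NormedAddCommGroup X] [NormedSpace ℝ X]

/-- `T.HasGenerator x y`: the vector `x` is in the domain of the generator `L` of `T`
and `L x = y`. -/
def HasGenerator (T : C0ContractionSemigroup X) (x y : X) : Prop :=
  Tendsto (fun h : ℝ => h⁻¹ • (T.op h x - x)) (𝓝[>] 0) (𝓝 y)

/-- The domain of the generator. -/
def generatorDomain (T : C0ContractionSemigroup X) : Set X :=
  {x | ∃ y, T.HasGenerator x y}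

/-- The resolvent `G_α x = ∫_0^∞ e^{-α t} T_t x dt`, for `α > 0`. -/
def resolvent (T : C0ContractionSemigroup X) (α : ℝ) (x : X) : X :=
  ∫ t in Ioi (0 : ℝ), Real.exp (-α * t) • T.op t x

end C0ContractionSemigroup

/-- A semigroup on an `L^p`-space is sub-Markovian if `0 ≤ f ≤ 1` a.e. implies
`0 ≤ T_t f ≤ 1` a.e. -/
def IsSubMarkovian {E : Type*} [MeasurableSpace E] {ν : Measure E} {p : ℝ≥0∞} [Fact (1 ≤ p)]
    (T : C0ContractionSemigroup (Lp ℝ p ν)) : Prop :=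
  ∀ t : ℝ, 0 < t → ∀ f : Lp ℝ p ν, (∀ᵐ x ∂ν, 0 ≤ f x ∧ f x ≤ 1) →
    ∀ᵐ x ∂ν, 0 ≤ T.op t f x ∧ T.op t f x ≤ 1

section Functions

variable {E : Type*} [MeasurableSpace E]

/-- Essentially bounded functions. -/
def EssBdd (μ : Measure E) (u : E → ℝ) : Prop :=
  ∃ C : ℝ, ∀ᵐ x ∂μ, |u x| ≤ C

/-- The support of the measure `|u| dμ`. -/
def essSupport [TopologicalSpace E] (μ : Measure E) (u : E → ℝ) : Set E :=
  (μ.withDensity fun x => ‖u x‖ₑ).support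

end Functions

/-! ### The extension of a sub-Markovian semigroup to bounded functions, conservativeness -/

section Conservative

variable {E : Type*} [MeasurableSpace E] {μ : Measure E}

/-- For a non-negative bounded function `f`, the function `g` is the value `S f` of the extension
of the positivity preserving operator `S` on `L^2`: one has `S f_n → g` a.e. whenever
`f_n ∈ L^2 ∩ L^∞` and `0 ≤ f_n ↗ f` a.e. -/
def IsMonotoneExtension (S : Lp ℝ 2 μ →L[ℝ] Lp ℝ 2 μ) (f g : E → ℝ) : Prop :=
  ∀ F : ℕ → Lp ℝ 2 μ, (∀ n, EssBdd μ (F n)) →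
    (∀ᵐ x ∂μ, (∀ n, 0 ≤ F n x) ∧ Monotone (fun n => F n x) ∧
      Tendsto (fun n => F n x) atTop (𝓝 (f x))) →
    ∀ᵐ x ∂μ, Tendsto (fun n => S (F n) x) atTop (𝓝 (g x))

/-- Conservativeness: `T_t 1 = 1` a.e. for all `t > 0`. -/
def IsConservative (T : C0ContractionSemigroup (Lp ℝ 2 μ)) : Prop :=
  ∀ t : ℝ, 0 < t → IsMonotoneExtension (T.op t) (fun _ => 1) (fun _ => 1)

end Conservative

/-! ### Dirichlet forms -/

/-- A bilinear form on `L^2(E, μ)` with a linear domain. -/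
structure L2Form {E : Type*} [MeasurableSpace E] (μ : Measure E) where
  dom : Submodule ℝ (E →ₘ[μ] ℝ)
  memLp : ∀ u ∈ dom, MemLp u 2 μ
  form : dom →ₗ[ℝ] dom →ₗ[ℝ] ℝ

namespace L2Form

variable {E : Type*} [MeasurableSpace E] {μ : Measure E}

/-- `𝓐_1(u, v) = 𝓐(u, v) + (u, v)`. -/
def form1 (A : L2Form μ) (u v : A.dom) : ℝ :=
  A.form u v + ∫ x, u.1 x * v.1 x ∂μ

/-- A (not necessarily symmetric) Dirichlet form: densely defined, non-negative, closed, with the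
weak sector condition and the two unit contraction properties. -/
structure IsDirichletForm (A : L2Form μ) : Prop where
  dense : ∀ f : E → ℝ, MemLp f 2 μ → ∀ ε : ℝ, 0 < ε →
    ∃ u : A.dom, ∫ x, (u.1 x - f x) ^ 2 ∂μ < ε
  nonneg : ∀ u : A.dom, 0 ≤ A.form u u
  complete : ∀ u : ℕ → A.dom,
    (∀ ε : ℝ, 0 < ε → ∃ k : ℕ, ∀ m ≥ k, ∀ n ≥ k, A.form1 (u m - u n) (u m - u n) < ε) →
    ∃ w : A.dom, Tendsto (fun n => A.form1 (u n - w) (u n - w)) atTop (𝓝 0)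
  sector : ∃ K : ℝ, ∀ u v : A.dom,
    |A.form1 u v| ≤ K * Real.sqrt (A.form1 u u) * Real.sqrt (A.form1 v v)
  contraction : ∀ u : A.dom, ∃ w : A.dom, (∀ᵐ x ∂μ, w.1 x = min (max (u.1 x) 0) 1) ∧
    0 ≤ A.form (u + w) (u - w) ∧ 0 ≤ A.form (u - w) (u + w)

variable [TopologicalSpace E]

/-- A symmetric strongly local regular Dirichlet form. -/
structure IsStronglyLocalRegular (A : L2Form μ) : Prop where
  dirichlet : A.IsDirichletForm
  symm : ∀ u v : A.dom, A.form u v = A.form v u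
  /-- `C_0(E) ∩ D(A)` is dense in `D(A)` -/
  regular_dom : ∀ u : A.dom, ∀ ε : ℝ, 0 < ε → ∃ (w : A.dom) (g : E → ℝ),
    Continuous g ∧ HasCompactSupport g ∧ (∀ᵐ x ∂μ, w.1 x = g x) ∧ A.form1 (u - w) (u - w) < ε
  /-- `C_0(E) ∩ D(A)` is uniformly dense in `C_0(E)` -/
  regular_cont : ∀ h : E → ℝ, Continuous h → HasCompactSupport h → ∀ ε : ℝ, 0 < ε →
    ∃ (w : A.dom) (g : E → ℝ), Continuous g ∧ HasCompactSupport g ∧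
      (∀ᵐ x ∂μ, w.1 x = g x) ∧ ∀ x, |h x - g x| < ε
  /-- `A(u, v) = 0` if `u` is constant on a neighbourhood of the support of `v` -/
  strongly_local : ∀ (u v : A.dom) (U : Set E) (c : ℝ), IsOpen U → essSupport μ v.1 ⊆ U →
    (∀ᵐ x ∂μ, x ∈ U → u.1 x = c) → A.form u v = 0

/-- The form `A` is represented by the carré du champ `Γ`, i.e. `Γ` is a symmetric positive
semidefinite bilinear form with values in `L^1`, `A(u, v) = ∫ Γ(u, v) dμ`, and `2 Γ(u, u)` is the
density of the energy measure of `u`, that is, `2 A(u, f u) - A(u², f) = 2 ∫ f Γ(u, u) dμ`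
for bounded `u, f` in the domain. -/
structure IsCarreDuChamp (A : L2Form μ) (Γ : A.dom →ₗ[ℝ] A.dom →ₗ[ℝ] (E →ₘ[μ] ℝ)) : Prop where
  symm : ∀ u v : A.dom, Γ u v = Γ v u
  nonneg : ∀ u : A.dom, ∀ᵐ x ∂μ, 0 ≤ Γ u u x
  integrable : ∀ u v : A.dom, Integrable (Γ u v) μ
  integral_eq : ∀ u v : A.dom, A.form u v = ∫ x, Γ u v x ∂μ
  energy : ∀ u f fu uu : A.dom, EssBdd μ u.1 → EssBdd μ f.1 →
    (∀ᵐ x ∂μ, fu.1 x = f.1 x * u.1 x) → (∀ᵐ x ∂μ, uu.1 x = u.1 x * u.1 x) →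
    2 * A.form u fu - A.form uu f = 2 * ∫ x, f.1 x * Γ u u x ∂μ

/-- `ρ ∈ D(A)_loc`. -/
def MemDomLoc (A : L2Form μ) (ρ : E → ℝ) : Prop :=
  ∀ V : Set E, IsOpen V → IsCompact (closure V) →
    ∃ u : A.dom, ∀ᵐ x ∂μ, x ∈ V → ρ x = u.1 x

/-- `g = Γ(ρ, ρ)` for `ρ ∈ D(A)_loc`: on every relatively compact open set `V`, `g` is `Γ(u, u)`
with `u ∈ D(A)` such that `u = ρ` a.e. on `V`. -/
def IsLocalGamma (A : L2Form μ) (Γ : A.dom →ₗ[ℝ] A.dom →ₗ[ℝ] (E →ₘ[μ] ℝ))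
    (ρ : E → ℝ) (g : E →ₘ[μ] ℝ) : Prop :=
  ∀ V : Set E, IsOpen V → IsCompact (closure V) →
    ∃ u : A.dom, ∀ᵐ x ∂μ, x ∈ V → ρ x = u.1 x ∧ g x = Γ u u x

/-- `g = N(ρ)` for locally bounded `ρ ∈ D(A)_loc`: on every relatively compact open set `V`, `g` is
`N u` with a bounded `u ∈ D(A)` such that `u = ρ` a.e. on `V`. -/
def IsLocalN (A : L2Form μ) (N : (E →ₘ[μ] ℝ) →ₗ.[ℝ] (E →ₘ[μ] ℝ))
    (ρ : E → ℝ) (g : E →ₘ[μ] ℝ) : Prop :=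
  ∀ V : Set E, IsOpen V → IsCompact (closure V) →
    ∃ u : N.domain, u.1 ∈ A.dom ∧ EssBdd μ u.1 ∧ ∀ᵐ x ∂μ, x ∈ V → ρ x = u.1 x ∧ g x = N u x

end L2Form

/-! ### Generalized Dirichlet forms -/

/-- The data of a generalized Dirichlet form: a Dirichlet form `(𝓐, 𝓥)` on `L^2(E, μ)` and a
sub-Markovian `C_0`-semigroup of contractions `(U_t)` on `L^2(E, μ)` (with generator `Λ`) that
restricts to a `C_0`-semigroup of bounded operators on `𝓥`. -/
structure GeneralizedDirichletForm {E : Type*} [MeasurableSpace E] (μ : Measure E) where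
  A : L2Form μ
  dirichlet : A.IsDirichletForm
  U : C0ContractionSemigroup (Lp ℝ 2 μ)
  subMarkovian : IsSubMarkovian U
  /-- the restriction of `U_t` to `𝓥` -/
  UV : ℝ → A.dom →ₗ[ℝ] A.dom
  UV_eq : ∀ t : ℝ, 0 ≤ t → ∀ (u : A.dom) (f : Lp ℝ 2 μ), f.1 = u.1 → (UV t u).1 = (U.op t f).1
  UV_bounded : ∀ t : ℝ, 0 ≤ t → ∃ C : ℝ, ∀ u : A.dom,
    A.form1 (UV t u) (UV t u) ≤ C * A.form1 u u
  UV_tendsto : ∀ u : A.dom,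
    Tendsto (fun t => A.form1 (UV t u - u) (UV t u - u)) (𝓝[>] 0) (𝓝 0)

namespace GeneralizedDirichletForm

variable {E : Type*} [MeasurableSpace E] {μ : Measure E}

/-- `u ∈ 𝓕` and `Λ u = l ∈ 𝓥'`, where `(Λ, 𝓕)` is the closure of `Λ : D(Λ) ∩ 𝓥 → 𝓥'` as an operator
from `𝓥` to the dual space `𝓥'`. -/
def ClosureGenerator (𝓔 : GeneralizedDirichletForm μ) (u : 𝓔.A.dom) (l : 𝓔.A.dom →ₗ[ℝ] ℝ) : Prop :=
  ∃ (v : ℕ → 𝓔.A.dom) (f g : ℕ → Lp ℝ 2 μ),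
    (∀ k, (f k).1 = (v k).1 ∧ 𝓔.U.HasGenerator (f k) (g k)) ∧
    Tendsto (fun k => 𝓔.A.form1 (v k - u) (v k - u)) atTop (𝓝 0) ∧
    ∀ ε : ℝ, 0 < ε → ∀ᶠ k in atTop, ∀ w : 𝓔.A.dom,
      |∫ x, g k x * w.1 x ∂μ - l w| ≤ ε * Real.sqrt (𝓔.A.form1 w w)

/-- `(T_t)` is the semigroup on `L^2(E, μ)` associated with `𝓔`: it is a sub-Markovian
`C_0`-semigroup of contractions whose resolvent satisfies `G_α f ∈ 𝓕` and
`𝓔_α(G_α f, w) = 𝓐(G_α f, w) - ⟨Λ G_α f, w⟩ + α (G_α f, w) = (f, w)` for all `w ∈ 𝓥`. -/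
def IsAssociated (𝓔 : GeneralizedDirichletForm μ) (T : C0ContractionSemigroup (Lp ℝ 2 μ)) : Prop :=
  IsSubMarkovian T ∧
  ∀ α : ℝ, 0 < α → ∀ f : Lp ℝ 2 μ, ∃ (u : 𝓔.A.dom) (l : 𝓔.A.dom →ₗ[ℝ] ℝ),
    u.1 = (T.resolvent α f).1 ∧ 𝓔.ClosureGenerator u l ∧
    ∀ w : 𝓔.A.dom,
      𝓔.A.form u w - l w + α * ∫ x, u.1 x * w.1 x ∂μ = ∫ x, f x * w.1 x ∂μ

end GeneralizedDirichletForm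

/-! ### The hypotheses -/

section Hypotheses

variable {E : Type*} [MeasurableSpace E]

/-- (H1) for the exhausting sequence `(V_n)_{n ≥ 1}`: the `That n` are sub-Markovian semigroups on
`L^p(V_n, μ)`, and for non-negative `f ∈ L^1 ∩ L^∞` the functions `That^n_t (f 1_{V_n})`, extended
by zero, increase a.e. to the value at `f` of the adjoint of `T_t`. -/
def HypH1 {μ : Measure E} (T : C0ContractionSemigroup (Lp ℝ 2 μ)) (V : ℕ → Set E)
    (p : ℝ≥0∞) [Fact (1 ≤ p)]
    (That : ∀ n : ℕ, C0ContractionSemigroup (Lp ℝ p (μ.restrict (V n)))) : Prop :=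
  (∀ n, 1 ≤ n → IsSubMarkovian (That n)) ∧
  ∀ t : ℝ, 0 < t → ∀ f : Lp ℝ 2 μ, (∀ᵐ x ∂μ, 0 ≤ f x) → Integrable f μ → EssBdd μ f →
    ∀ fV : ∀ n : ℕ, Lp ℝ p (μ.restrict (V n)), (∀ n, fV n =ᵐ[μ.restrict (V n)] f) →
    ∀ᵐ x ∂μ,
      (∀ n, 1 ≤ n → (V n).indicator ((That n).op t (fV n)) x ≤
        (V (n + 1)).indicator ((That (n + 1)).op t (fV (n + 1))) x) ∧
      Tendsto (fun n => (V n).indicator ((That n).op t (fV n)) x) atTop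
        (𝓝 (ContinuousLinearMap.adjoint (T.op t) f x))

/-- The structural part of (H2): the linear operator `N` is defined at least on `D(E₀)_b`, has
values in `L^1_loc`, is local, has mean zero on `D(E₀)_{0,b}` and obeys the chain rule and the
product rule. -/
structure IsDivFreeDerivation [TopologicalSpace E] {μ : Measure E} (E₀ : L2Form μ)
    (N : (E →ₘ[μ] ℝ) →ₗ.[ℝ] (E →ₘ[μ] ℝ)) : Prop where
  mem_domain : ∀ u ∈ E₀.dom, EssBdd μ u → u ∈ N.domain
  locallyIntegrable : ∀ u : N.domain, LocallyIntegrable (N u) μ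
  isLocal : ∀ u : N.domain, u.1 ∈ E₀.dom → EssBdd μ u.1 → ∀ (B : Set E) (c : ℝ), MeasurableSet B →
    (∀ᵐ x ∂μ, x ∈ B → u.1 x = c) → ∀ᵐ x ∂μ, x ∈ B → N u x = 0
  integral_eq_zero : ∀ u : N.domain, u.1 ∈ E₀.dom → EssBdd μ u.1 →
    IsCompact (essSupport μ u.1) → ∫ x, N u x ∂μ = 0
  chain : ∀ (u w : N.domain) (φ : ℝ → ℝ), EssBdd μ u.1 → ContDiff ℝ 1 φ →
    (∃ C : ℝ, ∀ r, |φ r| ≤ C ∧ |deriv φ r| ≤ C) → (∀ᵐ x ∂μ, w.1 x = φ (u.1 x)) →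
    ∀ᵐ x ∂μ, N w x = deriv φ (u.1 x) * N u x
  product : ∀ u v w : N.domain, EssBdd μ u.1 → EssBdd μ v.1 →
    (∀ᵐ x ∂μ, w.1 x = u.1 x * v.1 x) →
    ∀ᵐ x ∂μ, N w x = v.1 x * N u x + u.1 x * N v x

/-- (H2): `N` is as above, every bounded function `v` in the domain of the generator `Lhat^n` of
`That n` belongs (extended by zero) to `D(E₀)_b`, and
`-∫_{V_n} (Lhat^n v) u dμ = ∫_E Γ(u, v) dμ + ∫_{V_n} u N v dμ`
for the bounded `u ∈ D(E₀)` that vanish a.e. outside `V_n`. -/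
def HypH2 [TopologicalSpace E] {μ : Measure E} (E₀ : L2Form μ)
    (Γ : E₀.dom →ₗ[ℝ] E₀.dom →ₗ[ℝ] (E →ₘ[μ] ℝ)) (N : (E →ₘ[μ] ℝ) →ₗ.[ℝ] (E →ₘ[μ] ℝ))
    (V : ℕ → Set E) (p : ℝ≥0∞) [Fact (1 ≤ p)]
    (That : ∀ n : ℕ, C0ContractionSemigroup (Lp ℝ p (μ.restrict (V n)))) : Prop :=
  IsDivFreeDerivation E₀ N ∧
  ∀ n, 1 ≤ n → ∀ f Lf : Lp ℝ p (μ.restrict (V n)), (That n).HasGenerator f Lf →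
    EssBdd (μ.restrict (V n)) f →
    ∃ (v : E₀.dom) (v' : N.domain), v'.1 = v.1 ∧ (∀ᵐ x ∂μ, v.1 x = (V n).indicator f x) ∧
      ∀ u : E₀.dom, EssBdd μ u.1 → (∀ᵐ x ∂μ, x ∉ V n → u.1 x = 0) →
        -∫ x in V n, Lf x * u.1 x ∂μ = ∫ x, Γ u v x ∂μ + ∫ x in V n, u.1 x * N v' x ∂μ

/-- `g ∈ L^∞_loc(W, μ)` for an open set `W`. -/
def EssBddLocOn [TopologicalSpace E] (μ : Measure E) (W : Set E) (g : E → ℝ) : Prop :=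
  ∀ S : Set E, IsCompact S → S ⊆ W → ∃ C : ℝ, ∀ᵐ x ∂μ, x ∈ S → |g x| ≤ C

/-- The set `E_r = {ρ < r}`. -/
def sublevel (ρ : E → ℝ) (r : ℝ) : Set E := {x | ρ x < r}

/-- (H3), where `Γρ = Γ(ρ, ρ)` and `Nρ = N(ρ)`. -/
structure HypH3 [TopologicalSpace E] {μ : Measure E} (E₀ : L2Form μ)
    (Γ : E₀.dom →ₗ[ℝ] E₀.dom →ₗ[ℝ] (E →ₘ[μ] ℝ)) (N : (E →ₘ[μ] ℝ) →ₗ.[ℝ] (E →ₘ[μ] ℝ))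
    (ρ : E → ℝ) (Γρ Nρ : E →ₘ[μ] ℝ) (K₀ : Set E) : Prop where
  continuous : Continuous ρ
  nonneg : ∀ x, 0 ≤ ρ x
  memLoc : E₀.MemDomLoc ρ
  compact_sublevel : ∀ r : ℝ, 0 < r → IsCompact (closure (sublevel ρ r))
  gamma : E₀.IsLocalGamma Γ ρ Γρ
  drift : E₀.IsLocalN N ρ Nρ
  compact_K₀ : IsCompact K₀
  gamma_bdd : EssBddLocOn μ K₀ᶜ Γρ
  drift_bdd : EssBddLocOn μ K₀ᶜ Nρ

/-- `k_f = min {m ∈ ℕ : supp f ⊆ E_m and K ⊆ E_m}`. -/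
def kIndex [TopologicalSpace E] (μ : Measure E) (ρ : E → ℝ) (K : Set E) (f : E → ℝ) : ℕ :=
  sInf {m : ℕ | essSupport μ f ⊆ sublevel ρ m ∧ K ⊆ sublevel ρ m}

/-- The set `D_0` of the bounded functions `f` with compact support such that
`That^n_s f ∈ D(Lhat^n)` for all `n ≥ k_f` and all `0 < s ≤ t`. -/
def domD0 [TopologicalSpace E] (μ : Measure E) (ρ : E → ℝ) (K : Set E) (V : ℕ → Set E)
    (p : ℝ≥0∞) [Fact (1 ≤ p)]
    (That : ∀ n : ℕ, C0ContractionSemigroup (Lp ℝ p (μ.restrict (V n)))) (t : ℝ) :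
    Set (Lp ℝ 1 μ) :=
  {f | EssBdd μ f ∧ IsCompact (essSupport μ f) ∧
    ∀ n, kIndex μ ρ K f ≤ n → ∀ s : ℝ, 0 < s → s ≤ t →
      ∀ fV : Lp ℝ p (μ.restrict (V n)), fV =ᵐ[μ.restrict (V n)] f →
        (That n).op s fV ∈ (That n).generatorDomain}

/-- `Ahat_n(φ) = (a_n^{1/2} + b_n) μ(E_{4n} \ E_{2n})^{1/2} + ‖N(ρ)‖_{L^2(E_{4n} \ E_{2n})}` with
`a_n` and `b_n` the essential suprema of `Γ(ρ, ρ)` and `φ'(ρ) Γ(ρ, ρ)` on `E_{4n} \ E_{2n}`,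
as an extended non-negative number. -/
def Ahat (μ : Measure E) (ρ Γρ Nρ : E → ℝ) (φ : ℝ → ℝ) (n : ℕ) : ℝ≥0∞ :=
  let ν := μ.restrict (sublevel ρ (4 * n) \ sublevel ρ (2 * n))
  ((essSup (fun x => ENNReal.ofReal (Γρ x)) ν) ^ (1 / 2 : ℝ) +
      essSup (fun x => ENNReal.ofReal (deriv φ (ρ x) * Γρ x)) ν) * (ν univ) ^ (1 / 2 : ℝ) +
    eLpNorm Nρ 2 ν

end Hypotheses

end

noncomputable section

/-! ### Dirichlet forms: closedness and truncations -/

namespace L2Form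

section Basic

variable {E : Type*} [MeasurableSpace E] {μ : Measure E}

/-- The inclusion of the domain of a form into `L^2`. -/
def toL2 (A : L2Form μ) : A.dom →ₗ[ℝ] Lp ℝ 2 μ where
  toFun u := ⟨u.1, Lp.mem_Lp_iff_memLp.2 (A.memLp u.1 u.2)⟩
  map_add' _ _ := rfl
  map_smul' _ _ := rfl

@[simp] lemma coe_toL2 (A : L2Form μ) (u : A.dom) : (A.toL2 u : E →ₘ[μ] ℝ) = u.1 := rfl

lemma form1_self (A : L2Form μ) (u : A.dom) : A.form1 u u = A.form u u + ‖A.toL2 u‖ ^ 2 := by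
  have h : ∫ x, u.1 x * u.1 x ∂μ = inner ℝ (A.toL2 u) (A.toL2 u) := by
    rw [L2.inner_def]; rfl
  rw [form1, h, real_inner_self_eq_norm_sq]

variable {A : L2Form μ}

lemma form_quadratic (hs : ∀ u v : A.dom, A.form u v = A.form v u) (u v : A.dom) (a b : ℝ) :
    A.form (a • u + b • v) (a • u + b • v) =
      a ^ 2 * A.form u u + 2 * a * b * A.form u v + b ^ 2 * A.form v v := by
  simp only [map_add, map_smul, LinearMap.add_apply, LinearMap.smul_apply, smul_eq_mul, hs v u]
  ring

lemma form_add_self_le (h : A.IsDirichletForm) (hs : ∀ u v : A.dom, A.form u v = A.form v u)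
    (u v : A.dom) : A.form (u + v) (u + v) ≤ 2 * A.form u u + 2 * A.form v v := by
  have h1 := form_quadratic hs u v 1 1
  have h2 := form_quadratic hs u v 1 (-1)
  have h3 := h.nonneg ((1 : ℝ) • u + (-1 : ℝ) • v)
  rw [h2] at h3
  simp only [one_smul] at h1
  rw [h1]; linarith

lemma form_sub_self_le (h : A.IsDirichletForm) (hs : ∀ u v : A.dom, A.form u v = A.form v u)
    (u v : A.dom) : A.form (u - v) (u - v) ≤ 2 * A.form u u + 2 * A.form v v := by
  have := form_add_self_le h hs u (-v)
  simpa [sub_eq_add_neg] using this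

lemma convex_form_le (h : A.IsDirichletForm) (hs : ∀ u v : A.dom, A.form u v = A.form v u)
    (c : ℝ) : Convex ℝ {u : A.dom | A.form u u ≤ c} := by
  intro u hu v hv a b ha hb hab
  simp only [mem_ofPred_eq] at hu hv ⊢
  have h1 := form_quadratic hs u v a b
  have h2 := form_quadratic hs u v 1 (-1)
  have h3 := h.nonneg ((1 : ℝ) • u + (-1 : ℝ) • v)
  rw [h2] at h3
  rw [h1]
  have hb' : b = 1 - a := by linarith
  subst hb'
  nlinarith [mul_nonneg ha hb, mul_nonneg (mul_nonneg ha hb) h3, mul_le_mul_of_nonneg_left hu ha,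
    mul_le_mul_of_nonneg_left hv hb]

/-- Closedness of a Dirichlet form, with the limit identified in `L^2`. -/
lemma exists_of_cauchy (h : A.IsDirichletForm) (u : ℕ → A.dom) (f : Lp ℝ 2 μ)
    (hu : ∀ ε : ℝ, 0 < ε → ∃ k : ℕ, ∀ m ≥ k, ∀ n ≥ k, A.form (u m - u n) (u m - u n) < ε)
    (hf : Tendsto (fun n => A.toL2 (u n)) atTop (𝓝 f)) :
    ∃ w : A.dom, w.1 = f.1 ∧ Tendsto (fun n => A.form (u n - w) (u n - w)) atTop (𝓝 0) := by
  obtain ⟨w, hw⟩ := h.complete u (by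
    intro ε hε
    obtain ⟨k, hk⟩ := hu (ε / 2) (by positivity)
    have hc : CauchySeq (fun n => A.toL2 (u n)) := hf.cauchySeq
    rw [Metric.cauchySeq_iff] at hc
    obtain ⟨l, hl⟩ := hc (Real.sqrt (ε / 2)) (by positivity)
    refine ⟨max k l, fun m hm n hn => ?_⟩
    have h1 := hk m (le_of_max_le_left hm) n (le_of_max_le_left hn)
    have h2 := hl m (le_of_max_le_right hm) n (le_of_max_le_right hn)
    rw [form1_self, map_sub]
    rw [dist_eq_norm] at h2
    have h3 : ‖A.toL2 (u m) - A.toL2 (u n)‖ ^ 2 < Real.sqrt (ε / 2) ^ 2 :=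
      pow_lt_pow_left₀ h2 (norm_nonneg _) (by norm_num)
    rw [Real.sq_sqrt (by positivity)] at h3
    simp only [map_sub, LinearMap.sub_apply] at h1 ⊢
    linarith)
  simp only [form1_self] at hw
  have h1 : Tendsto (fun n => ‖A.toL2 (u n - w)‖ ^ 2) atTop (𝓝 0) :=
    squeeze_zero (fun n => by positivity)
      (fun n => by linarith [h.nonneg (u n - w)]) hw
  have h2 : Tendsto (fun n => A.toL2 (u n)) atTop (𝓝 (A.toL2 w)) := by
    rw [tendsto_iff_norm_sub_tendsto_zero]
    have := (Real.continuous_sqrt.tendsto 0).comp h1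
    simpa [Function.comp_def, Real.sqrt_sq (norm_nonneg _)] using this
  refine ⟨w, ?_, squeeze_zero (fun n => h.nonneg _)
      (fun n => by linarith [sq_nonneg ‖A.toL2 (u n - w)‖]) hw⟩
  have := tendsto_nhds_unique h2 hf
  rw [← this]; rfl

/-- If a sequence in a convex set that is closed in the form norm is bounded for the form and
converges in `L^2`, then its limit belongs to the set. -/
theorem exists_mem_of_bounded (h : A.IsDirichletForm)
    (hs : ∀ u v : A.dom, A.form u v = A.form v u) (u : ℕ → A.dom) (f : Lp ℝ 2 μ) (C : ℝ)
    (hC : ∀ n, A.form (u n) (u n) ≤ C)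
    (hf : Tendsto (fun n => A.toL2 (u n)) atTop (𝓝 f)) (P : Set A.dom) (hP : Convex ℝ P)
    (hPc : ∀ (v : ℕ → A.dom) (w : A.dom), (∀ n, v n ∈ P) →
      Tendsto (fun n => A.form (v n - w) (v n - w)) atTop (𝓝 0) → w ∈ P)
    (huP : ∀ n, u n ∈ P) : ∃ w ∈ P, w.1 = f.1 ∧ A.form w w ≤ C := by
  let S : ℕ → Set A.dom := fun n => convexHull ℝ (u '' Ici n)
  have hSanti : ∀ {m n}, m ≤ n → S n ⊆ S m := fun hmn =>
    convexHull_mono (image_mono (Ici_subset_Ici.2 hmn))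
  have hSC : ∀ n, ∀ x ∈ S n, A.form x x ≤ C := fun n =>
    convexHull_min (by rintro _ ⟨k, -, rfl⟩; exact hC k) (convex_form_le h hs C)
  have hSP : ∀ n, S n ⊆ P := fun n => convexHull_min (by rintro _ ⟨k, -, rfl⟩; exact huP k) hP
  have hne : ∀ n, ((fun x => A.form x x) '' S n).Nonempty := fun n =>
    ⟨_, u n, subset_convexHull _ _ ⟨n, le_refl n, rfl⟩, rfl⟩
  have hbdd : ∀ n, BddBelow ((fun x => A.form x x) '' S n) := fun n =>
    ⟨0, by rintro _ ⟨x, -, rfl⟩; exact h.nonneg x⟩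
  let d : ℕ → ℝ := fun n => sInf ((fun x => A.form x x) '' S n)
  have hd_le : ∀ n, ∀ x ∈ S n, d n ≤ A.form x x := fun n x hx => csInf_le (hbdd n) ⟨x, hx, rfl⟩
  have hdmono : Monotone d := fun m n hmn =>
    csInf_le_csInf (hbdd m) (hne n) (image_mono (hSanti hmn))
  have hdC : ∀ n, d n ≤ C := fun n => by
    obtain ⟨_, x, hx, rfl⟩ := hne n
    exact (hd_le n x hx).trans (hSC n x hx)
  obtain ⟨d0, hd0⟩ : ∃ d0, Tendsto d atTop (𝓝 d0) :=
    ⟨_, tendsto_atTop_ciSup hdmono ⟨C, by rintro _ ⟨n, rfl⟩; exact hdC n⟩⟩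
  have hex : ∀ n, ∃ x ∈ S n, A.form x x < d n + 1 / ((n : ℝ) + 1) := fun n => by
    obtain ⟨_, ⟨x, hx, rfl⟩, hlt⟩ := exists_lt_of_csInf_lt (hne n)
      (show sInf ((fun x => A.form x x) '' S n) < d n + 1 / ((n : ℝ) + 1) by
        have : (0 : ℝ) < 1 / ((n : ℝ) + 1) := by positivity
        linarith)
    exact ⟨x, hx, hlt⟩
  choose w hwS hw using hex
  have hinv : Tendsto (fun n : ℕ => 1 / ((n : ℝ) + 1)) atTop (𝓝 0) :=
    tendsto_one_div_add_atTop_nhds_zero_nat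
  have hpar : ∀ k, ∀ m ≥ k, ∀ n ≥ k, A.form (w m - w n) (w m - w n) ≤
      2 * (d m + 1 / ((m : ℝ) + 1)) + 2 * (d n + 1 / ((n : ℝ) + 1)) - 4 * d k := by
    intro k m hm n hn
    have hmid : (1 / 2 : ℝ) • w m + (1 / 2 : ℝ) • w n ∈ S k :=
      convex_convexHull ℝ _ (hSanti hm (hwS m)) (hSanti hn (hwS n)) (by norm_num) (by norm_num)
        (by norm_num)
    have h1 := hd_le k _ hmid
    rw [form_quadratic hs] at h1
    have h2 := form_quadratic hs (w m) (w n) 1 (-1)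
    have h3 : (1 : ℝ) • w m + (-1 : ℝ) • w n = w m - w n := by module
    rw [h3] at h2
    rw [h2]
    linarith [hw m, hw n]
  obtain ⟨x, hxf, hx⟩ := exists_of_cauchy h w f (by
    intro ε hε
    have e1 : ∀ᶠ n in atTop, dist (d n) d0 < ε / 16 := Metric.tendsto_nhds.1 hd0 _ (by positivity)
    have e2 : ∀ᶠ n : ℕ in atTop, 1 / ((n : ℝ) + 1) < ε / 16 :=
      hinv.eventually_lt_const (by positivity)
    obtain ⟨k, hk⟩ := eventually_atTop.1 (e1.and e2)
    refine ⟨k, fun m hm n hn => (hpar k m hm n hn).trans_lt ?_⟩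
    have a1 := abs_lt.1 (hk k le_rfl).1
    have a2 := abs_lt.1 (hk m hm).1
    have a3 := abs_lt.1 (hk n hn).1
    linarith [(hk m hm).2, (hk n hn).2, a1.1, a2.2, a3.2]) (by
    rw [Metric.tendsto_atTop] at hf ⊢
    intro ε hε
    obtain ⟨k, hk⟩ := hf (ε / 2) (by positivity)
    refine ⟨k, fun n hn => ?_⟩
    have hsub : S n ⊆ A.toL2 ⁻¹' Metric.closedBall f (ε / 2) :=
      convexHull_min (by
        rintro _ ⟨j, hj, rfl⟩
        exact (hk j (hn.le.trans hj)).le)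
        ((convex_closedBall f (ε / 2)).is_linear_preimage A.toL2.isLinear)
    exact (Metric.mem_closedBall.1 (hsub (hwS n))).trans_lt (by linarith))
  have hxP : ∀ c, (∀ n, w n ∈ {u : A.dom | A.form u u ≤ c}) → A.form x x ≤ c := by
    intro c hc
    refine le_of_forall_pos_le_add fun δ hδ => ?_
    -- the triangle inequality in the weighted form
    have key : ∀ η : ℝ, 0 < η → A.form x x ≤ (1 + η) * c := by
      intro η hη
      have hlim : Tendsto (fun n => (1 + η) * c + (1 + 1 / η) * A.form (w n - x) (w n - x)) atTop
          (𝓝 ((1 + η) * c + (1 + 1 / η) * 0)) := (hx.const_mul _).const_add _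
      rw [mul_zero, add_zero] at hlim
      refine ge_of_tendsto' hlim fun n => ?_
      have q1 := form_quadratic hs (w n) (w n - x) 1 (-1)
      have q2 := form_quadratic hs (w n) (w n - x) η 1
      have e1 : (1 : ℝ) • w n + (-1 : ℝ) • (w n - x) = x := by module
      have q3 := h.nonneg (η • w n + (1 : ℝ) • (w n - x))
      rw [e1] at q1
      rw [q2] at q3
      have := hc n
      simp only [mem_ofPred_eq] at this
      have q4 : 0 ≤ η * A.form (w n) (w n) + 2 * A.form (w n) (w n - x) +
          1 / η * A.form (w n - x) (w n - x) := by
        have : η * A.form (w n) (w n) + 2 * A.form (w n) (w n - x) +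
          1 / η * A.form (w n - x) (w n - x) = (1 / η) * (η ^ 2 * A.form (w n) (w n) +
            2 * η * 1 * A.form (w n) (w n - x) + 1 ^ 2 * A.form (w n - x) (w n - x)) := by
          field_simp
        rw [this]; positivity
      rw [q1]
      nlinarith [mul_le_mul_of_nonneg_left this hη.le]
    have hc0 : 0 ≤ c := (h.nonneg _).trans (hc 0)
    have := key (δ / (c + 1)) (by positivity)
    have h4 : δ / (c + 1) * c ≤ δ := by
      rw [div_mul_eq_mul_div, div_le_iff₀ (by positivity)]; nlinarith
    linarith
  exact ⟨x, hPc w x (fun n => hSP n (hwS n)) hx, hxf, hxP C fun n => hSC n _ (hwS n)⟩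

theorem exists_of_bounded (h : A.IsDirichletForm)
    (hs : ∀ u v : A.dom, A.form u v = A.form v u) (u : ℕ → A.dom) (f : Lp ℝ 2 μ) (C : ℝ)
    (hC : ∀ n, A.form (u n) (u n) ≤ C)
    (hf : Tendsto (fun n => A.toL2 (u n)) atTop (𝓝 f)) : ∃ w : A.dom, w.1 = f.1 := by
  obtain ⟨w, -, hw, -⟩ := exists_mem_of_bounded h hs u f C hC hf univ convex_univ
    (fun _ _ _ _ => mem_univ _) (fun _ => mem_univ _)
  exact ⟨w, hw⟩

lemma ae_add (u v : A.dom) : ∀ᵐ x ∂μ, (u + v).1 x = u.1 x + v.1 x := by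
  filter_upwards [AEEqFun.coeFn_add u.1 v.1] with x hx using hx

lemma ae_sub (u v : A.dom) : ∀ᵐ x ∂μ, (u - v).1 x = u.1 x - v.1 x := by
  filter_upwards [AEEqFun.coeFn_sub u.1 v.1] with x hx using hx

lemma ae_smul (c : ℝ) (u : A.dom) : ∀ᵐ x ∂μ, (c • u).1 x = c * u.1 x := by
  filter_upwards [AEEqFun.coeFn_smul c u.1] with x hx using hx

lemma ae_neg (u : A.dom) : ∀ᵐ x ∂μ, (-u).1 x = -u.1 x := by
  filter_upwards [AEEqFun.coeFn_neg u.1] with x hx using hx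

/-- Truncation of a function in the domain. -/
lemma exists_clamp (h : A.IsDirichletForm) (hs : ∀ u v : A.dom, A.form u v = A.form v u)
    (u : A.dom) {c : ℝ} (hc : 0 ≤ c) :
    ∃ w : A.dom, (∀ᵐ x ∂μ, w.1 x = min (max (u.1 x) 0) c) ∧ A.form w w ≤ A.form u u := by
  rcases hc.eq_or_lt with rfl | hc
  · refine ⟨0, ?_, by simpa using h.nonneg u⟩
    filter_upwards [AEEqFun.coeFn_zero (μ := μ) (β := ℝ) (α := E)] with x hx
    rw [min_eq_right (le_max_right _ _)]; exact hx
  · obtain ⟨w, hw, h1, -⟩ := h.contraction (c⁻¹ • u)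
    refine ⟨c • w, ?_, ?_⟩
    · filter_upwards [hw, ae_smul c w, ae_smul c⁻¹ u] with x h1 h2 h3
      rw [h2, h1, h3, mul_min_of_nonneg _ _ hc.le, mul_max_of_nonneg _ _ hc.le]
      field_simp
      simp
    · have h2 : A.form (c⁻¹ • u + w) (c⁻¹ • u - w) =
          (c⁻¹) ^ 2 * A.form u u - A.form w w := by
        simp only [map_add, map_sub, map_smul, LinearMap.add_apply, LinearMap.smul_apply,
          smul_eq_mul, hs w u]
        ring
      rw [h2] at h1
      simp only [map_smul, LinearMap.smul_apply, smul_eq_mul]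
      have h3 : c ^ 2 * ((c⁻¹) ^ 2 * A.form u u - A.form w w) =
          A.form u u - c * (c * A.form w w) := by field_simp
      nlinarith [mul_nonneg (sq_nonneg c) h1]

/-- `L^2`-convergence from a pointwise bound. -/
lemma tendsto_toL2_of_le {u : ℕ → A.dom} {f g : Lp ℝ 2 μ} {ε : ℕ → ℝ}
    (hε : Tendsto ε atTop (𝓝 0)) (h : ∀ n, ∀ᵐ x ∂μ, |(u n).1 x - f x| ≤ ε n * |g x|) :
    Tendsto (fun n => A.toL2 (u n)) atTop (𝓝 f) := by
  rw [tendsto_iff_norm_sub_tendsto_zero]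
  have h1 : Tendsto (fun n => ε n * ‖g‖) atTop (𝓝 0) := by simpa using hε.mul_const ‖g‖
  refine squeeze_zero (fun n => norm_nonneg _) (fun n => ?_) h1
  refine Lp.norm_le_mul_norm_of_ae_le_mul ?_
  filter_upwards [h n, Lp.coeFn_sub (A.toL2 (u n)) f] with x hx h2
  rw [h2]
  simpa using hx

/-- The square of a bounded non-negative function in the domain belongs to the domain. -/
lemma exists_sq_of_nonneg (h : A.IsDirichletForm) (hs : ∀ u v : A.dom, A.form u v = A.form v u)
    (u : A.dom) (h0 : ∀ᵐ x ∂μ, 0 ≤ u.1 x) {B : ℝ} (hB : 0 < B) (hu : ∀ᵐ x ∂μ, u.1 x ≤ B) :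
    ∃ w : A.dom, ∀ᵐ x ∂μ, w.1 x = u.1 x * u.1 x := by
  have hex : ∀ s : ℝ, 0 ≤ s → ∃ w : A.dom, (∀ᵐ x ∂μ, w.1 x = max (u.1 x - s) 0) ∧
      A.form w w ≤ 4 * A.form u u := by
    intro s hs0
    obtain ⟨w, hw, hw'⟩ := exists_clamp h hs u hs0
    refine ⟨u - w, ?_, by linarith [form_sub_self_le h hs u w]⟩
    filter_upwards [hw, ae_sub u w, h0] with x h1 h2 h3
    rw [h2, h1, max_eq_left h3]
    rcases le_total (u.1 x) s with h4 | h4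
    · rw [min_eq_left h4, max_eq_right (by linarith)]; ring
    · rw [min_eq_right h4, max_eq_left (by linarith)]
  choose! V hV hVC using hex
  have hstep : ∀ n : ℕ, ∃ w : A.dom, A.form w w ≤ 4 * A.form u u ∧
      ∀ᵐ x ∂μ, |2 * B * w.1 x - u.1 x * u.1 x| ≤ 2 * B / ((n : ℝ) + 1) * u.1 x := by
    intro n
    have hn : (0 : ℝ) < (n : ℝ) + 1 := by positivity
    refine ⟨∑ k ∈ Finset.range (n + 1), (1 / ((n : ℝ) + 1)) • V (k * (B / ((n : ℝ) + 1))), ?_, ?_⟩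
    · refine (convex_form_le h hs (4 * A.form u u)).sum_mem (fun _ _ => by positivity) ?_
        fun k _ => hVC _ (by positivity)
      simp; field_simp
    · have hsum : ∀ m : ℕ, ∀ᵐ x ∂μ, (∑ k ∈ Finset.range m, (1 / ((n : ℝ) + 1)) •
          V (k * (B / ((n : ℝ) + 1)))).1 x =
          ∑ k ∈ Finset.range m, 1 / ((n : ℝ) + 1) * max (u.1 x - k * (B / ((n : ℝ) + 1))) 0 := by
        intro m
        induction m with
        | zero =>
          filter_upwards [AEEqFun.coeFn_zero (μ := μ) (β := ℝ) (α := E)] with x hx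
          simpa using hx
        | succ m ih =>
          rw [Finset.sum_range_succ]
          filter_upwards [ih, ae_add (∑ k ∈ Finset.range m, (1 / ((n : ℝ) + 1)) •
            V (k * (B / ((n : ℝ) + 1)))) ((1 / ((n : ℝ) + 1)) • V (m * (B / ((n : ℝ) + 1)))),
            ae_smul (1 / ((n : ℝ) + 1)) (V (m * (B / ((n : ℝ) + 1)))),
            hV (m * (B / ((n : ℝ) + 1))) (by positivity)] with x h1 h2 h3 h4
          rw [Finset.sum_range_succ, h2, h1, h3, h4]
      filter_upwards [hsum (n + 1), h0, hu] with x h1 h2 h3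
      rw [h1]
      set y := u.1 x
      set δ := B / ((n : ℝ) + 1) with hδ
      have hδ0 : 0 < δ := by positivity
      -- compare with the telescoping sum of the squares of `max (y - k δ) 0`
      have key : ∀ k : ℕ, |2 * δ * max (y - k * δ) 0 -
          (max (y - k * δ) 0 ^ 2 - max (y - (k + 1 : ℕ) * δ) 0 ^ 2)| ≤
          2 * δ * (max (y - k * δ) 0 - max (y - (k + 1 : ℕ) * δ) 0) := by
        intro k
        push_cast
        have e : y - ((k : ℝ) + 1) * δ = y - k * δ - δ := by ring
        rw [e]
        generalize y - k * δ = z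
        rcases le_total z 0 with hz | hz
        · rw [max_eq_right hz, max_eq_right (by linarith)]; simp
        · rw [max_eq_left hz]
          rcases le_total z δ with hz' | hz'
          · rw [max_eq_right (by linarith), abs_le]; constructor <;> nlinarith
          · rw [max_eq_left (by linarith), abs_le]; constructor <;> nlinarith
      have tel1 : ∑ k ∈ Finset.range (n + 1), (max (y - k * δ) 0 ^ 2 -
          max (y - (k + 1 : ℕ) * δ) 0 ^ 2) = y * y := by
        rw [Finset.sum_range_sub' (fun k : ℕ => max (y - k * δ) 0 ^ 2)]
        have e : y - ((n + 1 : ℕ) : ℝ) * δ ≤ 0 := by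
          rw [hδ]; push_cast; field_simp; linarith
        rw [max_eq_right e]
        simp [max_eq_left h2]; ring
      have tel2 : ∑ k ∈ Finset.range (n + 1), (max (y - k * δ) 0 -
          max (y - (k + 1 : ℕ) * δ) 0) = y := by
        rw [Finset.sum_range_sub' (fun k : ℕ => max (y - k * δ) 0)]
        have e : y - ((n + 1 : ℕ) : ℝ) * δ ≤ 0 := by
          rw [hδ]; push_cast; field_simp; linarith
        rw [max_eq_right e]
        simp [max_eq_left h2]
      have e1 : 2 * B * ∑ k ∈ Finset.range (n + 1), 1 / ((n : ℝ) + 1) * max (y - k * δ) 0 -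
          y * y = ∑ k ∈ Finset.range (n + 1), (2 * δ * max (y - k * δ) 0 -
          (max (y - k * δ) 0 ^ 2 - max (y - (k + 1 : ℕ) * δ) 0 ^ 2)) := by
        rw [Finset.sum_sub_distrib, tel1, Finset.mul_sum]
        congr 1
        refine Finset.sum_congr rfl fun k _ => ?_
        rw [hδ]; field_simp
      rw [e1]
      refine (Finset.abs_sum_le_sum_abs _ _).trans ((Finset.sum_le_sum fun k _ => key k).trans ?_)
      rw [← Finset.mul_sum, tel2]
      exact le_of_eq (by rw [hδ]; ring)
  choose w hwC hw using hstep
  have hmem : MemLp (fun x => u.1 x * u.1 x) 2 μ := by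
    refine MemLp.of_le_mul (c := B) (A.memLp u.1 u.2)
      (u.1.aestronglyMeasurable.mul u.1.aestronglyMeasurable) ?_
    filter_upwards [h0, hu] with x h1 h2
    rw [norm_mul]
    gcongr
    rw [Real.norm_of_nonneg h1]; exact h2
  have hlim : Tendsto (fun n : ℕ => 2 * B / ((n : ℝ) + 1)) atTop (𝓝 0) := by
    have := (tendsto_one_div_add_atTop_nhds_zero_nat (𝕜 := ℝ)).const_mul (2 * B)
    simpa only [mul_one_div, mul_zero] using this
  obtain ⟨v, hv⟩ := exists_of_bounded h hs (fun n => (2 * B) • w n) hmem.toLp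
    ((2 * B) ^ 2 * (4 * A.form u u)) (fun n => by
      have := mul_le_mul_of_nonneg_left (hwC n) (sq_nonneg (2 * B))
      simp only [map_smul, LinearMap.smul_apply, smul_eq_mul]
      nlinarith) (tendsto_toL2_of_le (g := A.toL2 u) hlim fun n => by
      filter_upwards [hw n, ae_smul (2 * B) (w n), hmem.coeFn_toLp, h0] with x h1 h2 h3 h4
      rw [h2, h3]
      refine h1.trans (le_of_eq ?_)
      have : |(A.toL2 u) x| = u.1 x := abs_of_nonneg h4
      rw [this])
  refine ⟨v, ?_⟩
  filter_upwards [hmem.coeFn_toLp] with x hx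
  rw [hv]; exact hx

lemma exists_sq (h : A.IsDirichletForm) (hs : ∀ u v : A.dom, A.form u v = A.form v u)
    (u : A.dom) (hb : EssBdd μ u.1) : ∃ w : A.dom, ∀ᵐ x ∂μ, w.1 x = u.1 x * u.1 x := by
  obtain ⟨C, hC⟩ := hb
  have hB : 0 < |C| + 1 := by positivity
  obtain ⟨p, hp, -⟩ := exists_clamp h hs u hB.le
  obtain ⟨q, hq, -⟩ := exists_clamp h hs (-u) hB.le
  obtain ⟨p2, hp2⟩ := exists_sq_of_nonneg h hs p
    (hp.mono fun x hx => hx ▸ le_min (le_max_right _ _) hB.le) hB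
    (hp.mono fun x hx => hx ▸ min_le_right _ _)
  obtain ⟨q2, hq2⟩ := exists_sq_of_nonneg h hs q
    (hq.mono fun x hx => hx ▸ le_min (le_max_right _ _) hB.le) hB
    (hq.mono fun x hx => hx ▸ min_le_right _ _)
  refine ⟨p2 + q2, ?_⟩
  filter_upwards [hC, hp, hq, hp2, hq2, ae_neg u, ae_add p2 q2] with x h1 h2 h3 h4 h5 h6 h7
  rw [h7, h4, h5, h2, h3, h6]
  have h8 := (abs_le.1 (h1.trans (le_abs_self C)))
  rcases le_total 0 (u.1 x) with h9 | h9
  · rw [max_eq_left h9, max_eq_right (by linarith), min_eq_left (by linarith), min_eq_left hB.le]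
    ring
  · rw [max_eq_right h9, max_eq_left (by linarith), min_eq_left hB.le, min_eq_left (by linarith)]
    ring

/-- The bounded functions in the domain of a symmetric Dirichlet form are an algebra. -/
lemma exists_mul (h : A.IsDirichletForm) (hs : ∀ u v : A.dom, A.form u v = A.form v u)
    (u v : A.dom) (hu : EssBdd μ u.1) (hv : EssBdd μ v.1) :
    ∃ w : A.dom, ∀ᵐ x ∂μ, w.1 x = u.1 x * v.1 x := by
  have hb : ∀ c : ℝ, EssBdd μ (u + c • v).1 := by
    intro c
    obtain ⟨C, hC⟩ := hu
    obtain ⟨D, hD⟩ := hv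
    refine ⟨C + |c| * D, ?_⟩
    filter_upwards [hC, hD, ae_add u (c • v), ae_smul c v] with x h1 h2 h3 h4
    rw [h3, h4]
    refine (abs_add_le _ _).trans ?_
    rw [abs_mul]; gcongr
  obtain ⟨p, hp⟩ := exists_sq h hs _ (hb 1)
  obtain ⟨q, hq⟩ := exists_sq h hs _ (hb (-1))
  refine ⟨(1 / 4 : ℝ) • (p - q), ?_⟩
  filter_upwards [hp, hq, ae_add u ((1 : ℝ) • v), ae_add u ((-1 : ℝ) • v), ae_smul 1 v,
    ae_smul (-1) v, ae_smul (1 / 4) (p - q), ae_sub p q] with x h1 h2 h3 h4 h5 h6 h7 h8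
  rw [h7, h8, h1, h2, h3, h4, h5, h6]
  ring

end Basic

end L2Form

end

noncomputable section

lemma essSupport_subset_of_isClosed {E : Type*} [MeasurableSpace E] [TopologicalSpace E]
    [OpensMeasurableSpace E] {μ : Measure E} {u : E → ℝ} {S : Set E} (hS : IsClosed S)
    (h : ∀ᵐ x ∂μ, x ∉ S → u x = 0) : essSupport μ u ⊆ S := by
  refine Measure.support_subset_of_isClosed hS ?_
  rw [mem_ae_iff, withDensity_apply _ hS.measurableSet.compl]
  have : ∀ᵐ x ∂μ.restrict Sᶜ, ‖u x‖ₑ = 0 := by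
    rw [ae_restrict_iff' hS.measurableSet.compl]
    filter_upwards [h] with x hx hx'
    rw [hx hx', enorm_zero]
  rw [lintegral_congr_ae this, lintegral_zero]

/-! ### The carré du champ: Cauchy-Schwarz, locality and truncation -/

namespace L2Form

section Gamma

variable {E : Type*} [MeasurableSpace E] {μ : Measure E} {A : L2Form μ}
  {Γ : A.dom →ₗ[ℝ] A.dom →ₗ[ℝ] (E →ₘ[μ] ℝ)}

lemma gamma_add_left (u v g : A.dom) : ∀ᵐ x ∂μ, Γ (u + v) g x = Γ u g x + Γ v g x := by
  rw [map_add, LinearMap.add_apply]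
  filter_upwards [AEEqFun.coeFn_add (Γ u g) (Γ v g)] with x hx using hx

lemma gamma_sub_left (u v g : A.dom) : ∀ᵐ x ∂μ, Γ (u - v) g x = Γ u g x - Γ v g x := by
  rw [map_sub, LinearMap.sub_apply]
  filter_upwards [AEEqFun.coeFn_sub (Γ u g) (Γ v g)] with x hx using hx

lemma gamma_smul_left (c : ℝ) (u g : A.dom) : ∀ᵐ x ∂μ, Γ (c • u) g x = c * Γ u g x := by
  rw [map_smul, LinearMap.smul_apply]
  filter_upwards [AEEqFun.coeFn_smul c (Γ u g)] with x hx using hx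

lemma gamma_neg_left (u g : A.dom) : ∀ᵐ x ∂μ, Γ (-u) g x = -Γ u g x := by
  rw [map_neg, LinearMap.neg_apply]
  filter_upwards [AEEqFun.coeFn_neg (Γ u g)] with x hx using hx

lemma gamma_smul_add_left (a b : ℝ) (u v g : A.dom) :
    ∀ᵐ x ∂μ, Γ (a • u + b • v) g x = a * Γ u g x + b * Γ v g x := by
  filter_upwards [gamma_add_left (Γ := Γ) (a • u) (b • v) g, gamma_smul_left (Γ := Γ) a u g,
    gamma_smul_left (Γ := Γ) b v g] with x h1 h2 h3
  rw [h1, h2, h3]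

lemma gamma_quadratic (hΓ : A.IsCarreDuChamp Γ) (a b : ℝ) (u v : A.dom) :
    ∀ᵐ x ∂μ, Γ (a • u + b • v) (a • u + b • v) x =
      a ^ 2 * Γ u u x + 2 * a * b * Γ u v x + b ^ 2 * Γ v v x := by
  have h1 := gamma_smul_add_left (Γ := Γ) a b u v (a • u + b • v)
  have h2 := gamma_smul_add_left (Γ := Γ) a b u v u
  have h3 := gamma_smul_add_left (Γ := Γ) a b u v v
  rw [hΓ.symm _ u] at h2
  rw [hΓ.symm _ v] at h3
  filter_upwards [h1, h2, h3] with x h1 h2 h3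
  rw [h1, h2, h3, hΓ.symm v u]; ring

/-- The Cauchy-Schwarz inequality for the carré du champ. -/
lemma gamma_cauchy_schwarz (hΓ : A.IsCarreDuChamp Γ) (u v : A.dom) :
    ∀ᵐ x ∂μ, Γ u v x ^ 2 ≤ Γ u u x * Γ v v x := by
  have h : ∀ᵐ x ∂μ, ∀ q : ℚ, 0 ≤ Γ u u x + 2 * q * Γ u v x + q ^ 2 * Γ v v x := by
    rw [ae_all_iff]
    intro q
    filter_upwards [gamma_quadratic hΓ 1 q u v, hΓ.nonneg ((1 : ℝ) • u + (q : ℝ) • v)]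
      with x h1 h2
    rw [h1] at h2
    linarith
  filter_upwards [h] with x hx
  have hall : ∀ r : ℝ, 0 ≤ Γ v v x * (r * r) + 2 * Γ u v x * r + Γ u u x := by
    intro r
    have hcl : IsClosed {r : ℝ | 0 ≤ Γ v v x * (r * r) + 2 * Γ u v x * r + Γ u u x} :=
      isClosed_le continuous_const (by fun_prop)
    have hsub : closure (range ((↑) : ℚ → ℝ)) ⊆
        {r : ℝ | 0 ≤ Γ v v x * (r * r) + 2 * Γ u v x * r + Γ u u x} :=
      closure_minimal (by
        rintro _ ⟨q, rfl⟩
        have := hx q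
        simp only [mem_ofPred_eq]; linarith) hcl
    exact hsub ((Rat.denseRange_cast (𝕜 := ℝ)) r)
  have := discrim_le_zero hall
  rw [discrim] at this
  linarith

lemma gamma_eq_zero_on (hΓ : A.IsCarreDuChamp Γ) {u : A.dom} {S : Set E}
    (h : ∀ᵐ x ∂μ, x ∈ S → Γ u u x = 0) (g : A.dom) : ∀ᵐ x ∂μ, x ∈ S → Γ u g x = 0 := by
  filter_upwards [h, gamma_cauchy_schwarz hΓ u g] with x h1 h2 hx
  rw [h1 hx, zero_mul] at h2
  exact pow_eq_zero_iff (two_ne_zero) |>.1 (le_antisymm h2 (sq_nonneg _))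

lemma gamma_congr_on (hΓ : A.IsCarreDuChamp Γ) {u v : A.dom} {S : Set E}
    (h : ∀ᵐ x ∂μ, x ∈ S → Γ (u - v) (u - v) x = 0) (g : A.dom) :
    ∀ᵐ x ∂μ, x ∈ S → Γ u g x = Γ v g x := by
  filter_upwards [gamma_eq_zero_on hΓ h g, gamma_sub_left (Γ := Γ) u v g] with x h1 h2 hx
  have := h1 hx
  rw [h2] at this; linarith

lemma gamma_self_congr_on (hΓ : A.IsCarreDuChamp Γ) {u v : A.dom} {S : Set E}
    (h : ∀ᵐ x ∂μ, x ∈ S → Γ (u - v) (u - v) x = 0) :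
    ∀ᵐ x ∂μ, x ∈ S → Γ u u x = Γ v v x := by
  have h2 := gamma_congr_on hΓ h v
  rw [hΓ.symm u v] at h2
  filter_upwards [gamma_congr_on hΓ h u, h2] with x h1 h2 hx
  rw [h1 hx, h2 hx]

lemma convex_gamma_zero (hΓ : A.IsCarreDuChamp Γ) (S : Set E) (z : A.dom) :
    Convex ℝ {u : A.dom | ∀ᵐ x ∂μ, x ∈ S → Γ (u - z) (u - z) x = 0} := by
  intro u hu v hv a b _ _ hab
  have e : a • u + b • v - z = a • (u - z) + b • (v - z) := by
    rw [show a • u + b • v - z = a • u + b • v - (a + b) • z by rw [hab, one_smul]]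
    module
  simp only [mem_ofPred_eq] at hu hv ⊢
  rw [e]
  filter_upwards [hu, hv, gamma_eq_zero_on hΓ hu (v - z), gamma_quadratic hΓ a b (u - z) (v - z)]
    with x h1 h2 h3 h4 hx
  rw [h4, h1 hx, h2 hx, h3 hx]; ring

lemma closed_gamma_zero (hΓ : A.IsCarreDuChamp Γ) {S : Set E} (hS : MeasurableSet S) (z : A.dom)
    (v : ℕ → A.dom) (w : A.dom) (hv : ∀ n, ∀ᵐ x ∂μ, x ∈ S → Γ (v n - z) (v n - z) x = 0)
    (hw : Tendsto (fun n => A.form (v n - w) (v n - w)) atTop (𝓝 0)) :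
    ∀ᵐ x ∂μ, x ∈ S → Γ (w - z) (w - z) x = 0 := by
  have h1 : ∀ n, ∀ᵐ x ∂μ, x ∈ S → Γ (v n - w) (v n - w) x = Γ (w - z) (w - z) x := by
    intro n
    have e : (v n - w) - (-(w - z)) = v n - z := by abel
    have := gamma_self_congr_on hΓ (u := v n - w) (v := -(w - z)) (S := S) (by
      rw [e]; exact hv n)
    simpa only [map_neg, LinearMap.neg_apply, neg_neg] using this
  have h2 : ∫ x in S, Γ (w - z) (w - z) x ∂μ ≤ 0 := by
    refine ge_of_tendsto' hw fun n => ?_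
    rw [hΓ.integral_eq]
    rw [← setIntegral_congr_ae hS (h1 n)]
    exact setIntegral_le_integral (hΓ.integrable _ _) (hΓ.nonneg _)
  have h3 : 0 ≤ᵐ[μ.restrict S] Γ (w - z) (w - z) := ae_restrict_of_ae (hΓ.nonneg _)
  have h4 := (integral_eq_zero_iff_of_nonneg_ae h3 (hΓ.integrable _ _).restrict).1
    (le_antisymm h2 (integral_nonneg_of_ae h3))
  exact (ae_restrict_iff' hS).1 h4

lemma exists_subseq_gamma (hΓ : A.IsCarreDuChamp Γ) (v : ℕ → A.dom) (w : A.dom)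
    (hw : Tendsto (fun n => A.form (v n - w) (v n - w)) atTop (𝓝 0)) :
    ∃ ns : ℕ → ℕ, StrictMono ns ∧ ∀ f : A.dom, ∀ᵐ x ∂μ,
      Tendsto (fun k => Γ (v (ns k)) f x) atTop (𝓝 (Γ w f x)) := by
  have h1 : Tendsto (fun n => eLpNorm (⇑(Γ (v n - w) (v n - w)) - fun _ : E => (0 : ℝ)) 1 μ) atTop
      (𝓝 0) := by
    have h2 : ∀ n, eLpNorm (⇑(Γ (v n - w) (v n - w)) - fun _ : E => (0 : ℝ)) 1 μ =
        ENNReal.ofReal (A.form (v n - w) (v n - w)) := by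
      intro n
      have : (⇑(Γ (v n - w) (v n - w)) - fun _ : E => (0 : ℝ)) = Γ (v n - w) (v n - w) := by
        ext x; simp
      rw [this, hΓ.integral_eq, eLpNorm_one_eq_lintegral_enorm,
        ofReal_integral_eq_lintegral_ofReal (hΓ.integrable _ _) (hΓ.nonneg _)]
      refine lintegral_congr_ae ?_
      filter_upwards [hΓ.nonneg (v n - w)] with x hx
      exact Real.enorm_of_nonneg hx
    simp only [h2]
    simpa using ENNReal.tendsto_ofReal hw
  obtain ⟨ns, hns, hlim⟩ := (tendstoInMeasure_of_tendsto_eLpNorm one_ne_zero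
    (fun n => (Γ (v n - w) (v n - w)).aestronglyMeasurable) aestronglyMeasurable_const
    h1).exists_seq_tendsto_ae
  refine ⟨ns, hns, fun f => ?_⟩
  have hcs : ∀ᵐ x ∂μ, ∀ k, Γ (v (ns k) - w) f x ^ 2 ≤ Γ (v (ns k) - w) (v (ns k) - w) x * Γ f f x :=
    ae_all_iff.2 fun k => gamma_cauchy_schwarz hΓ _ _
  have hsub : ∀ᵐ x ∂μ, ∀ k, Γ (v (ns k) - w) f x = Γ (v (ns k)) f x - Γ w f x :=
    ae_all_iff.2 fun k => gamma_sub_left _ _ _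
  filter_upwards [hlim, hcs, hsub] with x h1 h2 h3
  have h4 : Tendsto (fun k => Γ (v (ns k) - w) f x ^ 2) atTop (𝓝 0) := by
    refine squeeze_zero (fun _ => sq_nonneg _) h2 ?_
    simpa using h1.mul_const (Γ f f x)
  have h5 : Tendsto (fun k => Γ (v (ns k) - w) f x) atTop (𝓝 0) := by
    rw [tendsto_zero_iff_abs_tendsto_zero]
    have := (Real.continuous_sqrt.tendsto 0).comp h4
    simpa [Function.comp_def, Real.sqrt_sq_eq_abs] using this
  have := h5.add_const (Γ w f x)
  simpa only [h3, sub_add_cancel, zero_add] using this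

lemma exists_truncation (h : A.IsDirichletForm) (hs : ∀ u v : A.dom, A.form u v = A.form v u)
    (u : A.dom) (c : ℝ) (hc : 0 ≤ c) : ∃ w : A.dom,
      (∀ᵐ x ∂μ, w.1 x = min (max (u.1 x) 0) c - min (max (-u.1 x) 0) c) ∧
      A.form w w ≤ 4 * A.form u u := by
  obtain ⟨p, hp, hp'⟩ := exists_clamp h hs u hc
  obtain ⟨q, hq, hq'⟩ := exists_clamp h hs (-u) hc
  refine ⟨p - q, ?_, ?_⟩
  · filter_upwards [hp, hq, ae_sub p q, ae_neg u] with x h1 h2 h3 h4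
    rw [h3, h1, h2, h4]
  · have : A.form (-u) (-u) = A.form u u := by simp
    linarith [form_sub_self_le h hs p q]

end Gamma

section Local

variable {E : Type*} [MetricSpace E] [LocallyCompactSpace E]
    [TopologicalSpace.SeparableSpace E] [MeasurableSpace E] [BorelSpace E]
    {μ : Measure E} {A : L2Form μ} {Γ : A.dom →ₗ[ℝ] A.dom →ₗ[ℝ] (E →ₘ[μ] ℝ)}

/-- Continuous cut-off functions in the domain of a regular Dirichlet form. -/
lemma exists_cutoff {E : Type*} [MetricSpace E] [LocallyCompactSpace E] [MeasurableSpace E]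
    {μ : Measure E} {A : L2Form μ} (h : A.IsStronglyLocalRegular) {K U : Set E} (hK : IsCompact K)
    (hU : IsOpen U) (hKU : K ⊆ U) :
    ∃ (w : A.dom) (g : E → ℝ), Continuous g ∧ (∀ x, 0 ≤ g x ∧ g x ≤ 1) ∧
      IsCompact (tsupport g) ∧ tsupport g ⊆ U ∧ (∀ x ∈ K, g x = 1) ∧ ∀ᵐ x ∂μ, w.1 x = g x := by
  obtain ⟨k, hkc, hkcl, hKk, hkU⟩ := exists_compact_closed_between hK hU hKU
  obtain ⟨h0, hh1, hh2, hh3, hh4⟩ := exists_continuous_one_zero_of_isCompact hK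
    (isOpen_interior (s := k)).isClosed_compl (disjoint_compl_right_iff_subset.2 hKk)
  obtain ⟨w, g, hg, hgc, hwg, hgh⟩ := h.regular_cont h0 h0.continuous hh3 (1 / 4) (by norm_num)
  obtain ⟨w1, hw1, -⟩ := exists_clamp h.dirichlet h.symm w (c := 3 / 4) (by norm_num)
  obtain ⟨w2, hw2, -⟩ := exists_clamp h.dirichlet h.symm w (c := 1 / 4) (by norm_num)
  have hz : ∀ x, x ∉ k → 2 * (min (max (g x) 0) (3 / 4) - min (max (g x) 0) (1 / 4)) = 0 := by
    intro x hx
    have h1 : h0 x = 0 := hh2 (fun hx' => hx (interior_subset hx'))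
    have h2 := abs_lt.1 (hgh x)
    rw [h1] at h2
    have h3 : max (g x) 0 ≤ 1 / 4 := max_le (by linarith) (by norm_num)
    rw [min_eq_left h3, min_eq_left (by linarith)]; ring
  have hts : tsupport (fun x => 2 * (min (max (g x) 0) (3 / 4) - min (max (g x) 0) (1 / 4))) ⊆ k :=
    closure_minimal (fun x hx => by by_contra h; exact hx (hz x h)) hkcl
  refine ⟨(2 : ℝ) • (w1 - w2),
    fun x => 2 * (min (max (g x) 0) (3 / 4) - min (max (g x) 0) (1 / 4)), by fun_prop, ?_,
    hkc.of_isClosed_subset (isClosed_tsupport _) hts, hts.trans hkU, ?_, ?_⟩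
  · intro x
    have h0 : 0 ≤ max (g x) 0 := le_max_right _ _
    simp only
    generalize max (g x) 0 = y at h0
    rcases le_total y (1 / 4) with h1 | h1
    · rw [min_eq_left h1, min_eq_left (by linarith)]; constructor <;> linarith
    · rw [min_eq_right h1]
      have := min_le_right y (3 / 4 : ℝ)
      have : 1 / 4 ≤ min y (3 / 4 : ℝ) := le_min h1 (by norm_num)
      constructor <;> linarith
  · intro x hx
    have h1 : h0 x = 1 := hh1 hx
    have h2 := abs_lt.1 (hgh x)
    rw [h1] at h2
    have h3 : 3 / 4 ≤ max (g x) 0 := le_max_of_le_left (by linarith)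
    simp only
    rw [min_eq_right h3, min_eq_right (by linarith)]; ring
  · filter_upwards [hw1, hw2, hwg, ae_smul 2 (w1 - w2), ae_sub w1 w2] with x h1 h2 h3 h4 h5
    rw [h4, h5, h1, h2, h3]

lemma gamma_eq_zero_of_bdd (h : A.IsStronglyLocalRegular) (hΓ : A.IsCarreDuChamp Γ)
    (u : A.dom) (hb : EssBdd μ u.1) {U : Set E} (hU : IsOpen U) (c : ℝ)
    (hc : ∀ᵐ x ∂μ, x ∈ U → u.1 x = c) : ∀ᵐ x ∂μ, x ∈ U → Γ u u x = 0 := by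
  have : {x | ¬ (x ∈ U → Γ u u x = 0)} = {x | x ∈ U ∧ Γ u u x ≠ 0} := by
    ext x; simp
  rw [ae_iff, this]
  refine measure_null_of_locally_null _ fun x hx => ?_
  obtain ⟨K, hK, hxK, hKU⟩ := exists_compact_subset hU hx.1
  obtain ⟨f, g, hg, hg01, hgc, hgU, hgK, hfg⟩ := exists_cutoff h hK hU hKU
  have hfb : EssBdd μ f.1 := ⟨1, hfg.mono fun x hx => by
    rw [hx, abs_of_nonneg (hg01 x).1]; exact (hg01 x).2⟩
  obtain ⟨fu, hfu⟩ := exists_mul h.dirichlet h.symm f u hfb hb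
  obtain ⟨uu, huu⟩ := exists_mul h.dirichlet h.symm u u hb hb
  have hsupp : essSupport μ f.1 ⊆ U :=
    (essSupport_subset_of_isClosed (isClosed_tsupport g) (hfg.mono fun x hx hx' => by
      rw [hx]; exact image_eq_zero_of_notMem_tsupport hx')).trans hgU
  have e1 : fu = c • f := by
    refine Subtype.ext (AEEqFun.ext ?_)
    filter_upwards [hfu, ae_smul c f, hfg, hc] with x h1 h2 h3 h4
    rw [h1, h2]
    by_cases hx : x ∈ U
    · rw [h4 hx]; ring
    · have : g x = 0 := image_eq_zero_of_notMem_tsupport fun h => hx (hgU h)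
      rw [h3, this]; ring
  have e2 : A.form u fu = 0 := by
    rw [e1, map_smul, h.strongly_local u f U c hU hsupp hc, smul_zero]
  have e3 : A.form uu f = 0 := by
    refine h.strongly_local uu f U (c * c) hU hsupp ?_
    filter_upwards [huu, hc] with x h1 h2 hx
    rw [h1, h2 hx]
  have e4 := hΓ.energy u f fu uu hb hfb hfu huu
  rw [e2, e3] at e4
  have hnn : 0 ≤ᵐ[μ] fun x => f.1 x * Γ u u x := by
    filter_upwards [hfg, hΓ.nonneg u] with x h1 h2
    rw [h1]; exact mul_nonneg (hg01 x).1 h2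
  have hint : Integrable (fun x => f.1 x * Γ u u x) μ := by
    refine (hΓ.integrable u u).bdd_mul (c := 1) f.1.aestronglyMeasurable ?_
    filter_upwards [hfg] with x h1
    rw [h1, Real.norm_of_nonneg (hg01 x).1]; exact (hg01 x).2
  have e5 := (integral_eq_zero_iff_of_nonneg_ae hnn hint).1 (by linarith)
  have e6 : ∀ᵐ x ∂μ, x ∈ interior K → Γ u u x = 0 := by
    filter_upwards [e5, hfg] with y h1 h2 hy
    simp only [Pi.zero_apply] at h1
    rwa [h2, hgK y (interior_subset hy), one_mul] at h1
  have e7 : μ {y | y ∈ interior K ∧ Γ u u y ≠ 0} = 0 := by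
    rw [ae_iff] at e6
    refine (measure_mono_null ?_ e6)
    intro y hy
    simpa using hy
  refine ⟨_, mem_nhdsWithin.2 ⟨interior K, isOpen_interior, hxK, fun y hy => ?_⟩, e7⟩
  exact ⟨hy.1, hy.2.2⟩

/-- Locality of the carré du champ. -/
theorem gamma_eq_zero_of_const (h : A.IsStronglyLocalRegular) (hΓ : A.IsCarreDuChamp Γ)
    (u : A.dom) {U : Set E} (hU : IsOpen U) (c : ℝ)
    (hc : ∀ᵐ x ∂μ, x ∈ U → u.1 x = c) : ∀ᵐ x ∂μ, x ∈ U → Γ u u x = 0 := by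
  have hex := fun n : ℕ => exists_truncation h.dirichlet h.symm u n n.cast_nonneg
  choose z hz hzA using hex
  have habs : ∀ (y : ℝ) (n : ℕ), |min (max y 0) n - min (max (-y) 0) n| ≤ |y| := by
    intro y n
    have hn : (0 : ℝ) ≤ n := n.cast_nonneg
    rcases le_total 0 y with hy | hy
    · rw [max_eq_left hy, max_eq_right (by linarith : -y ≤ 0), min_eq_left hn, sub_zero,
        abs_of_nonneg (le_min hy hn), abs_of_nonneg hy]
      exact min_le_left _ _
    · rw [max_eq_right hy, max_eq_left (by linarith : 0 ≤ -y), min_eq_left hn, zero_sub, abs_neg,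
        abs_of_nonneg (le_min (by linarith) hn), abs_of_nonpos hy]
      exact min_le_left _ _
  have habsn : ∀ (y : ℝ) (n : ℕ), |min (max y 0) n - min (max (-y) 0) n| ≤ n := by
    intro y n
    have hn : (0 : ℝ) ≤ n := n.cast_nonneg
    have h1 := min_le_right (max y 0) (n : ℝ)
    have h2 := min_le_right (max (-y) 0) (n : ℝ)
    have h3 : 0 ≤ min (max y 0) (n : ℝ) := le_min (le_max_right _ _) hn
    have h4 : 0 ≤ min (max (-y) 0) (n : ℝ) := le_min (le_max_right _ _) hn
    rw [abs_le]; constructor <;> linarith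
  have hlim : Tendsto (fun n => A.toL2 (z n)) atTop (𝓝 (A.toL2 u)) := by
    rw [tendsto_iff_norm_sub_tendsto_zero]
    have hsq : ∀ n, ‖A.toL2 (z n) - A.toL2 u‖ = Real.sqrt (∫ x, ((z n).1 x - u.1 x) ^ 2 ∂μ) := by
      intro n
      rw [← map_sub, ← Real.sqrt_sq (norm_nonneg _), ← real_inner_self_eq_norm_sq, L2.inner_def]
      congr 1
      refine integral_congr_ae ?_
      filter_upwards [ae_sub (z n) u] with x hx
      rw [coe_toL2, hx]
      simp [sq]
    simp only [hsq]
    have h0 : Tendsto (fun n => ∫ x, ((z n).1 x - u.1 x) ^ 2 ∂μ) atTop (𝓝 (∫ _, (0 : ℝ) ∂μ)) := by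
      refine tendsto_integral_of_dominated_convergence (fun x => (2 * u.1 x) ^ 2)
        (fun n => (((z n).1.aestronglyMeasurable.sub u.1.aestronglyMeasurable).pow 2)) ?_ ?_ ?_
      · have := ((A.memLp u.1 u.2).integrable_sq).const_mul 4
        refine this.congr (Eventually.of_forall fun x => ?_)
        simp only; ring
      · intro n
        filter_upwards [hz n] with x hx
        rw [hx, Real.norm_of_nonneg (sq_nonneg _), sq_le_sq, abs_mul, abs_two]
        refine (abs_sub _ _).trans ?_
        linarith [habs (u.1 x) n]
      · filter_upwards [ae_all_iff.2 hz] with x hx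
        refine tendsto_const_nhds.congr' ?_
        filter_upwards [eventually_ge_atTop (⌈|u.1 x|⌉₊)] with n hn
        have h1 : |u.1 x| ≤ n := (Nat.le_ceil _).trans (by exact_mod_cast hn)
        rw [hx n]
        have h2 := abs_le.1 h1
        rcases le_total 0 (u.1 x) with hy | hy
        · rw [max_eq_left hy, max_eq_right (by linarith : -u.1 x ≤ 0), min_eq_left h2.2,
            min_eq_left n.cast_nonneg]; ring
        · rw [max_eq_right hy, max_eq_left (by linarith : 0 ≤ -u.1 x), min_eq_left n.cast_nonneg,
            min_eq_left (by linarith)]; ring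
    have := (Real.continuous_sqrt.tendsto _).comp h0
    simpa [Function.comp_def] using this
  obtain ⟨w, hwP, hw, -⟩ := exists_mem_of_bounded h.dirichlet h.symm z (A.toL2 u)
    (4 * A.form u u) hzA hlim _ (convex_gamma_zero hΓ U 0)
    (closed_gamma_zero hΓ hU.measurableSet 0) (fun n => by
      simp only [mem_ofPred_eq, sub_zero]
      refine gamma_eq_zero_of_bdd h hΓ (z n) ⟨n, (hz n).mono fun x hx => hx ▸ habsn _ _⟩ hU
        (min (max c 0) n - min (max (-c) 0) n) ?_
      filter_upwards [hz n, hc] with x h1 h2 hx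
      rw [h1, h2 hx])
  have : w = u := Subtype.ext hw
  subst this
  simpa using hwP

lemma gamma_congr_of_eq (h : A.IsStronglyLocalRegular) (hΓ : A.IsCarreDuChamp Γ)
    (u v : A.dom) {U : Set E} (hU : IsOpen U) (huv : ∀ᵐ x ∂μ, x ∈ U → u.1 x = v.1 x) (g : A.dom) :
    ∀ᵐ x ∂μ, x ∈ U → Γ u g x = Γ v g x := by
  refine gamma_congr_on hΓ (gamma_eq_zero_of_const h hΓ (u - v) hU 0 ?_) g
  filter_upwards [huv, ae_sub u v] with x h1 h2 hx
  rw [h2, h1 hx, sub_self]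

/-- The carré du champ of a truncated continuous function. -/
theorem gamma_truncation (h : A.IsStronglyLocalRegular) (hΓ : A.IsCarreDuChamp Γ)
    (u : A.dom) {g : E → ℝ} (hg : Continuous g) (hg0 : ∀ x, 0 ≤ g x) (hug : ∀ᵐ x ∂μ, u.1 x = g x)
    {s : ℝ} (hs : 0 ≤ s) : ∃ w : A.dom, (∀ᵐ x ∂μ, w.1 x = min (g x) s) ∧
      ∀ f : A.dom, ∀ᵐ x ∂μ, Γ w f x = (if g x < s then 1 else 0) * Γ u f x := by
  have hcl : ∀ s : ℝ, 0 ≤ s → ∃ w : A.dom, (∀ᵐ x ∂μ, w.1 x = min (g x) s) ∧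
      A.form w w ≤ A.form u u := by
    intro s hs
    obtain ⟨w, hw, hwA⟩ := exists_clamp h.dirichlet h.symm u hs
    refine ⟨w, ?_, hwA⟩
    filter_upwards [hw, hug] with x h1 h2
    rw [h1, h2, max_eq_left (hg0 x)]
  rcases hs.eq_or_lt with rfl | hs
  · refine ⟨0, ?_, fun f => ?_⟩
    · filter_upwards [AEEqFun.coeFn_zero (μ := μ) (β := ℝ) (α := E)] with x hx
      rw [min_eq_right (hg0 x)]; exact hx
    · rw [map_zero, LinearMap.zero_apply]
      filter_upwards [AEEqFun.coeFn_zero (μ := μ) (β := ℝ) (α := E)] with x hx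
      rw [if_neg (not_lt.2 (hg0 x)), zero_mul]; exact hx
  obtain ⟨w, hw, hwA⟩ := hcl s hs.le
  have hsk : ∀ k : ℕ, 0 ≤ s - s / ((k : ℝ) + 2) ∧ s - s / ((k : ℝ) + 2) < s := fun k => by
    have h2 : (0 : ℝ) < (k : ℝ) + 2 := by positivity
    have : s / ((k : ℝ) + 2) ≤ s := div_le_self hs.le (by linarith)
    have : 0 < s / ((k : ℝ) + 2) := by positivity
    constructor <;> linarith
  choose v hv hvA using fun k : ℕ => hcl _ (hsk k).1
  have hS : MeasurableSet {x | s ≤ g x} := (isClosed_le continuous_const hg).measurableSet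
  have hlim : Tendsto (fun k => A.toL2 (w - v k)) atTop (𝓝 (A.toL2 0)) := by
    refine tendsto_toL2_of_le (g := A.toL2 w) tendsto_one_div_add_atTop_nhds_zero_nat fun k => ?_
    filter_upwards [hw, hv k, ae_sub w (v k), AEEqFun.coeFn_zero (μ := μ) (β := ℝ) (α := E)]
      with x h1 h2 h3 h4
    have e0 : (A.toL2 0) x = 0 := h4
    have e1 : (A.toL2 w) x = w.1 x := rfl
    rw [e0, e1, h3, h1, h2, sub_zero, abs_of_nonneg (le_min (hg0 x) hs.le)]
    obtain ⟨a1, a2⟩ := hsk k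
    rcases le_total (g x) (s - s / ((k : ℝ) + 2)) with h5 | h5
    · rw [min_eq_left h5, min_eq_left (h5.trans a2.le), sub_self, abs_zero]
      have := hg0 x; positivity
    · rw [min_eq_right h5, abs_of_nonneg (sub_nonneg.2 (le_min h5 a2.le))]
      have h6 : min (g x) s ≤ s := min_le_right _ _
      have h7 : s - s / ((k : ℝ) + 2) ≤ min (g x) s := le_min h5 a2.le
      have h8 : s / ((k : ℝ) + 2) = 1 / ((k : ℝ) + 1) * (s - s / ((k : ℝ) + 2)) := by
        field_simp; ring
      have h9 : 1 / ((k : ℝ) + 1) * (s - s / ((k : ℝ) + 2)) ≤ 1 / ((k : ℝ) + 1) * min (g x) s := by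
        gcongr
      linarith
  obtain ⟨y, hyP, hy, -⟩ := exists_mem_of_bounded h.dirichlet h.symm (fun k => w - v k) (A.toL2 0)
    (4 * A.form u u) (fun k => by linarith [form_sub_self_le h.dirichlet h.symm w (v k), hvA k])
    hlim _ (convex_gamma_zero hΓ {x | s ≤ g x} w) (closed_gamma_zero hΓ hS w) (fun k => by
      simp only [mem_ofPred_eq]
      have e : w - v k - w = - v k := by abel
      rw [e]
      simp only [map_neg, LinearMap.neg_apply, neg_neg]
      have := gamma_eq_zero_of_const h hΓ (v k) (isOpen_lt continuous_const hg)
        (s - s / ((k : ℝ) + 2)) ((hv k).mono fun x hx hx' => by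
          rw [hx, min_eq_right (le_of_lt hx')])
      filter_upwards [this] with x h1 hx
      exact h1 (lt_of_lt_of_le (hsk k).2 hx))
  have hy0 : y = 0 := Subtype.ext hy
  subst hy0
  have hzero : ∀ᵐ x ∂μ, x ∈ {x | s ≤ g x} → Γ w w x = 0 := by
    have := hyP
    simpa only [mem_ofPred_eq, zero_sub, map_neg, LinearMap.neg_apply, neg_neg] using this
  refine ⟨w, hw, fun f => ?_⟩
  have hU : IsOpen {x | g x < s} := isOpen_lt hg continuous_const
  filter_upwards [gamma_eq_zero_on hΓ hzero f, gamma_congr_of_eq h hΓ w u hU (by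
    filter_upwards [hw, hug] with x h1 h2 hx
    rw [h1, h2, min_eq_left (le_of_lt hx)]) f] with x h1 h2
  by_cases hx : g x < s
  · rw [if_pos hx, h2 hx, one_mul]
  · rw [if_neg hx, h1 (not_lt.1 hx), zero_mul]

end Local

end L2Form

end

noncomputable section

/-! ### Chain rule and product rule for the carré du champ -/

section Riemann

variable {F F' : ℝ → ℝ} {B ω y : ℝ} {n : ℕ}

lemma abs_sum_truncation_sub_le (hF : ∀ x, HasDerivAt F (F' x) x) (hF0 : F 0 = 0) (hB : 0 < B)
    (hω : ∀ a ∈ Icc 0 B, ∀ b ∈ Icc 0 B, |a - b| ≤ B / ((n : ℝ) + 1) → |F' a - F' b| ≤ ω)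
    (hy0 : 0 ≤ y) (hyB : y ≤ B) :
    |∑ k ∈ Finset.range (n + 1), F' (k * (B / ((n : ℝ) + 1))) *
      (min y ((k + 1 : ℕ) * (B / ((n : ℝ) + 1))) - min y (k * (B / ((n : ℝ) + 1)))) - F y| ≤
      ω * y := by
  set δ := B / ((n : ℝ) + 1) with hδ
  have hδ0 : 0 < δ := by positivity
  have hnδ : ((n + 1 : ℕ) : ℝ) * δ = B := by rw [hδ]; push_cast; field_simp
  have t1 : ∑ k ∈ Finset.range (n + 1), (F (min y ((k + 1 : ℕ) * δ)) - F (min y (k * δ))) =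
      F y := by
    rw [Finset.sum_range_sub (fun k : ℕ => F (min y (k * δ))), hnδ, min_eq_left hyB]
    simp [min_eq_right hy0, hF0]
  have t2 : ∑ k ∈ Finset.range (n + 1), (min y ((k + 1 : ℕ) * δ) - min y (k * δ)) = y := by
    rw [Finset.sum_range_sub (fun k : ℕ => min y (k * δ)), hnδ, min_eq_left hyB]
    simp [min_eq_right hy0]
  rw [← t1, ← Finset.sum_sub_distrib]
  have t3 : ω * y = ∑ k ∈ Finset.range (n + 1),
      ω * (min y ((k + 1 : ℕ) * δ) - min y (k * δ)) := by rw [← Finset.mul_sum, t2]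
  rw [t3]
  refine (Finset.abs_sum_le_sum_abs _ _).trans (Finset.sum_le_sum fun k hk => ?_)
  have hk' : ((k + 1 : ℕ) : ℝ) * δ ≤ B := by
    rw [← hnδ]
    have : ((k + 1 : ℕ) : ℝ) ≤ ((n + 1 : ℕ) : ℝ) := by
      exact_mod_cast Nat.succ_le_of_lt (Finset.mem_range.1 hk)
    gcongr
  have hk1 : ((k + 1 : ℕ) : ℝ) * δ = k * δ + δ := by push_cast; ring
  rw [hk1] at hk' ⊢
  have hk0 : 0 ≤ (k : ℝ) * δ := by positivity
  rcases le_total y (k * δ) with h1 | h1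
  · rw [min_eq_left h1, min_eq_left (by linarith)]; simp
  · rw [min_eq_right h1]
    have hle : k * δ ≤ min y (k * δ + δ) := le_min h1 (by linarith)
    have hmv := (convex_Icc (k * δ) (k * δ + δ)).norm_image_sub_le_of_norm_hasDerivWithin_le
      (f := fun x => F x - F' (k * δ) * x) (f' := fun x => F' x - F' (k * δ)) (C := ω)
      (fun x _ => ((hF x).sub (by simpa using (hasDerivAt_id x).const_mul (F' (k * δ)))).hasDerivWithinAt)
      (fun x hx => hω x ⟨hk0.trans hx.1, hx.2.trans hk'⟩ _ ⟨hk0, by linarith⟩ (by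
        rw [abs_of_nonneg (by linarith [hx.1])]; linarith [hx.2]))
      (x := k * δ) (y := min y (k * δ + δ)) ⟨le_rfl, by linarith⟩ ⟨hle, min_le_right _ _⟩
    rw [Real.norm_eq_abs, Real.norm_eq_abs, abs_of_nonneg (sub_nonneg.2 hle)] at hmv
    rw [abs_sub_comm]
    refine le_trans (le_of_eq ?_) hmv
    congr 1; ring

lemma abs_sum_indicator_sub_le (hB : 0 < B)
    (hω : ∀ a ∈ Icc 0 B, ∀ b ∈ Icc 0 B, |a - b| ≤ B / ((n : ℝ) + 1) → |F' a - F' b| ≤ ω)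
    (hy0 : 0 ≤ y) (hyB : y < B) :
    |∑ k ∈ Finset.range (n + 1), F' (k * (B / ((n : ℝ) + 1))) *
      ((if y < (k + 1 : ℕ) * (B / ((n : ℝ) + 1)) then 1 else 0) -
        (if y < k * (B / ((n : ℝ) + 1)) then 1 else 0)) - F' y| ≤ ω := by
  set δ := B / ((n : ℝ) + 1) with hδ
  have hδ0 : 0 < δ := by positivity
  have hnδ : ((n + 1 : ℕ) : ℝ) * δ = B := by rw [hδ]; push_cast; field_simp
  have t2 : ∑ k ∈ Finset.range (n + 1), ((if y < (k + 1 : ℕ) * δ then (1 : ℝ) else 0) -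
      (if y < k * δ then 1 else 0)) = 1 := by
    rw [Finset.sum_range_sub (fun k : ℕ => if y < k * δ then (1 : ℝ) else 0), hnδ, if_pos hyB]
    simp [not_lt.2 hy0]
  have e : F' y = ∑ k ∈ Finset.range (n + 1), F' y *
      ((if y < (k + 1 : ℕ) * δ then (1 : ℝ) else 0) - (if y < k * δ then 1 else 0)) := by
    rw [← Finset.mul_sum, t2, mul_one]
  have e' : ω = ∑ k ∈ Finset.range (n + 1), ω *
      ((if y < (k + 1 : ℕ) * δ then (1 : ℝ) else 0) - (if y < k * δ then 1 else 0)) := by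
    rw [← Finset.mul_sum, t2, mul_one]
  rw [e, ← Finset.sum_sub_distrib]
  refine ((Finset.abs_sum_le_sum_abs _ _).trans ?_).trans e'.ge
  refine (Finset.sum_le_sum fun k hk => ?_)
  have hk' : ((k + 1 : ℕ) : ℝ) * δ ≤ B := by
    rw [← hnδ]
    have : ((k + 1 : ℕ) : ℝ) ≤ ((n + 1 : ℕ) : ℝ) := by
      exact_mod_cast Nat.succ_le_of_lt (Finset.mem_range.1 hk)
    gcongr
  have hk1 : ((k + 1 : ℕ) : ℝ) * δ = k * δ + δ := by push_cast; ring
  rw [hk1] at hk' ⊢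
  have hk0 : 0 ≤ (k : ℝ) * δ := by positivity
  by_cases h1 : y < k * δ
  · rw [if_pos h1, if_pos (by linarith)]; simp
  · rw [if_neg h1]
    by_cases h2 : y < k * δ + δ
    · rw [if_pos h2, sub_zero, mul_one, mul_one, mul_one]
      push Not at h1
      refine hω _ ⟨hk0, by linarith⟩ _ ⟨hy0, hyB.le⟩ ?_
      rw [abs_sub_comm, abs_of_nonneg (by linarith)]; linarith
    · rw [if_neg h2]; simp

/-- A continuous function has a modulus of continuity along the equidistant partitions. -/
lemma exists_modulus (hF' : Continuous F') (hB : 0 < B) : ∃ ω : ℕ → ℝ, Tendsto ω atTop (𝓝 0) ∧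
    ∀ n : ℕ, ∀ a ∈ Icc 0 B, ∀ b ∈ Icc 0 B, |a - b| ≤ B / ((n : ℝ) + 1) → |F' a - F' b| ≤ ω n := by
  have hco := isCompact_Icc (a := (0 : ℝ)) (b := B)
  obtain ⟨M, hM⟩ := hco.exists_bound_of_continuousOn hF'.continuousOn
  have huc := hco.uniformContinuousOn_of_continuous hF'.continuousOn
  rw [Metric.uniformContinuousOn_iff] at huc
  let T : ℕ → Set ℝ := fun n => {r | ∃ a ∈ Icc 0 B, ∃ b ∈ Icc 0 B,
    |a - b| ≤ B / ((n : ℝ) + 1) ∧ r = |F' a - F' b|}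
  have hT : ∀ n, BddAbove (T n) := fun n => ⟨M + M, by
    rintro _ ⟨a, ha, b, hb, -, rfl⟩
    exact (abs_sub _ _).trans (add_le_add (hM a ha) (hM b hb))⟩
  have hne : ∀ n, (T n).Nonempty := fun n =>
    ⟨_, 0, ⟨le_rfl, hB.le⟩, 0, ⟨le_rfl, hB.le⟩, by simp; positivity, rfl⟩
  refine ⟨fun n => sSup (T n), ?_, fun n a ha b hb hab => le_csSup (hT n) ⟨a, ha, b, hb, hab, rfl⟩⟩
  rw [Metric.tendsto_atTop]
  intro ε hε
  obtain ⟨δ, hδ, hδ'⟩ := huc (ε / 2) (by positivity)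
  have hlim : Tendsto (fun n : ℕ => B / ((n : ℝ) + 1)) atTop (𝓝 0) := by
    have := (tendsto_one_div_add_atTop_nhds_zero_nat (𝕜 := ℝ)).const_mul B
    simpa only [mul_one_div, mul_zero] using this
  obtain ⟨k, hk⟩ := eventually_atTop.1 (hlim.eventually_lt_const hδ)
  refine ⟨k, fun n hn => ?_⟩
  have h1 : sSup (T n) ≤ ε / 2 := csSup_le (hne n) (by
    rintro _ ⟨a, ha, b, hb, hab, rfl⟩
    exact (hδ' a ha b hb (hab.trans_lt (hk n hn))).le)
  obtain ⟨r, hr⟩ := hne n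
  have h2 : 0 ≤ sSup (T n) := by
    refine le_trans ?_ (le_csSup (hT n) hr)
    obtain ⟨a, -, b, -, -, rfl⟩ := hr
    exact abs_nonneg _
  rw [Real.dist_eq, sub_zero, abs_of_nonneg h2]
  linarith

end Riemann

namespace L2Form

section Gamma

variable {E : Type*} [MetricSpace E] [LocallyCompactSpace E]
    [TopologicalSpace.SeparableSpace E] [MeasurableSpace E] [BorelSpace E]
    {μ : Measure E} {A : L2Form μ} {Γ : A.dom →ₗ[ℝ] A.dom →ₗ[ℝ] (E →ₘ[μ] ℝ)}

lemma ae_sum {E : Type*} [MeasurableSpace E] {μ : Measure E} {A : L2Form μ} {ι : Type*}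
    (s : Finset ι) (c : ι → ℝ) (v : ι → A.dom) :
    ∀ᵐ x ∂μ, (∑ k ∈ s, c k • v k).1 x = ∑ k ∈ s, c k * (v k).1 x := by
  classical
  induction s using Finset.induction_on with
  | empty =>
    filter_upwards [AEEqFun.coeFn_zero (μ := μ) (β := ℝ) (α := E)] with x hx
    simpa using hx
  | insert a s ha ih =>
    rw [Finset.sum_insert ha]
    filter_upwards [ih, ae_add (c a • v a) (∑ k ∈ s, c k • v k), ae_smul (c a) (v a)]
      with x h1 h2 h3
    rw [Finset.sum_insert ha, h2, h1, h3]

lemma gamma_sum {E : Type*} [MeasurableSpace E] {μ : Measure E} {A : L2Form μ}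
    {Γ : A.dom →ₗ[ℝ] A.dom →ₗ[ℝ] (E →ₘ[μ] ℝ)} {ι : Type*}
    (s : Finset ι) (c : ι → ℝ) (v : ι → A.dom) (f : A.dom) :
    ∀ᵐ x ∂μ, Γ (∑ k ∈ s, c k • v k) f x = ∑ k ∈ s, c k * Γ (v k) f x := by
  classical
  induction s using Finset.induction_on with
  | empty =>
    filter_upwards [AEEqFun.coeFn_zero (μ := μ) (β := ℝ) (α := E)] with x hx
    simpa using hx
  | insert a s ha ih =>
    rw [Finset.sum_insert ha]
    filter_upwards [ih, gamma_add_left (Γ := Γ) (c a • v a) (∑ k ∈ s, c k • v k) f,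
      gamma_smul_left (Γ := Γ) (c a) (v a) f] with x h1 h2 h3
    rw [Finset.sum_insert ha, h2, h1, h3]

/-- The chain rule for non-negative bounded continuous functions in the domain. -/
theorem gamma_comp (h : A.IsStronglyLocalRegular) (hΓ : A.IsCarreDuChamp Γ)
    (u : A.dom) {g : E → ℝ} (hg : Continuous g) (hg0 : ∀ x, 0 ≤ g x) (hug : ∀ᵐ x ∂μ, u.1 x = g x)
    {B : ℝ} (hB : 0 < B) (hgB : ∀ x, g x < B) {F F' : ℝ → ℝ} (hF : ∀ x, HasDerivAt F (F' x) x)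
    (hF' : Continuous F') (hF0 : F 0 = 0) :
    ∃ w : A.dom, (∀ᵐ x ∂μ, w.1 x = F (g x)) ∧
      ∀ f : A.dom, ∀ᵐ x ∂μ, Γ w f x = F' (g x) * Γ u f x := by
  obtain ⟨ω, hω0, hω⟩ := exists_modulus hF' hB
  have hωnn : ∀ n, 0 ≤ ω n := fun n => by
    have := hω n 0 ⟨le_rfl, hB.le⟩ 0 ⟨le_rfl, hB.le⟩ (by simp; positivity)
    simpa using this
  choose! T hT hTΓ using fun (s : ℝ) (hs : 0 ≤ s) => gamma_truncation h hΓ u hg hg0 hug hs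
  let w : ℕ → A.dom := fun n => ∑ k ∈ Finset.range (n + 1), F' (k * (B / ((n : ℝ) + 1))) •
    (T ((k + 1 : ℕ) * (B / ((n : ℝ) + 1))) - T (k * (B / ((n : ℝ) + 1))))
  have hpos : ∀ (n k : ℕ), 0 ≤ (k : ℝ) * (B / ((n : ℝ) + 1)) := fun n k => by positivity
  have hw : ∀ n, ∀ᵐ x ∂μ, |(w n).1 x - F (g x)| ≤ ω n * g x := by
    intro n
    have h1 : ∀ᵐ x ∂μ, ∀ k : ℕ, (T ((k + 1 : ℕ) * (B / ((n : ℝ) + 1))) -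
        T (k * (B / ((n : ℝ) + 1)))).1 x =
        min (g x) ((k + 1 : ℕ) * (B / ((n : ℝ) + 1))) - min (g x) (k * (B / ((n : ℝ) + 1))) := by
      rw [ae_all_iff]
      intro k
      filter_upwards [hT _ (hpos n (k + 1)), hT _ (hpos n k),
        ae_sub (T ((k + 1 : ℕ) * (B / ((n : ℝ) + 1)))) (T (k * (B / ((n : ℝ) + 1))))]
        with x h1 h2 h3
      rw [h3, h1, h2]
    filter_upwards [h1, ae_sum (Finset.range (n + 1)) (fun k : ℕ => F' (k * (B / ((n : ℝ) + 1))))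
      (fun k : ℕ => T ((k + 1 : ℕ) * (B / ((n : ℝ) + 1))) - T (k * (B / ((n : ℝ) + 1))))]
      with x h1 h2
    rw [h2]
    simp only [h1]
    exact abs_sum_truncation_sub_le hF hF0 hB (hω n) (hg0 x) (hgB x).le
  have hwΓ : ∀ n f, ∀ᵐ x ∂μ, |Γ (w n) f x - F' (g x) * Γ u f x| ≤ ω n * |Γ u f x| := by
    intro n f
    have h1 : ∀ᵐ x ∂μ, ∀ k : ℕ, Γ (T ((k + 1 : ℕ) * (B / ((n : ℝ) + 1))) -
        T (k * (B / ((n : ℝ) + 1)))) f x =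
        ((if g x < (k + 1 : ℕ) * (B / ((n : ℝ) + 1)) then 1 else 0) -
        (if g x < k * (B / ((n : ℝ) + 1)) then 1 else 0)) * Γ u f x := by
      rw [ae_all_iff]
      intro k
      filter_upwards [hTΓ _ (hpos n (k + 1)) f, hTΓ _ (hpos n k) f,
        gamma_sub_left (Γ := Γ) (T ((k + 1 : ℕ) * (B / ((n : ℝ) + 1))))
          (T (k * (B / ((n : ℝ) + 1)))) f] with x h1 h2 h3
      rw [h3, h1, h2, sub_mul]
    filter_upwards [h1, gamma_sum (Γ := Γ) (Finset.range (n + 1))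
      (fun k : ℕ => F' (k * (B / ((n : ℝ) + 1))))
      (fun k : ℕ => T ((k + 1 : ℕ) * (B / ((n : ℝ) + 1))) - T (k * (B / ((n : ℝ) + 1)))) f]
      with x h1 h2
    rw [h2]
    simp only [h1]
    simp only [← mul_assoc]
    rw [← Finset.sum_mul, ← sub_mul, abs_mul]
    exact mul_le_mul_of_nonneg_right (abs_sum_indicator_sub_le hB (hω n) (hg0 x) (hgB x))
      (abs_nonneg _)
  have hdiff : ∀ m n f, ∀ᵐ x ∂μ, |Γ (w m - w n) f x| ≤ (ω m + ω n) * |Γ u f x| := by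
    intro m n f
    filter_upwards [hwΓ m f, hwΓ n f, gamma_sub_left (Γ := Γ) (w m) (w n) f] with x h1 h2 h3
    rw [h3]
    have e : Γ (w m) f x - Γ (w n) f x = (Γ (w m) f x - F' (g x) * Γ u f x) -
      (Γ (w n) f x - F' (g x) * Γ u f x) := by ring
    rw [e]
    refine (abs_sub _ _).trans ?_
    linarith
  have hcauchy : ∀ m n, A.form (w m - w n) (w m - w n) ≤ (ω m + ω n) ^ 2 * A.form u u := by
    intro m n
    rw [hΓ.integral_eq, hΓ.integral_eq u u, ← integral_const_mul]
    refine integral_mono_ae (hΓ.integrable _ _) ((hΓ.integrable _ _).const_mul _) ?_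
    have h2 := hdiff m n u
    rw [hΓ.symm _ u] at h2
    filter_upwards [hdiff m n (w m - w n), h2, hΓ.nonneg u] with x h1 h2 h3
    rw [abs_of_nonneg h3] at h2
    have h4 : 0 ≤ ω m + ω n := add_nonneg (hωnn m) (hωnn n)
    calc Γ (w m - w n) (w m - w n) x ≤ (ω m + ω n) * |Γ u (w m - w n) x| := (le_abs_self _).trans h1
      _ ≤ (ω m + ω n) * ((ω m + ω n) * Γ u u x) := by gcongr
      _ = _ := by ring
  have hFm : MemLp (fun x => F (g x)) 2 μ := by
    obtain ⟨M, hM⟩ := (isCompact_Icc (a := (0 : ℝ)) (b := B)).exists_bound_of_continuousOn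
      hF'.continuousOn
    have hFc : Continuous F := continuous_iff_continuousAt.2 fun x => (hF x).continuousAt
    refine MemLp.of_le_mul (c := M) (A.memLp u.1 u.2)
      (hFc.comp hg).aestronglyMeasurable ?_
    filter_upwards [hug] with x hx
    have hmv := (convex_Icc 0 B).norm_image_sub_le_of_norm_hasDerivWithin_le
      (fun x _ => (hF x).hasDerivWithinAt) hM (x := 0) (y := g x) ⟨le_rfl, hB.le⟩
      ⟨hg0 x, (hgB x).le⟩
    rw [hx]
    simpa [hF0] using hmv
  have hωlim : ∀ ε : ℝ, 0 < ε → ∃ k, ∀ m ≥ k, ω m < ε := fun ε hε =>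
    eventually_atTop.1 (hω0.eventually_lt_const hε)
  obtain ⟨v, hv, hvlim⟩ := exists_of_cauchy h.dirichlet w hFm.toLp (by
    intro ε hε
    have hA := h.dirichlet.nonneg u
    obtain ⟨k, hk⟩ := hωlim (Real.sqrt (ε / (4 * (A.form u u + 1)))) (by positivity)
    refine ⟨k, fun m hm n hn => (hcauchy m n).trans_lt ?_⟩
    have h1 : (ω m + ω n) ^ 2 ≤ (2 * Real.sqrt (ε / (4 * (A.form u u + 1)))) ^ 2 :=
      pow_le_pow_left₀ (add_nonneg (hωnn m) (hωnn n)) (by linarith [hk m hm, hk n hn]) 2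
    rw [mul_pow, Real.sq_sqrt (by positivity)] at h1
    have h2 : (2 : ℝ) ^ 2 * (ε / (4 * (A.form u u + 1))) * (A.form u u + 1) = ε := by
      field_simp; norm_num
    have h3 : 0 < (2 : ℝ) ^ 2 * (ε / (4 * (A.form u u + 1))) := by positivity
    nlinarith [mul_le_mul_of_nonneg_right h1 hA])
    (tendsto_toL2_of_le (g := A.toL2 u) hω0 fun n => by
      filter_upwards [hw n, hug, hFm.coeFn_toLp] with x h1 h2 h3
      have e1 : (A.toL2 u) x = u.1 x := rfl
      rw [h3, e1, h2, abs_of_nonneg (hg0 x)]; exact h1)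
  refine ⟨v, ?_, fun f => ?_⟩
  · filter_upwards [hFm.coeFn_toLp] with x hx
    rw [hv]; exact hx
  · obtain ⟨ns, hns, hlim⟩ := exists_subseq_gamma hΓ w v hvlim
    filter_upwards [hlim f, ae_all_iff.2 fun n => hwΓ n f] with x h1 h2
    refine tendsto_nhds_unique h1 ?_
    rw [tendsto_iff_norm_sub_tendsto_zero]
    refine squeeze_zero (fun _ => norm_nonneg _) (fun k => h2 (ns k)) ?_
    simpa using (hω0.comp hns.tendsto_atTop).mul_const |Γ u f x|

lemma gamma_sq (h : A.IsStronglyLocalRegular) (hΓ : A.IsCarreDuChamp Γ)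
    (u : A.dom) {g : E → ℝ} (hg : Continuous g) (hug : ∀ᵐ x ∂μ, u.1 x = g x)
    {B : ℝ} (hgB : ∀ x, |g x| ≤ B) :
    ∃ w : A.dom, (∀ᵐ x ∂μ, w.1 x = g x * g x) ∧
      ∀ f : A.dom, ∀ᵐ x ∂μ, Γ w f x = 2 * g x * Γ u f x := by
  have key : ∀ (u : A.dom) (g : E → ℝ), Continuous g → (∀ᵐ x ∂μ, u.1 x = g x) →
      (∀ x, |g x| ≤ B) → ∃ w : A.dom, (∀ᵐ x ∂μ, w.1 x = max (g x) 0 * max (g x) 0) ∧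
      ∀ f : A.dom, ∀ᵐ x ∂μ, Γ w f x = 2 * max (g x) 0 * Γ u f x := by
    intro u g hg hug hgB
    obtain ⟨p, hp, -⟩ := exists_clamp h.dirichlet h.symm u (c := |B| + 1) (by positivity)
    have hp' : ∀ᵐ x ∂μ, p.1 x = max (g x) 0 := by
      filter_upwards [hp, hug] with x h1 h2
      rw [h1, h2, min_eq_left (max_le ?_ (by positivity))]
      linarith [le_abs_self (g x), hgB x, le_abs_self B]
    obtain ⟨w, hw, hwΓ⟩ := gamma_comp h hΓ p (g := fun x => max (g x) 0) (by fun_prop)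
      (fun x => le_max_right _ _) hp' (B := |B| + 1) (by positivity)
      (fun x => max_lt (by linarith [le_abs_self (g x), hgB x, le_abs_self B]) (by positivity))
      (F := fun y => y * y) (F' := fun y => 2 * y)
      (fun x => ((hasDerivAt_id' x).mul (hasDerivAt_id' x)).congr_deriv (by ring))
      (by fun_prop) (by simp)
    refine ⟨w, hw, fun f => ?_⟩
    filter_upwards [hwΓ f, gamma_congr_of_eq h hΓ p u (isOpen_lt continuous_const hg) (U := {x | 0 < g x}) (by
      filter_upwards [hp', hug] with x h1 h2 hx
      rw [h1, h2, max_eq_left (le_of_lt hx)]) f] with x h1 h2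
    rw [h1]
    by_cases hx : 0 < g x
    · rw [h2 hx]
    · rw [max_eq_right (not_lt.1 hx)]; simp
  obtain ⟨p, hp, hpΓ⟩ := key u g hg hug hgB
  obtain ⟨q, hq, hqΓ⟩ := key (-u) (fun x => -g x) hg.neg (by
    filter_upwards [hug, ae_neg u] with x h1 h2
    rw [h2, h1]) (fun x => by rw [abs_neg]; exact hgB x)
  refine ⟨p + q, ?_, fun f => ?_⟩
  · filter_upwards [hp, hq, ae_add p q] with x h1 h2 h3
    rw [h3, h1, h2]
    rcases le_total 0 (g x) with hx | hx
    · rw [max_eq_left hx, max_eq_right (by linarith)]; ring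
    · rw [max_eq_right hx, max_eq_left (by linarith)]; ring
  · filter_upwards [hpΓ f, hqΓ f, gamma_add_left (Γ := Γ) p q f,
      gamma_neg_left (Γ := Γ) u f] with x h1 h2 h3 h4
    rw [h3, h1, h2, h4]
    rcases le_total 0 (g x) with hx | hx
    · rw [max_eq_left hx, max_eq_right (by linarith)]; ring
    · rw [max_eq_right hx, max_eq_left (by linarith)]; ring

/-- The product rule for bounded continuous functions in the domain. -/
lemma gamma_mul_of_continuous (h : A.IsStronglyLocalRegular) (hΓ : A.IsCarreDuChamp Γ)
    (u v : A.dom) {g k : E → ℝ} (hg : Continuous g) (hk : Continuous k)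
    (hug : ∀ᵐ x ∂μ, u.1 x = g x) (hvk : ∀ᵐ x ∂μ, v.1 x = k x)
    {B C : ℝ} (hgB : ∀ x, |g x| ≤ B) (hkC : ∀ x, |k x| ≤ C) :
    ∃ w : A.dom, (∀ᵐ x ∂μ, w.1 x = g x * k x) ∧
      ∀ f : A.dom, ∀ᵐ x ∂μ, Γ w f x = g x * Γ v f x + k x * Γ u f x := by
  obtain ⟨p, hp, hpΓ⟩ := gamma_sq h hΓ (u + v) (g := fun x => g x + k x) (by fun_prop) (by
    filter_upwards [hug, hvk, ae_add u v] with x h1 h2 h3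
    rw [h3, h1, h2]) (B := B + C) (fun x => (abs_add_le _ _).trans (add_le_add (hgB x) (hkC x)))
  obtain ⟨q, hq, hqΓ⟩ := gamma_sq h hΓ (u - v) (g := fun x => g x - k x) (by fun_prop) (by
    filter_upwards [hug, hvk, ae_sub u v] with x h1 h2 h3
    rw [h3, h1, h2]) (B := B + C) (fun x => (abs_sub _ _).trans (add_le_add (hgB x) (hkC x)))
  refine ⟨(1 / 4 : ℝ) • (p - q), ?_, fun f => ?_⟩
  · filter_upwards [hp, hq, ae_sub p q, ae_smul (1 / 4) (p - q)] with x h1 h2 h3 h4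
    rw [h4, h3, h1, h2]; ring
  · filter_upwards [hpΓ f, hqΓ f, gamma_sub_left (Γ := Γ) p q f,
      gamma_smul_left (Γ := Γ) (1 / 4) (p - q) f, gamma_add_left (Γ := Γ) u v f,
      gamma_sub_left (Γ := Γ) u v f] with x h1 h2 h3 h4 h5 h6
    rw [h4, h3, h1, h2, h5, h6]; ring

/-- The product rule for a bounded continuous function with bounded carré du champ and an
arbitrary function in the domain. -/
theorem gamma_mul (h : A.IsStronglyLocalRegular) (hΓ : A.IsCarreDuChamp Γ)
    (u v : A.dom) {g : E → ℝ} (hg : Continuous g) (hug : ∀ᵐ x ∂μ, u.1 x = g x)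
    {B C : ℝ} (hgB : ∀ x, |g x| ≤ B) (hC : ∀ᵐ x ∂μ, Γ u u x ≤ C) :
    ∃ w : A.dom, (∀ᵐ x ∂μ, w.1 x = g x * v.1 x) ∧
      ∀ f : A.dom, ∀ᵐ x ∂μ, Γ w f x = g x * Γ v f x + v.1 x * Γ u f x := by
  have hex : ∀ n : ℕ, ∃ (y : A.dom) (w : A.dom), A.form1 (v - y) (v - y) < 1 / ((n : ℝ) + 1) ∧
      (∀ᵐ x ∂μ, w.1 x = g x * y.1 x) ∧
      ∀ f : A.dom, ∀ᵐ x ∂μ, Γ w f x = g x * Γ y f x + y.1 x * Γ u f x := by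
    intro n
    obtain ⟨y, k, hk, hkc, hyk, hvy⟩ := h.regular_dom v (1 / ((n : ℝ) + 1)) (by positivity)
    obtain ⟨C, hC⟩ := hk.bounded_above_of_compact_support hkc
    obtain ⟨w, hw, hwΓ⟩ := gamma_mul_of_continuous h hΓ u y hg hk hug hyk hgB hC
    refine ⟨y, w, hvy, ?_, fun f => ?_⟩
    · filter_upwards [hw, hyk] with x h1 h2
      rw [h1, h2]
    · filter_upwards [hwΓ f, hyk] with x h1 h2
      rw [h1, h2]
  choose y w hy hw hwΓ using hex
  have hB' : ∀ x, |g x| ≤ |B| := fun x => (hgB x).trans (le_abs_self B)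
  simp only [form1_self] at hy
  have hlim0 := tendsto_one_div_add_atTop_nhds_zero_nat (𝕜 := ℝ)
  have hyA : Tendsto (fun n => A.form (y n - v) (y n - v)) atTop (𝓝 0) := by
    refine squeeze_zero (fun n => h.dirichlet.nonneg _) (fun n => ?_) hlim0
    have e : y n - v = -(v - y n) := by abel
    rw [e]
    have := hy n
    simp only [map_neg, LinearMap.neg_apply, neg_neg]
    nlinarith [sq_nonneg ‖A.toL2 (v - y n)‖]
  have hyL : Tendsto (fun n => ‖A.toL2 (y n) - A.toL2 v‖) atTop (𝓝 0) := by
    have h1 : Tendsto (fun n => ‖A.toL2 (v - y n)‖ ^ 2) atTop (𝓝 0) :=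
      squeeze_zero (fun n => by positivity) (fun n => by
        linarith [hy n, h.dirichlet.nonneg (v - y n)]) hlim0
    have := (Real.continuous_sqrt.tendsto 0).comp h1
    simpa [Function.comp_def, Real.sqrt_sq (norm_nonneg _), norm_sub_rev] using this
  have hgm : MemLp (fun x => g x * v.1 x) 2 μ := by
    refine MemLp.of_le_mul (c := |B|) (A.memLp v.1 v.2)
      (hg.aestronglyMeasurable.mul v.1.aestronglyMeasurable) ?_
    refine Eventually.of_forall fun x => ?_
    rw [norm_mul]
    exact mul_le_mul_of_nonneg_right (hB' x) (norm_nonneg _)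
  have hwL : Tendsto (fun n => A.toL2 (w n)) atTop (𝓝 hgm.toLp) := by
    rw [tendsto_iff_norm_sub_tendsto_zero]
    refine squeeze_zero (fun _ => norm_nonneg _) (fun n => ?_)
      (by simpa using hyL.const_mul |B|)
    refine Lp.norm_le_mul_norm_of_ae_le_mul ?_
    filter_upwards [hw n, Lp.coeFn_sub (A.toL2 (w n)) hgm.toLp, hgm.coeFn_toLp,
      Lp.coeFn_sub (A.toL2 (y n)) (A.toL2 v)] with x h1 h2 h3 h4
    rw [h2, h4]
    simp only [Pi.sub_apply]
    rw [h3, coe_toL2, coe_toL2, coe_toL2, h1, ← mul_sub, norm_mul]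
    exact mul_le_mul_of_nonneg_right (hB' x) (norm_nonneg _)
  have hwd : ∀ m n (f : A.dom), ∀ᵐ x ∂μ, Γ (w m - w n) f x =
      g x * Γ (y m - y n) f x + (y m - y n).1 x * Γ u f x := by
    intro m n f
    filter_upwards [hwΓ m f, hwΓ n f, gamma_sub_left (Γ := Γ) (w m) (w n) f,
      gamma_sub_left (Γ := Γ) (y m) (y n) f, ae_sub (y m) (y n)] with x h1 h2 h3 h4 h5
    rw [h3, h4, h5, h1, h2]; ring
  have hwA : ∀ m n, A.form (w m - w n) (w m - w n) ≤
      2 * |B| ^ 2 * A.form (y m - y n) (y m - y n) + 2 * |C| * ‖A.toL2 (y m - y n)‖ ^ 2 := by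
    intro m n
    have hsq : Integrable (fun x => (y m - y n).1 x ^ 2) μ :=
      (A.memLp _ (y m - y n).2).integrable_sq
    have e1 : ‖A.toL2 (y m - y n)‖ ^ 2 = ∫ x, (y m - y n).1 x ^ 2 ∂μ := by
      rw [← real_inner_self_eq_norm_sq, L2.inner_def]
      refine integral_congr_ae (Eventually.of_forall fun x => ?_)
      simp only [coe_toL2]
      simp [sq]
    rw [e1, hΓ.integral_eq, hΓ.integral_eq, ← integral_const_mul, ← integral_const_mul,
      ← integral_add ((hΓ.integrable _ _).const_mul _) (hsq.const_mul _)]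
    refine integral_mono_ae (hΓ.integrable _ _)
      (((hΓ.integrable _ _).const_mul _).add (hsq.const_mul _)) ?_
    have h2 := hwd m n (y m - y n)
    have h3 := hwd m n u
    rw [hΓ.symm _ (y m - y n)] at h2
    rw [hΓ.symm _ u] at h3
    filter_upwards [hwd m n (w m - w n), h2, h3, gamma_cauchy_schwarz hΓ u (y m - y n), hC,
      hΓ.nonneg u, hΓ.nonneg (y m - y n)] with x h1 h2 h3 h4 h5 h6 h7
    rw [h1, h2, h3, hΓ.symm (y m - y n) u]
    generalize Γ (y m - y n) (y m - y n) x = a at *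
    generalize Γ u (y m - y n) x = b at *
    generalize Γ u u x = c at *
    generalize (y m - y n).1 x = d at *
    have hg2 : g x ^ 2 ≤ |B| ^ 2 := sq_le_sq' (by linarith [abs_le.1 (hB' x)]) (abs_le.1 (hB' x)).2
    have hc2 : c ≤ |C| := h5.trans (le_abs_self C)
    have key : 2 * (g x * d * b) ≤ g x ^ 2 * a + d ^ 2 * c := by
      have h8 : (2 * (g x * d * b)) ^ 2 ≤ (g x ^ 2 * a + d ^ 2 * c) ^ 2 := by
        have : (g x * d) ^ 2 * b ^ 2 ≤ (g x * d) ^ 2 * (c * a) := by gcongr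
        nlinarith [sq_nonneg (g x ^ 2 * a - d ^ 2 * c)]
      exact abs_le_of_sq_le_sq' h8 (by positivity) |>.2
    nlinarith [mul_le_mul_of_nonneg_right hg2 h7, mul_le_mul_of_nonneg_left hc2 (sq_nonneg d)]
  obtain ⟨z, hz, hzlim⟩ := exists_of_cauchy h.dirichlet w hgm.toLp (by
    intro ε hε
    have e1 : Tendsto (fun n => (8 * |B| ^ 2) * A.form (y n - v) (y n - v) +
        (8 * |C|) * ‖A.toL2 (y n) - A.toL2 v‖ ^ 2) atTop (𝓝 0) := by
      have := (hyA.const_mul (8 * |B| ^ 2)).add ((hyL.pow 2).const_mul (8 * |C|))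
      rwa [mul_zero, zero_pow two_ne_zero, mul_zero, add_zero] at this
    obtain ⟨k, hk⟩ := eventually_atTop.1 (e1.eventually_lt_const (half_pos hε))
    refine ⟨k, fun m hm n hn => (hwA m n).trans_lt ?_⟩
    have h1 := hk m hm
    have h2 := hk n hn
    have e2 : y m - y n = (y m - v) - (y n - v) := by abel
    have h3 := form_sub_self_le h.dirichlet h.symm (y m - v) (y n - v)
    rw [← e2] at h3
    have h4 : ‖A.toL2 (y m - y n)‖ ^ 2 ≤ 2 * ‖A.toL2 (y m) - A.toL2 v‖ ^ 2 +
        2 * ‖A.toL2 (y n) - A.toL2 v‖ ^ 2 := by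
      have : ‖A.toL2 (y m - y n)‖ ≤ ‖A.toL2 (y m) - A.toL2 v‖ + ‖A.toL2 (y n) - A.toL2 v‖ := by
        rw [e2, map_sub, map_sub, map_sub]; exact norm_sub_le _ _
      nlinarith [norm_nonneg (A.toL2 (y m - y n)),
        sq_nonneg (‖A.toL2 (y m) - A.toL2 v‖ - ‖A.toL2 (y n) - A.toL2 v‖)]
    have hB2 : 0 ≤ |B| ^ 2 := by positivity
    nlinarith [mul_le_mul_of_nonneg_left h3 hB2, mul_le_mul_of_nonneg_left h4 (abs_nonneg C),
      h.dirichlet.nonneg (y m - v), h.dirichlet.nonneg (y n - v)]) hwL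
  refine ⟨z, ?_, fun f => ?_⟩
  · filter_upwards [hgm.coeFn_toLp] with x hx
    rw [hz]; exact hx
  · obtain ⟨n1, hn1, hl1⟩ := exists_subseq_gamma hΓ w z hzlim
    obtain ⟨n2, hn2, hl2⟩ := exists_subseq_gamma hΓ (y ∘ n1) v (hyA.comp hn1.tendsto_atTop)
    have hyL2 : Tendsto (fun k => A.toL2 (y (n1 (n2 k)))) atTop (𝓝 (A.toL2 v)) := by
      rw [tendsto_iff_norm_sub_tendsto_zero]
      exact (hyL.comp hn1.tendsto_atTop).comp hn2.tendsto_atTop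
    obtain ⟨n3, hn3, hl3⟩ := (tendstoInMeasure_of_tendsto_Lp hyL2).exists_seq_tendsto_ae
    filter_upwards [hl1 f, hl2 f, hl3, ae_all_iff.2 fun n => hwΓ n f] with x h1 h2 h3 h4
    refine tendsto_nhds_unique ((h1.comp hn2.tendsto_atTop).comp hn3.tendsto_atTop) ?_
    simp only [Function.comp_def, h4]
    exact ((h2.comp hn3.tendsto_atTop).const_mul (g x)).add (h3.mul_const (Γ u f x))

end Gamma

end L2Form

end

noncomputable section

/-! ### Functions of the exhaustion function -/

section EssBounded

variable {E : Type*} [MeasurableSpace E] {μ : Measure E}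

lemma EssBdd.congr {u v : E → ℝ} (h : EssBdd μ u) (huv : ∀ᵐ x ∂μ, v x = u x) : EssBdd μ v := by
  obtain ⟨C, hC⟩ := h
  exact ⟨C, by filter_upwards [hC, huv] with x h1 h2; rwa [h2]⟩

lemma EssBdd.mul {u v : E → ℝ} (hu : EssBdd μ u) (hv : EssBdd μ v) :
    EssBdd μ (fun x => u x * v x) := by
  obtain ⟨C, hC⟩ := hu
  obtain ⟨D, hD⟩ := hv
  refine ⟨C * D, ?_⟩
  filter_upwards [hC, hD] with x h1 h2
  rw [abs_mul]
  exact mul_le_mul h1 h2 (abs_nonneg _) ((abs_nonneg _).trans h1)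

lemma EssBdd.add {u v : E → ℝ} (hu : EssBdd μ u) (hv : EssBdd μ v) :
    EssBdd μ (fun x => u x + v x) := by
  obtain ⟨C, hC⟩ := hu
  obtain ⟨D, hD⟩ := hv
  refine ⟨C + D, ?_⟩
  filter_upwards [hC, hD] with x h1 h2
  exact (abs_add_le _ _).trans (add_le_add h1 h2)

lemma essBdd_of_le {u : E → ℝ} {C : ℝ} (h : ∀ x, |u x| ≤ C) : EssBdd μ u :=
  ⟨C, Eventually.of_forall h⟩

end EssBounded

section Derivation

variable {E : Type*} [MeasurableSpace E] [TopologicalSpace E] {μ : Measure E} {E₀ : L2Form μ}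
  {N : (E →ₘ[μ] ℝ) →ₗ.[ℝ] (E →ₘ[μ] ℝ)}

/-- A bounded element of the domain of the form, as an element of the domain of `N`. -/
def IsDivFreeDerivation.lift (hN : IsDivFreeDerivation E₀ N) (u : E₀.dom) (hu : EssBdd μ u.1) :
    N.domain := ⟨u.1, hN.mem_domain u.1 u.2 hu⟩

@[simp] lemma IsDivFreeDerivation.coe_lift (hN : IsDivFreeDerivation E₀ N) (u : E₀.dom)
    (hu : EssBdd μ u.1) : (hN.lift u hu : E →ₘ[μ] ℝ) = u.1 := rfl

lemma IsDivFreeDerivation.eq_of_sub_const (hN : IsDivFreeDerivation E₀ N) (u v : N.domain)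
    (hu : u.1 ∈ E₀.dom) (hv : v.1 ∈ E₀.dom) (hub : EssBdd μ u.1) (hvb : EssBdd μ v.1)
    {B : Set E} (hB : MeasurableSet B) (c : ℝ) (h : ∀ᵐ x ∂μ, x ∈ B → u.1 x = v.1 x + c) :
    ∀ᵐ x ∂μ, x ∈ B → N u x = N v x := by
  have hs := AEEqFun.coeFn_sub u.1 v.1
  have hb : EssBdd μ (u - v).1 := by
    obtain ⟨C, hC⟩ := hub
    obtain ⟨D, hD⟩ := hvb
    refine ⟨C + D, ?_⟩
    filter_upwards [hC, hD, hs] with x h1 h2 h3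
    have : (u - v).1 x = u.1 x - v.1 x := h3
    rw [this]
    exact (abs_sub _ _).trans (add_le_add h1 h2)
  have := hN.isLocal (u - v) (E₀.dom.sub_mem hu hv) hb B c hB (by
    filter_upwards [h, hs] with x h1 h2 hx
    have : (u - v).1 x = u.1 x - v.1 x := h2
    rw [this, h1 hx]; ring)
  rw [LinearPMap.map_sub] at this
  filter_upwards [this, AEEqFun.coeFn_sub (N u) (N v)] with x h1 h2 hx
  have h3 := h1 hx
  rw [h2, Pi.sub_apply] at h3
  linarith

lemma IsDivFreeDerivation.integrable [OpensMeasurableSpace E]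
    (hN : IsDivFreeDerivation E₀ N) (u : N.domain)
    (hu : u.1 ∈ E₀.dom) (hub : EssBdd μ u.1) {V : Set E} (hV : IsOpen V)
    (hVc : IsCompact (closure V)) (h : ∀ᵐ x ∂μ, x ∉ V → u.1 x = 0) :
    Integrable (N u) μ ∧ (∀ᵐ x ∂μ, x ∉ V → N u x = 0) ∧ ∫ x, N u x ∂μ = 0 := by
  have h0 : ∀ᵐ x ∂μ, x ∉ V → N u x = 0 :=
    hN.isLocal u hu hub Vᶜ 0 hV.measurableSet.compl h
  refine ⟨?_, h0, hN.integral_eq_zero u hu hub (hVc.of_isClosed_subset Measure.isClosed_support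
    (essSupport_subset_of_isClosed isClosed_closure
      (h.mono fun x hx hx' => hx fun hx'' => hx' (subset_closure hx''))))⟩
  have h1 : IntegrableOn (N u) (closure V) μ :=
    (hN.locallyIntegrable u).integrableOn_isCompact hVc
  rw [← integrable_indicator_iff isClosed_closure.measurableSet] at h1
  refine h1.congr ?_
  filter_upwards [h0] with x hx
  by_cases hxV : x ∈ closure V
  · rw [indicator_of_mem hxV]
  · rw [indicator_of_notMem hxV, hx fun hx' => hxV (subset_closure hx')]

end Derivation

section Sublevel

variable {E : Type*} [TopologicalSpace E] [MeasurableSpace E] {μ : Measure E}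
    {E₀ : L2Form μ} {Γ : E₀.dom →ₗ[ℝ] E₀.dom →ₗ[ℝ] (E →ₘ[μ] ℝ)}
    {N : (E →ₘ[μ] ℝ) →ₗ.[ℝ] (E →ₘ[μ] ℝ)} {ρ : E → ℝ} {Γρ Nρ : E →ₘ[μ] ℝ} {K₀ : Set E}

lemma HypH3.isOpen_sublevel (H3 : HypH3 E₀ Γ N ρ Γρ Nρ K₀) (r : ℝ) : IsOpen (sublevel ρ r) :=
  isOpen_lt H3.continuous continuous_const

lemma HypH3.closure_sublevel_subset (H3 : HypH3 E₀ Γ N ρ Γρ Nρ K₀) {r s : ℝ} (hrs : r < s) :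
    closure (sublevel ρ r) ⊆ sublevel ρ s := by
  have : closure (sublevel ρ r) ⊆ {x | ρ x ≤ r} :=
    closure_minimal (fun x (hx : ρ x < r) => show ρ x ≤ r from hx.le) (isClosed_le H3.continuous continuous_const)
  exact fun x hx => lt_of_le_of_lt (this hx) hrs

lemma HypH3.gamma_nonneg (hΓ : E₀.IsCarreDuChamp Γ) (H3 : HypH3 E₀ Γ N ρ Γρ Nρ K₀) :
    ∀ᵐ x ∂μ, 0 ≤ Γρ x := by
  have h : ∀ n : ℕ, ∀ᵐ x ∂μ, ρ x < (n : ℝ) + 1 → 0 ≤ Γρ x := by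
    intro n
    obtain ⟨p, hp⟩ := H3.gamma (sublevel ρ ((n : ℝ) + 1)) (H3.isOpen_sublevel _)
      (H3.compact_sublevel _ (by positivity))
    filter_upwards [hp, hΓ.nonneg p] with x h1 h2 hx
    rw [(h1 hx).2]; exact h2
  filter_upwards [ae_all_iff.2 h] with x hx
  exact hx ⌊ρ x⌋₊ (Nat.lt_floor_add_one _)

lemma HypH3.gamma_bdd_annulus (H3 : HypH3 E₀ Γ N ρ Γρ Nρ K₀) {R R' : ℝ}
    (hK : K₀ ⊆ sublevel ρ R) : ∃ C : ℝ, ∀ᵐ x ∂μ, R ≤ ρ x → ρ x ≤ R' → |Γρ x| ≤ C := by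
  have hS : IsCompact {x | R ≤ ρ x ∧ ρ x ≤ R'} := by
    refine (H3.compact_sublevel (|R'| + 1) (by positivity)).of_isClosed_subset
      ((isClosed_le continuous_const H3.continuous).inter
        (isClosed_le H3.continuous continuous_const)) fun x hx => subset_closure ?_
    have h1 := hx.2
    have h2 := le_abs_self R'
    show ρ x < |R'| + 1
    linarith
  obtain ⟨C, hC⟩ := H3.gamma_bdd _ hS fun x hx hx' => absurd (hK hx') (not_lt.2 hx.1)
  exact ⟨C, hC.mono fun x hx h1 h2 => hx ⟨h1, h2⟩⟩

lemma HypH3.exists_subset_sublevel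
    (H3 : HypH3 E₀ Γ N ρ Γρ Nρ K₀) {S : Set E} (hS : IsCompact S) :
    ∃ R : ℝ, 0 ≤ R ∧ ∀ r, R ≤ r → S ⊆ sublevel ρ r := by
  obtain ⟨C, hC⟩ := hS.exists_bound_of_continuousOn H3.continuous.continuousOn
  refine ⟨|C| + 1, by positivity, fun r hr x hx => ?_⟩
  have h1 := hC x hx
  have h2 := le_abs_self (ρ x)
  have h3 := le_abs_self C
  rw [Real.norm_eq_abs] at h1
  show ρ x < r
  linarith

end Sublevel

section Exhaustion

variable {E : Type*} [MetricSpace E] [LocallyCompactSpace E]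
    [TopologicalSpace.SeparableSpace E] [MeasurableSpace E] [BorelSpace E]
    {μ : Measure E} {E₀ : L2Form μ} {Γ : E₀.dom →ₗ[ℝ] E₀.dom →ₗ[ℝ] (E →ₘ[μ] ℝ)}
    {N : (E →ₘ[μ] ℝ) →ₗ.[ℝ] (E →ₘ[μ] ℝ)} {ρ : E → ℝ} {Γρ Nρ : E →ₘ[μ] ℝ} {K₀ : Set E}

/-- `C¹`-functions of `ρ` that vanish for large values of `ρ` belong to the domain of the form and
satisfy the chain rule. -/
theorem HypH3.exists_comp (hE₀ : E₀.IsStronglyLocalRegular) (hΓ : E₀.IsCarreDuChamp Γ)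
    (hN : IsDivFreeDerivation E₀ N) (H3 : HypH3 E₀ Γ N ρ Γρ Nρ K₀)
    {G G' : ℝ → ℝ} (hG : ∀ r, HasDerivAt G (G' r) r) (hG' : Continuous G') {C : ℝ}
    (hGC : ∀ r, |G r| ≤ C) (hGC' : ∀ r, |G' r| ≤ C) {R : ℝ} (hR : 0 ≤ R)
    (hG0 : ∀ r, R ≤ r → G r = 0) (hG0' : ∀ r, R ≤ r → G' r = 0) :
    ∃ (w : E₀.dom) (w' : N.domain), w'.1 = w.1 ∧ (∀ᵐ x ∂μ, w.1 x = G (ρ x)) ∧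
      (∀ᵐ x ∂μ, Γ w w x = G' (ρ x) ^ 2 * Γρ x) ∧ ∀ᵐ x ∂μ, N w' x = G' (ρ x) * Nρ x := by
  have hcρ := H3.continuous
  have hGc : Continuous G := continuous_iff_continuousAt.2 fun x => (hG x).continuousAt
  obtain ⟨q, hqd, hqb, hq⟩ := H3.drift (sublevel ρ (R + 3)) (H3.isOpen_sublevel _)
    (H3.compact_sublevel _ (by linarith))
  obtain ⟨c1, g1, hg1, hg101, -, hg1s, hg1K, hc1⟩ := L2Form.exists_cutoff hE₀ (μ := μ)
    (H3.compact_sublevel (R + 1) (by linarith)) (H3.isOpen_sublevel (R + 2))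
    (H3.closure_sublevel_subset (by linarith))
  obtain ⟨c2, g2, hg2, hg201, hg2c, hg2s, hg2K, hc2⟩ := L2Form.exists_cutoff hE₀ (μ := μ)
    (H3.compact_sublevel (R + 2) (by linarith)) (H3.isOpen_sublevel (R + 3))
    (H3.closure_sublevel_subset (by linarith))
  have hg1z : ∀ x, R + 2 ≤ ρ x → g1 x = 0 := fun x hx =>
    image_eq_zero_of_notMem_tsupport fun h => absurd (hg1s h) (not_lt.2 hx)
  have hg2z : ∀ x, R + 3 ≤ ρ x → g2 x = 0 := fun x hx =>
    image_eq_zero_of_notMem_tsupport fun h => absurd (hg2s h) (not_lt.2 hx)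
  have hg1o : ∀ x, ρ x < R + 1 → g1 x = 1 := fun x hx => hg1K x (subset_closure hx)
  have hg2o : ∀ x, ρ x < R + 2 → g2 x = 1 := fun x hx => hg2K x (subset_closure hx)
  have hc1b : EssBdd μ c1.1 := (essBdd_of_le (u := g1) (C := 1) fun x => by
    rw [abs_of_nonneg (hg101 x).1]; exact (hg101 x).2).congr hc1
  have hc2b : EssBdd μ c2.1 := (essBdd_of_le (u := g2) (C := 1) fun x => by
    rw [abs_of_nonneg (hg201 x).1]; exact (hg201 x).2).congr hc2
  obtain ⟨r, hr⟩ := L2Form.exists_mul hE₀.dirichlet hE₀.symm c2 ⟨q.1, hqd⟩ hc2b hqb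
  let k : E → ℝ := fun x => g2 x * ρ x
  have hrk : ∀ᵐ x ∂μ, r.1 x = k x := by
    filter_upwards [hr, hc2, hq] with x h1 h2 h3
    rw [h1, h2]
    by_cases hx : ρ x < R + 3
    · rw [← (h3 hx).1]
    · simp [k, hg2z x (not_lt.1 hx)]
  have hkc : Continuous k := hg2.mul hcρ
  have hk0 : ∀ x, 0 ≤ k x := fun x => mul_nonneg (hg201 x).1 (H3.nonneg x)
  have hk3 : ∀ x, k x < R + 4 := fun x => by
    by_cases hx : ρ x < R + 3
    · have := mul_le_mul_of_nonneg_right (hg201 x).2 (H3.nonneg x)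
      simp only [k]; linarith
    · simp only [k]
      rw [hg2z x (not_lt.1 hx)]; linarith
  have hkρ : ∀ x, ρ x < R + 2 → k x = ρ x := fun x hx => by simp [k, hg2o x hx]
  obtain ⟨w1, hw1, hw1Γ⟩ := L2Form.gamma_comp hE₀ hΓ r hkc hk0 hrk (B := R + 4) (by linarith) hk3
    (F := fun y => G y - G 0) (F' := G') (fun x => (hG x).sub_const _) hG' (by simp)
  have hw1b : EssBdd μ w1.1 := (essBdd_of_le (u := fun x => G (k x) - G 0) (C := C + C) fun x =>
    (abs_sub _ _).trans (add_le_add (hGC _) (hGC _))).congr hw1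
  obtain ⟨w2, hw2⟩ := L2Form.exists_mul hE₀.dirichlet hE₀.symm c1 w1 hc1b hw1b
  have hw : ∀ᵐ x ∂μ, (w2 + G 0 • c1).1 x = G (ρ x) := by
    filter_upwards [hw2, hw1, hc1, L2Form.ae_add w2 (G 0 • c1), L2Form.ae_smul (G 0) c1]
      with x h1 h2 h3 h4 h5
    rw [h4, h5, h1, h2, h3]
    by_cases hx : ρ x < R + 2
    · rw [hkρ x hx]
      by_cases hx' : ρ x < R + 1
      · rw [hg1o x hx']; ring
      · rw [hG0 (ρ x) (by linarith)]; ring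
    · rw [hg1z x (not_lt.1 hx), hG0 (ρ x) (by linarith)]; ring
  set w := w2 + G 0 • c1 with hwdef
  have hwb : EssBdd μ w.1 := (essBdd_of_le (u := fun x => G (ρ x)) fun x => hGC _).congr hw
  have hrb : EssBdd μ r.1 := (essBdd_of_le (u := k) (C := R + 4) fun x => by
    rw [abs_of_nonneg (hk0 x)]; exact (hk3 x).le).congr hrk
  have hww1 : ∀ᵐ x ∂μ, x ∈ sublevel ρ (R + 1) → w.1 x = w1.1 x + G 0 := by
    filter_upwards [hw, hw1] with x h1 h2 hx
    have : ρ x < R + 1 := hx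
    rw [h1, h2, hkρ x (by linarith)]; ring
  have hU2 : IsOpen {x | R < ρ x} := isOpen_lt continuous_const hcρ
  have hwz : ∀ᵐ x ∂μ, x ∈ {x | R < ρ x} → w.1 x = 0 := by
    filter_upwards [hw] with x h1 hx
    rw [h1, hG0 _ (le_of_lt hx)]
  refine ⟨w, hN.lift w hwb, rfl, hw, ?_, ?_⟩
  · obtain ⟨p, hp⟩ := H3.gamma (sublevel ρ (R + 1)) (H3.isOpen_sublevel _)
      (H3.compact_sublevel _ (by linarith))
    have e1 := L2Form.gamma_self_congr_on hΓ (L2Form.gamma_eq_zero_of_const hE₀ hΓ (w - w1)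
      (H3.isOpen_sublevel (R + 1)) (G 0) (by
        filter_upwards [hww1, L2Form.ae_sub w w1] with x h1 h2 hx
        rw [h2, h1 hx]; ring))
    have e2 := L2Form.gamma_self_congr_on hΓ (L2Form.gamma_eq_zero_of_const hE₀ hΓ (r - p)
      (H3.isOpen_sublevel (R + 1)) 0 (by
        filter_upwards [hrk, hp, L2Form.ae_sub r p] with x h1 h2 h3 hx
        have : ρ x < R + 1 := hx
        rw [h3, h1, hkρ x (by linarith), (h2 hx).1]; ring))
    have e3 := L2Form.gamma_eq_zero_of_const hE₀ hΓ w hU2 0 hwz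
    have e4 := hw1Γ r
    rw [hΓ.symm w1 r] at e4
    filter_upwards [e1, e2, e3, hw1Γ w1, e4, hp] with x h1 h2 h3 h4 h5 h6
    by_cases hx : ρ x < R + 1
    · rw [h1 hx, h4, h5, h2 hx, (h6 hx).2, hkρ x (by linarith)]; ring
    · rw [h3 (show R < ρ x by linarith), hG0' _ (by linarith)]; ring
  · have hU1 := (H3.isOpen_sublevel (R + 1)).measurableSet
    have e1 := hN.eq_of_sub_const (hN.lift w hwb) (hN.lift w1 hw1b) w.2 w1.2 hwb hw1b hU1 (G 0) hww1
    have e2 := hN.eq_of_sub_const (hN.lift r hrb) q r.2 hqd hrb hqb hU1 0 (by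
      filter_upwards [hrk, hq] with x h1 h2 hx
      have hx' : ρ x < R + 1 := hx
      have : ρ x < R + 3 := by linarith
      rw [hN.coe_lift, h1, hkρ x (by linarith), (h2 this).1, add_zero])
    have e3 := hN.isLocal (hN.lift w hwb) w.2 hwb _ 0 hU2.measurableSet hwz
    have hd : deriv (fun y => G y - G 0) = G' := funext fun y => ((hG y).sub_const _).deriv
    have e4 := hN.chain (hN.lift r hrb) (hN.lift w1 hw1b) (fun y => G y - G 0) hrb
      (contDiff_one_iff_deriv.2 ⟨fun y => ((hG y).sub_const _).differentiableAt, by rwa [hd]⟩)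
      ⟨C + C, fun y => ⟨(abs_sub _ _).trans (add_le_add (hGC _) (hGC _)), by
        rw [hd]; linarith [hGC' y, abs_nonneg (G' y)]⟩⟩ (by
      filter_upwards [hw1, hrk] with x h1 h2
      rw [hN.coe_lift, hN.coe_lift, h1, h2])
    rw [hd] at e4
    filter_upwards [e1, e2, e3, e4, hq, hrk] with x h1 h2 h3 h4 h5 h6
    rw [hN.coe_lift, h6] at h4
    by_cases hx : ρ x < R + 1
    · have hx3 : ρ x < R + 3 := by linarith
      rw [h1 hx, h4, h2 hx, (h5 hx3).2, hkρ x (by linarith)]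
    · rw [h3 (show R < ρ x by linarith), hG0' _ (by linarith)]; ring

end Exhaustion

end

noncomputable section

/-! ### The weighted energy inequality -/

section Energy

variable {E : Type*} [MetricSpace E] [LocallyCompactSpace E]
    [TopologicalSpace.SeparableSpace E] [MeasurableSpace E] [BorelSpace E]
    {μ : Measure E} {E₀ : L2Form μ} {Γ : E₀.dom →ₗ[ℝ] E₀.dom →ₗ[ℝ] (E →ₘ[μ] ℝ)}
    {N : (E →ₘ[μ] ℝ) →ₗ.[ℝ] (E →ₘ[μ] ℝ)}

lemma EssBdd.integrable_mul {E : Type*} [MeasurableSpace E] {μ : Measure E} {u v : E → ℝ}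
    (hu : EssBdd μ u) (hum : AEStronglyMeasurable u μ) (hv : Integrable v μ) :
    Integrable (fun x => u x * v x) μ := by
  obtain ⟨C, hC⟩ := hu
  exact hv.bdd_mul hum hC

/-- The weighted energy inequality for a solution of the evolution equation on `V` with the weight
`W = g + c`. -/
theorem energy_inequality (hE₀ : E₀.IsStronglyLocalRegular) (hΓ : E₀.IsCarreDuChamp Γ)
    (hN : IsDivFreeDerivation E₀ N) {V : Set E} (hV : IsOpen V) (hVc : IsCompact (closure V))
    (v : E₀.dom) (v' : N.domain) (hvv : v'.1 = v.1) (hvb : EssBdd μ v.1)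
    (hv0 : ∀ᵐ x ∂μ, x ∉ V → v.1 x = 0) (L : E → ℝ)
    (hL : ∀ u : E₀.dom, EssBdd μ u.1 → (∀ᵐ x ∂μ, x ∉ V → u.1 x = 0) →
      -∫ x in V, L x * u.1 x ∂μ = ∫ x, Γ u v x ∂μ + ∫ x in V, u.1 x * N v' x ∂μ)
    (w : E₀.dom) (w' : N.domain) (hww : w'.1 = w.1) {g : E → ℝ} (hg : Continuous g) {B C c : ℝ}
    (hgB : ∀ x, |g x| ≤ B) (hwg : ∀ᵐ x ∂μ, w.1 x = g x) (hC : ∀ᵐ x ∂μ, Γ w w x ≤ C)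
    (hW : ∀ x, 0 ≤ g x + c) {θ Λ : ℝ} (hθ : 0 ≤ θ) {D e : E → ℝ} (hD0 : ∀ᵐ x ∂μ, 0 ≤ D x)
    (hD : ∀ᵐ x ∂μ, Γ w w x = (2 * θ * (g x + c)) ^ 2 * D x)
    (he : ∀ᵐ x ∂μ, N w' x = 2 * θ * (g x + c) * e x) (hDe : ∀ᵐ x ∂μ, x ∈ V → D x + e x ≤ Λ) :
    2 * ∫ x in V, L x * v.1 x * (g x + c) ∂μ ≤
      -2 * (1 - θ) * (∫ x, (g x + c) * Γ v v x ∂μ) +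
        2 * θ * Λ * ∫ x in V, v.1 x ^ 2 * (g x + c) ∂μ := by
  have hgb : EssBdd μ g := essBdd_of_le hgB
  have hwb : EssBdd μ w.1 := hgb.congr hwg
  have hgm : AEStronglyMeasurable g μ := hg.aestronglyMeasurable
  have hWb : EssBdd μ (fun x => g x + c) := hgb.add (essBdd_of_le (C := |c|) fun _ => le_rfl)
  have hWm : AEStronglyMeasurable (fun x => g x + c) μ := hgm.add aestronglyMeasurable_const
  have hd := hE₀.dirichlet
  obtain ⟨z, hz, hzΓ⟩ := L2Form.gamma_mul hE₀ hΓ w v hg hwg hgB hC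
  obtain ⟨v2, hv2⟩ := L2Form.exists_mul hd hE₀.symm v v hvb hvb
  have hv2b : EssBdd μ v2.1 := (hvb.mul hvb).congr hv2
  obtain ⟨y, hy⟩ := L2Form.exists_mul hd hE₀.symm w v2 hwb hv2b
  have hyb : EssBdd μ y.1 := (hwb.mul hv2b).congr hy
  have hv20 : ∀ᵐ x ∂μ, x ∉ V → v2.1 x = 0 := by
    filter_upwards [hv2, hv0] with x h1 h2 hx
    rw [h1, h2 hx, mul_zero]
  have hy0 : ∀ᵐ x ∂μ, x ∉ V → y.1 x = 0 := by
    filter_upwards [hy, hv20] with x h1 h2 hx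
    rw [h1, h2 hx, mul_zero]
  obtain ⟨hv2i, -, hv2N⟩ := hN.integrable (hN.lift v2 hv2b) v2.2 hv2b hV hVc hv20
  obtain ⟨hyi, -, hyN⟩ := hN.integrable (hN.lift y hyb) y.2 hyb hV hVc hy0
  have hv'b : EssBdd μ v'.1 := by rw [hvv]; exact hvb
  have hw'b : EssBdd μ w'.1 := by rw [hww]; exact hwb
  have p1 := hN.product v' v' (hN.lift v2 hv2b) hv'b hv'b (by
    filter_upwards [hv2] with x hx
    rw [hN.coe_lift, hx, hvv])
  have p2 := hN.product w' (hN.lift v2 hv2b) (hN.lift y hyb) hw'b hv2b (by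
    filter_upwards [hy] with x hx
    rw [hN.coe_lift, hN.coe_lift, hx, hww])
  -- the test function `(g + c) v`
  have hu : ∀ᵐ x ∂μ, (z + c • v).1 x = (g x + c) * v.1 x := by
    filter_upwards [hz, L2Form.ae_add z (c • v), L2Form.ae_smul c v] with x h1 h2 h3
    rw [h2, h1, h3]; ring
  have hub : EssBdd μ (z + c • v).1 := (hWb.mul hvb).congr hu
  have hu0 : ∀ᵐ x ∂μ, x ∉ V → (z + c • v).1 x = 0 := by
    filter_upwards [hu, hv0] with x h1 h2 hx
    rw [h1, h2 hx, mul_zero]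
  have hid := hL (z + c • v) hub hu0
  have hΓu : ∀ᵐ x ∂μ, Γ (z + c • v) v x = (g x + c) * Γ v v x + v.1 x * Γ w v x := by
    filter_upwards [hzΓ v, L2Form.gamma_add_left (Γ := Γ) z (c • v) v,
      L2Form.gamma_smul_left (Γ := Γ) c v v] with x h1 h2 h3
    rw [h2, h1, h3]; ring
  have i1 : Integrable (fun x => (g x + c) * Γ v v x) μ :=
    hWb.integrable_mul hWm (hΓ.integrable _ _)
  have i2 : Integrable (fun x => v.1 x * Γ w v x) μ :=
    hvb.integrable_mul v.1.aestronglyMeasurable (hΓ.integrable _ _)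
  have i3 : Integrable (fun x => g x * N (hN.lift v2 hv2b) x) μ := hgb.integrable_mul hgm hv2i
  have hvN : ∀ᵐ x ∂μ, v.1 x ^ 2 * N w' x = N (hN.lift y hyb) x - g x * N (hN.lift v2 hv2b) x := by
    filter_upwards [p2, hv2, hwg] with x h1 h2 h3
    rw [h1, hN.coe_lift, h2, hww, h3]; ring
  have i4 : Integrable (fun x => v.1 x ^ 2 * N w' x) μ :=
    (hyi.sub i3).congr (hvN.mono fun x hx => hx.symm)
  have hNint : ∫ x in V, (z + c • v).1 x * N v' x ∂μ = -(1 / 2) * ∫ x, v.1 x ^ 2 * N w' x ∂μ := by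
    have e1 : ∫ x in V, (z + c • v).1 x * N v' x ∂μ = ∫ x, (z + c • v).1 x * N v' x ∂μ := by
      refine setIntegral_eq_integral_of_ae_compl_eq_zero ?_
      filter_upwards [hu0] with x hx hx'
      rw [hx hx', zero_mul]
    have e2 : ∀ᵐ x ∂μ, (z + c • v).1 x * N v' x =
        1 / 2 * N (hN.lift y hyb) x + c / 2 * N (hN.lift v2 hv2b) x -
          1 / 2 * (v.1 x ^ 2 * N w' x) := by
      filter_upwards [hu, hvN, p1] with x h1 h2 h3
      rw [h1, h2, h3, hvv]; ring
    have j1 := hyi.const_mul (1 / 2)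
    have j2 := hv2i.const_mul (c / 2)
    have j3 := i4.const_mul (1 / 2)
    have j4 : Integrable (fun x => 1 / 2 * N (hN.lift y hyb) x +
      c / 2 * N (hN.lift v2 hv2b) x) μ := j1.add j2
    rw [e1, integral_congr_ae e2, integral_sub j4 j3, integral_add j1 j2,
      integral_const_mul, integral_const_mul, integral_const_mul, hyN, hv2N]
    ring
  have i5 : Integrable (fun x => v.1 x ^ 2 * (g x + c)) μ := by
    have := hWb.integrable_mul hWm (E₀.memLp v.1 v.2).integrable_sq
    simpa only [mul_comm] using this
  have hVi : ∫ x in V, v.1 x ^ 2 * (g x + c) ∂μ = ∫ x, v.1 x ^ 2 * (g x + c) ∂μ := by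
    refine setIntegral_eq_integral_of_ae_compl_eq_zero ?_
    filter_upwards [hv0] with x hx hx'
    rw [hx hx']; ring
  have hLi : ∫ x in V, L x * v.1 x * (g x + c) ∂μ = ∫ x in V, L x * (z + c • v).1 x ∂μ := by
    refine integral_congr_ae (ae_restrict_of_ae ?_)
    filter_upwards [hu] with x hx
    rw [hx]; ring
  rw [hNint, integral_congr_ae hΓu] at hid
  have hpt : ∫ x, ((1 - θ) * ((g x + c) * Γ v v x) - θ * Λ * (v.1 x ^ 2 * (g x + c))) ∂μ ≤
      ∫ x, ((g x + c) * Γ v v x + v.1 x * Γ w v x - 1 / 2 * (v.1 x ^ 2 * N w' x)) ∂μ := by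
    refine integral_mono_ae ((i1.const_mul _).sub (i5.const_mul _))
      ((i1.add i2).sub (i4.const_mul _)) ?_
    filter_upwards [L2Form.gamma_cauchy_schwarz hΓ w v, hΓ.nonneg v, hD0, hD, he, hDe, hv0]
      with x h1 h2 h3 h4 h5 h6 h7
    have hWx := hW x
    rw [h5]
    rw [h4] at h1
    generalize g x + c = W at *
    generalize Γ v v x = a at *
    generalize Γ w v x = b at *
    generalize N w' x = n at *
    by_cases hx : x ∈ V
    · have h8 := h6 hx
      generalize v.1 x = s at *
      have key : -(s * b) ≤ θ * W * (s ^ 2 * D x + a) := by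
        have h9 : (-(s * b)) ^ 2 ≤ (θ * W * (s ^ 2 * D x + a)) ^ 2 := by
          have t1 : s ^ 2 * b ^ 2 ≤ s ^ 2 * ((2 * θ * W) ^ 2 * D x * a) := by gcongr
          have t2 : 0 ≤ (θ * W) ^ 2 * (s ^ 2 * D x - a) ^ 2 := by positivity
          nlinarith
        exact (abs_le_of_sq_le_sq' h9 (by positivity)).2
      have h10 : θ * W * s ^ 2 * (D x + e x) ≤ θ * W * s ^ 2 * Λ := by gcongr
      nlinarith
    · rw [h7 hx]
      have : 0 ≤ θ * (W * a) := by positivity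
      nlinarith
  have q1 : ∫ x, ((1 - θ) * ((g x + c) * Γ v v x) - θ * Λ * (v.1 x ^ 2 * (g x + c))) ∂μ =
      (1 - θ) * (∫ x, (g x + c) * Γ v v x ∂μ) - θ * Λ * ∫ x, v.1 x ^ 2 * (g x + c) ∂μ := by
    rw [integral_sub (i1.const_mul _) (i5.const_mul _), integral_const_mul, integral_const_mul]
  have q2 : ∫ x, ((g x + c) * Γ v v x + v.1 x * Γ w v x - 1 / 2 * (v.1 x ^ 2 * N w' x)) ∂μ =
      ∫ x, ((g x + c) * Γ v v x + v.1 x * Γ w v x) ∂μ - 1 / 2 * ∫ x, v.1 x ^ 2 * N w' x ∂μ := by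
    have i12 : Integrable (fun x => (g x + c) * Γ v v x + v.1 x * Γ w v x) μ := i1.add i2
    rw [integral_sub i12 (i4.const_mul _), integral_const_mul]
  rw [q1, q2] at hpt
  rw [hVi, hLi]
  linarith

/-- The rate of change of the integral against a cut-off function. -/
theorem cutoff_inequality (hE₀ : E₀.IsStronglyLocalRegular) (hΓ : E₀.IsCarreDuChamp Γ)
    (hN : IsDivFreeDerivation E₀ N) {V : Set E} (hV : IsOpen V) (hVc : IsCompact (closure V))
    (v : E₀.dom) (v' : N.domain) (hvv : v'.1 = v.1) (hvb : EssBdd μ v.1)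
    (hv0 : ∀ᵐ x ∂μ, x ∉ V → v.1 x = 0) (L : E → ℝ)
    (hL : ∀ u : E₀.dom, EssBdd μ u.1 → (∀ᵐ x ∂μ, x ∉ V → u.1 x = 0) →
      -∫ x in V, L x * u.1 x ∂μ = ∫ x, Γ u v x ∂μ + ∫ x in V, u.1 x * N v' x ∂μ)
    (χ : E₀.dom) (χ' : N.domain) (hχχ : χ'.1 = χ.1) (hχb : EssBdd μ χ.1)
    (hχ0 : ∀ᵐ x ∂μ, x ∉ V → χ.1 x = 0) {W : E → ℝ} {B κ : ℝ} (hWm : Continuous W)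
    (hW1 : ∀ x, 1 ≤ W x) (hWB : ∀ x, W x ≤ B) (hκ : 0 < κ)
    (hκ1 : ∫ x, (W x)⁻¹ * Γ χ χ x ∂μ ≤ κ ^ 2)
    (hi : Integrable (fun x => (W x)⁻¹ * N χ' x ^ 2) μ)
    (hκ2 : ∫ x, (W x)⁻¹ * N χ' x ^ 2 ∂μ ≤ κ ^ 2) :
    |∫ x in V, L x * χ.1 x ∂μ| ≤ κ / 2 * (1 + ∫ x, W x * Γ v v x ∂μ) +
      κ / 2 * (1 + ∫ x in V, v.1 x ^ 2 * W x ∂μ) := by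
  have hid := hL χ hχb hχ0
  have hd := hE₀.dirichlet
  have hWb : EssBdd μ W := essBdd_of_le fun x => by
    rw [abs_of_nonneg (by linarith [hW1 x])]; exact hWB x
  have hWib : EssBdd μ (fun x => (W x)⁻¹) := essBdd_of_le (C := 1) fun x => by
    have := hW1 x
    rw [abs_of_nonneg (by positivity)]; exact inv_le_one_of_one_le₀ this
  have hWpos : ∀ x, 0 < W x := fun x => by linarith [hW1 x]
  have hWim : AEStronglyMeasurable (fun x => (W x)⁻¹) μ :=
    (hWm.inv₀ fun x => (hWpos x).ne').aestronglyMeasurable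
  obtain ⟨y, hy⟩ := L2Form.exists_mul hd hE₀.symm χ v hχb hvb
  have hyb : EssBdd μ y.1 := (hχb.mul hvb).congr hy
  have hy0 : ∀ᵐ x ∂μ, x ∉ V → y.1 x = 0 := by
    filter_upwards [hy, hv0] with x h1 h2 hx
    rw [h1, h2 hx, mul_zero]
  obtain ⟨hyi, -, hyN⟩ := hN.integrable (hN.lift y hyb) y.2 hyb hV hVc hy0
  have hv'b : EssBdd μ v'.1 := by rw [hvv]; exact hvb
  have hχ'b : EssBdd μ χ'.1 := by rw [hχχ]; exact hχb
  have p1 := hN.product χ' v' (hN.lift y hyb) hχ'b hv'b (by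
    filter_upwards [hy] with x hx
    rw [hN.coe_lift, hx, hvv, hχχ])
  have hv'i := (hN.integrable v' (by rw [hvv]; exact v.2) hv'b hV hVc (by rw [hvv]; exact hv0)).1
  have i1 : Integrable (fun x => χ.1 x * N v' x) μ :=
    hχb.integrable_mul χ.1.aestronglyMeasurable hv'i
  have hNχ : ∀ᵐ x ∂μ, v.1 x * N χ' x = N (hN.lift y hyb) x - χ.1 x * N v' x := by
    filter_upwards [p1] with x h1
    rw [h1, hvv, hχχ]; ring
  have i2 : Integrable (fun x => v.1 x * N χ' x) μ :=
    (hyi.sub i1).congr (hNχ.mono fun x hx => hx.symm)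
  have e1 : ∫ x in V, χ.1 x * N v' x ∂μ = -∫ x, v.1 x * N χ' x ∂μ := by
    rw [integral_congr_ae hNχ, integral_sub hyi i1, hyN, zero_sub, neg_neg]
    refine setIntegral_eq_integral_of_ae_compl_eq_zero ?_
    filter_upwards [hχ0] with x hx hx'
    rw [hx hx', zero_mul]
  have i3 : Integrable (fun x => W x * Γ v v x) μ :=
    hWb.integrable_mul hWm.aestronglyMeasurable (hΓ.integrable _ _)
  have i4 : Integrable (fun x => (W x)⁻¹ * Γ χ χ x) μ :=
    hWib.integrable_mul hWim (hΓ.integrable _ _)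
  have i5 : Integrable (fun x => v.1 x ^ 2 * W x) μ := by
    have := hWb.integrable_mul hWm.aestronglyMeasurable (E₀.memLp v.1 v.2).integrable_sq
    simpa only [mul_comm] using this
  have hVi : ∫ x in V, v.1 x ^ 2 * W x ∂μ = ∫ x, v.1 x ^ 2 * W x ∂μ := by
    refine setIntegral_eq_integral_of_ae_compl_eq_zero ?_
    filter_upwards [hv0] with x hx hx'
    rw [hx hx']; ring
  have elem : ∀ p q w : ℝ, 0 < w → |p * q| ≤ 1 / (2 * κ) * (w⁻¹ * p ^ 2) + κ / 2 * (w * q ^ 2) := by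
    intro p q w hw
    have h1 : 1 / (2 * κ) * (w⁻¹ * p ^ 2) + κ / 2 * (w * q ^ 2) - |p * q| =
        (|p| - κ * w * |q|) ^ 2 / (2 * κ * w) := by
      rw [abs_mul, ← sq_abs p, ← sq_abs q]; field_simp; ring
    have h2 : 0 ≤ (|p| - κ * w * |q|) ^ 2 / (2 * κ * w) := by positivity
    linarith
  have b1 : |∫ x, Γ χ v x ∂μ| ≤ κ / 2 * (1 + ∫ x, W x * Γ v v x ∂μ) := by
    have hle : ∫ x, |Γ χ v x| ∂μ ≤
        ∫ x, (1 / (2 * κ) * ((W x)⁻¹ * Γ χ χ x) + κ / 2 * (W x * Γ v v x)) ∂μ := by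
      refine integral_mono_ae (hΓ.integrable _ _).abs ((i4.const_mul _).add (i3.const_mul _)) ?_
      filter_upwards [L2Form.gamma_cauchy_schwarz hΓ χ v, hΓ.nonneg χ, hΓ.nonneg v] with x h1 h2 h3
      have h4 := elem (Real.sqrt (Γ χ χ x)) (Real.sqrt (Γ v v x)) (W x) (hWpos x)
      rw [Real.sq_sqrt h2, Real.sq_sqrt h3, abs_of_nonneg (by positivity), ← Real.sqrt_mul h2] at h4
      exact (Real.abs_le_sqrt h1).trans h4
    rw [integral_add (i4.const_mul _) (i3.const_mul _), integral_const_mul,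
      integral_const_mul] at hle
    have h5 : 1 / (2 * κ) * ∫ x, (W x)⁻¹ * Γ χ χ x ∂μ ≤ 1 / (2 * κ) * κ ^ 2 := by gcongr
    have h6 : 1 / (2 * κ) * κ ^ 2 = κ / 2 := by field_simp
    have := abs_integral_le_integral_abs (f := Γ χ v) (μ := μ)
    linarith
  have b2 : |∫ x, v.1 x * N χ' x ∂μ| ≤ κ / 2 * (1 + ∫ x in V, v.1 x ^ 2 * W x ∂μ) := by
    have hle : ∫ x, |v.1 x * N χ' x| ∂μ ≤
        ∫ x, (1 / (2 * κ) * ((W x)⁻¹ * N χ' x ^ 2) + κ / 2 * (v.1 x ^ 2 * W x)) ∂μ := by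
      refine integral_mono_ae i2.abs ((hi.const_mul _).add (i5.const_mul _)) ?_
      refine Eventually.of_forall fun x => ?_
      have := elem (N χ' x) (v.1 x) (W x) (hWpos x)
      simp only
      rw [mul_comm (v.1 x), mul_comm (v.1 x ^ 2)]
      exact this
    rw [integral_add (hi.const_mul _) (i5.const_mul _), integral_const_mul,
      integral_const_mul] at hle
    have h5 : 1 / (2 * κ) * ∫ x, (W x)⁻¹ * N χ' x ^ 2 ∂μ ≤ 1 / (2 * κ) * κ ^ 2 := by gcongr
    have h6 : 1 / (2 * κ) * κ ^ 2 = κ / 2 := by field_simp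
    have := abs_integral_le_integral_abs (f := fun x => v.1 x * N χ' x) (μ := μ)
    rw [hVi]
    linarith
  rw [e1] at hid
  have : ∫ x in V, L x * χ.1 x ∂μ = -(∫ x, Γ χ v x ∂μ) + ∫ x, v.1 x * N χ' x ∂μ := by linarith
  rw [this]
  refine (abs_add_le _ _).trans ?_
  rw [abs_neg]
  linarith

end Energy

end

noncomputable section

/-! ### Differentiation along a semigroup -/

section Monotone

/-- A mean value inequality for right derivatives. -/
lemma sub_le_mul_of_rightDeriv_le {f f' : ℝ → ℝ} {t c : ℝ} (ht : 0 < t)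
    (hf : ContinuousOn f (Icc 0 t))
    (hf' : ∀ s ∈ Ioo 0 t, HasDerivWithinAt f (f' s) (Ici s) s) (hc : ∀ s ∈ Ioo 0 t, f' s ≤ c) :
    f t - f 0 ≤ c * t := by
  have h1 : ∀ δ ∈ Ioo 0 t, f t ≤ f δ + c * (t - δ) := by
    intro δ hδ
    have := image_le_of_deriv_right_le_deriv_boundary (f := f) (f' := f') (a := δ) (b := t)
      (hf.mono (Icc_subset_Icc_left hδ.1.le)) (fun x hx => hf' x ⟨hδ.1.trans_le hx.1, hx.2⟩)
      (B := fun x => f δ + c * (x - δ)) (B' := fun _ => c) (by simp) (by fun_prop)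
      (fun x _ => (((hasDerivAt_id' x).sub_const δ).const_mul c |>.const_add (f δ)
        |>.congr_deriv (by ring)).hasDerivWithinAt)
      (fun x hx => hc x ⟨hδ.1.trans_le hx.1, hx.2⟩)
    exact this ⟨hδ.2.le, le_rfl⟩
  have h2 : Tendsto (fun δ => f δ + c * (t - δ)) (𝓝[>] 0) (𝓝 (f 0 + c * (t - 0))) := by
    refine Tendsto.add ?_ ?_
    · have := (hf 0 ⟨le_rfl, ht.le⟩).mono_left (nhdsWithin_mono 0 (Ioc_subset_Icc_self (b := t)))
      rwa [nhdsWithin_Ioc_eq_nhdsGT ht] at this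
    · exact ((continuous_const.sub continuous_id).const_mul c).continuousAt.tendsto.mono_left
        nhdsWithin_le_nhds
  have h3 := ge_of_tendsto h2 (b := f t) (by
    filter_upwards [Ioo_mem_nhdsGT ht] with δ hδ using h1 δ hδ)
  rw [sub_zero] at h3
  linarith

lemma abs_sub_le_of_weighted {G H G' H' F : ℝ → ℝ} {t a κ l : ℝ} (ht : 0 < t) (ha : 0 < a)
    (hκ : 0 < κ) (hl : 0 ≤ l) (hG : ContinuousOn G (Icc 0 t)) (hH : ContinuousOn H (Icc 0 t))
    (hGd : ∀ s ∈ Ioo 0 t, HasDerivWithinAt G (G' s) (Ici s) s)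
    (hHd : ∀ s ∈ Ioo 0 t, HasDerivWithinAt H (H' s) (Ici s) s)
    (hF : ∀ s, 0 ≤ F s) (hGnn : ∀ s, 0 ≤ G s)
    (hG' : ∀ s ∈ Ioo 0 t, G' s ≤ -2 * a * F s + l * G s)
    (hH' : ∀ s ∈ Ioo 0 t, |H' s| ≤ κ / 2 * (1 + F s) + κ / 2 * (1 + G s)) :
    |H t - H 0| ≤ κ * (1 + Real.exp (l * t) * G 0) * t +
      κ * Real.exp (l * t) / (4 * a) * G 0 := by
  set P : ℝ → ℝ := fun s => Real.exp (-(l * s)) * G s with hP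
  have hPc : ContinuousOn P (Icc 0 t) := (by fun_prop : Continuous fun s => Real.exp (-(l * s))).continuousOn.mul hG
  have hPd : ∀ s ∈ Ioo 0 t, HasDerivWithinAt P
      (Real.exp (-(l * s)) * (-l) * G s + Real.exp (-(l * s)) * G' s) (Ici s) s := by
    intro s hs
    have h1 : HasDerivAt (fun s => Real.exp (-(l * s))) (Real.exp (-(l * s)) * (-l)) s := by
      have := ((hasDerivAt_id' s).const_mul l).neg.exp
      simpa using this
    exact h1.hasDerivWithinAt.mul (hGd s hs)
  have hP' : ∀ s ∈ Ioo 0 t, Real.exp (-(l * s)) * (-l) * G s + Real.exp (-(l * s)) * G' s ≤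
      -2 * a * (Real.exp (-(l * t)) * F s) := by
    intro s hs
    have h1 := mul_le_mul_of_nonneg_left (hG' s hs) (Real.exp_pos (-(l * s))).le
    have h2 : Real.exp (-(l * t)) ≤ Real.exp (-(l * s)) := by
      apply Real.exp_le_exp.2
      nlinarith [hs.2]
    have h3 := mul_le_mul_of_nonneg_right h2 (mul_nonneg (mul_nonneg (by norm_num : (0:ℝ) ≤ 2) ha.le) (hF s))
    nlinarith
  have hP0 : P 0 = G 0 := by simp [hP]
  have hG0 := hGnn 0
  have hGle : ∀ s ∈ Ioo 0 t, G s ≤ Real.exp (l * t) * G 0 := by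
    intro s hs
    have h1 := sub_le_mul_of_rightDeriv_le (f := P) (c := 0) hs.1
      (hPc.mono (Icc_subset_Icc_right hs.2.le))
      (fun r hr => hPd r ⟨hr.1, hr.2.trans hs.2⟩) (fun r hr => by
        refine (hP' r ⟨hr.1, hr.2.trans hs.2⟩).trans ?_
        have : 0 ≤ a * (Real.exp (-(l * t)) * F r) :=
          mul_nonneg ha.le (mul_nonneg (Real.exp_pos _).le (hF r))
        linarith)
    rw [hP0, zero_mul] at h1
    have h2 : G s = Real.exp (l * s) * P s := by
      rw [hP]; simp only; rw [← mul_assoc, ← Real.exp_add]; simp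
    have h3 : Real.exp (l * s) ≤ Real.exp (l * t) := Real.exp_le_exp.2 (by nlinarith [hs.2])
    calc G s = Real.exp (l * s) * P s := h2
      _ ≤ Real.exp (l * s) * G 0 := by gcongr; linarith
      _ ≤ _ := by gcongr
  set m := κ * Real.exp (l * t) / (4 * a) with hm
  have hm0 : 0 < m := by positivity
  have hPt : 0 ≤ P t := mul_nonneg (Real.exp_pos _).le (hGnn t)
  have key : ∀ σ : ℝ, |σ| = 1 → σ * (H t - H 0) + m * (P t - P 0) ≤
      κ * (1 + Real.exp (l * t) * G 0) * t := by
    intro σ hσ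
    have := sub_le_mul_of_rightDeriv_le (f := fun s => σ * H s + m * P s)
      (c := κ * (1 + Real.exp (l * t) * G 0)) ht
      ((continuousOn_const.mul hH).add (continuousOn_const.mul hPc))
      (fun s hs => ((hHd s hs).const_mul σ).add ((hPd s hs).const_mul m)) (fun s hs => by
        have h1 : σ * H' s ≤ κ / 2 * (1 + F s) + κ / 2 * (1 + G s) := by
          refine (le_abs_self _).trans ?_
          rw [abs_mul, hσ, one_mul]
          exact hH' s hs
        have h2 := mul_le_mul_of_nonneg_left (hP' s hs) hm0.le
        have h3 : m * (-2 * a * (Real.exp (-(l * t)) * F s)) = -(κ / 2) * F s := by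
          rw [hm, Real.exp_neg]; field_simp; ring
        rw [h3] at h2
        have h4 := mul_le_mul_of_nonneg_left (hGle s hs) hκ.le
        have h5 : 0 ≤ Real.exp (l * t) * G 0 := by positivity
        have h6 := mul_nonneg hκ.le h5
        linarith)
    linarith
  have hb : m * (P 0 - P t) ≤ m * G 0 := by rw [hP0]; nlinarith
  have k1 := key 1 (by simp)
  have k2 := key (-1) (by simp)
  rw [abs_le]
  constructor <;> linarith

end Monotone

section Semigroup

namespace C0ContractionSemigroup

variable {X : Type*} [NormedAddCommGroup X] [NormedSpace ℝ X] (T : C0ContractionSemigroup X)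

lemma norm_op_le (x : X) {s : ℝ} (hs : 0 ≤ s) : ‖T.op s x‖ ≤ ‖x‖ := by
  have := (T.op s).le_of_opNorm_le (T.norm_le_one s hs) x
  rwa [one_mul] at this

lemma norm_op_sub_op_le (x : X) {r s : ℝ} (hr : 0 ≤ r) (hrs : r ≤ s) :
    ‖T.op s x - T.op r x‖ ≤ ‖T.op (s - r) x - x‖ := by
  have h1 : T.op s x = T.op r (T.op (s - r) x) := by
    have := T.op_add r (s - r) hr (by linarith)
    rw [add_sub_cancel] at this
    rw [this]; rfl
  rw [h1, ← map_sub]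
  exact T.norm_op_le _ hr

lemma continuousOn_op (x : X) : ContinuousOn (fun s => T.op s x) (Ici 0) := by
  have h0 := Metric.tendsto_nhds.1 (T.tendsto_zero x)
  rw [Metric.continuousOn_iff]
  intro s hs ε hε
  have h1 := h0 ε hε
  rw [eventually_nhdsWithin_iff, Metric.eventually_nhds_iff] at h1
  obtain ⟨δ, hδ, h2⟩ := h1
  have h3 : ∀ h : ℝ, 0 ≤ h → h < δ → ‖T.op h x - x‖ < ε := by
    intro h hh hhδ
    rcases hh.eq_or_lt with rfl | hh
    · rw [T.op_zero]; simpa using hε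
    · rw [← dist_eq_norm]
      exact h2 (by rwa [Real.dist_eq, sub_zero, abs_of_pos hh]) hh
  refine ⟨δ, hδ, fun r hr hrs => ?_⟩
  rw [Real.dist_eq] at hrs
  rw [dist_eq_norm]
  rcases le_total r s with h | h
  · rw [norm_sub_rev]
    rw [abs_sub_comm, abs_of_nonneg (by linarith)] at hrs
    exact (T.norm_op_sub_op_le x hr h).trans_lt (h3 _ (by linarith) hrs)
  · rw [abs_of_nonneg (by linarith)] at hrs
    exact (T.norm_op_sub_op_le x hs h).trans_lt (h3 _ (by linarith) hrs)

lemma tendsto_slope_op {x y : X} {s : ℝ} (hs : 0 ≤ s) (h : T.HasGenerator (T.op s x) y) :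
    Tendsto (fun r => (r - s)⁻¹ • (T.op r x - T.op s x)) (𝓝[>] s) (𝓝 y) := by
  have h1 : Tendsto (fun r => r - s) (𝓝[>] s) (𝓝[>] 0) := by
    refine tendsto_nhdsWithin_iff.2 ⟨?_, ?_⟩
    · have : Tendsto (fun r => r - s) (𝓝 s) (𝓝 (s - s)) := by
        exact (continuous_id.sub continuous_const).continuousAt.tendsto
      rw [sub_self] at this
      exact this.mono_left nhdsWithin_le_nhds
    · filter_upwards [self_mem_nhdsWithin] with r hr
      exact sub_pos.2 (mem_Ioi.1 hr)
  refine (h.comp h1).congr' ?_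
  filter_upwards [self_mem_nhdsWithin] with r hr
  have hr' : s < r := hr
  have h2 : T.op r x = T.op (r - s) (T.op s x) := by
    have := T.op_add (r - s) s (by linarith) hs
    rw [sub_add_cancel] at this
    rw [this]; rfl
  simp only [Function.comp_apply]
  rw [h2]

end C0ContractionSemigroup

variable {E : Type*} [MeasurableSpace E] {ν : Measure E} {p : ℝ≥0∞} [Fact (1 ≤ p)]

lemma IsSubMarkovian.mem_Icc {T : C0ContractionSemigroup (Lp ℝ p ν)} (hT : IsSubMarkovian T)
    {s : ℝ} (hs : 0 < s) (f : Lp ℝ p ν) {B : ℝ} (hB : 0 < B)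
    (hf : ∀ᵐ x ∂ν, 0 ≤ f x ∧ f x ≤ B) : ∀ᵐ x ∂ν, 0 ≤ T.op s f x ∧ T.op s f x ≤ B := by
  have h1 := hT s hs (B⁻¹ • f) (by
    filter_upwards [hf, Lp.coeFn_smul B⁻¹ f] with x h1 h2
    rw [h2, Pi.smul_apply, smul_eq_mul]
    refine ⟨mul_nonneg (by positivity) h1.1, ?_⟩
    rw [inv_mul_le_iff₀ hB]; linarith [h1.2])
  rw [map_smul] at h1
  filter_upwards [h1, Lp.coeFn_smul B⁻¹ (T.op s f)] with x h2 h3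
  rw [h3, Pi.smul_apply, smul_eq_mul, inv_mul_le_iff₀ hB, mul_one] at h2
  refine ⟨?_, h2.2⟩
  have := mul_nonneg hB.le h2.1
  rwa [mul_inv_cancel_left₀ hB.ne'] at this

lemma Lp.posPart_sub_posPart_neg {p : ℝ≥0∞} (f : Lp ℝ p ν) : Lp.posPart f - Lp.posPart (-f) = f := by
  refine Lp.ext ?_
  filter_upwards [Lp.coeFn_sub (Lp.posPart f) (Lp.posPart (-f)), Lp.coeFn_posPart f,
    Lp.coeFn_posPart (-f), Lp.coeFn_neg f] with x h1 h2 h3 h4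
  rw [h1, Pi.sub_apply, h2, h3, h4, Pi.neg_apply]
  rcases le_total 0 (f x) with h | h
  · rw [max_eq_left h, max_eq_right (by linarith)]; ring
  · rw [max_eq_right h, max_eq_left (by linarith)]; ring

lemma IsSubMarkovian.abs_le {T : C0ContractionSemigroup (Lp ℝ p ν)} (hT : IsSubMarkovian T)
    {s : ℝ} (hs : 0 ≤ s) (f : Lp ℝ p ν) {B : ℝ} (hB : 0 < B)
    (hf : ∀ᵐ x ∂ν, |f x| ≤ B) : ∀ᵐ x ∂ν, |T.op s f x| ≤ B := by
  rcases hs.eq_or_lt with rfl | hs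
  · rw [T.op_zero]; exact hf
  have h1 := hT.mem_Icc hs (Lp.posPart f) hB (by
    filter_upwards [hf, Lp.coeFn_posPart f] with x h1 h2
    rw [h2]
    exact ⟨le_max_right _ _, max_le ((le_abs_self _).trans h1) hB.le⟩)
  have h2 := hT.mem_Icc hs (Lp.posPart (-f)) hB (by
    filter_upwards [hf, Lp.coeFn_posPart (-f), Lp.coeFn_neg f] with x h1 h2 h3
    rw [h2, h3]
    exact ⟨le_max_right _ _, max_le ((neg_le_abs _).trans h1) hB.le⟩)
  have h3 : T.op s f = T.op s (Lp.posPart f) - T.op s (Lp.posPart (-f)) := by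
    rw [← map_sub, Lp.posPart_sub_posPart_neg]
  rw [h3]
  filter_upwards [h1, h2, Lp.coeFn_sub (T.op s (Lp.posPart f)) (T.op s (Lp.posPart (-f)))]
    with x h1 h2 h3
  rw [h3, Pi.sub_apply, _root_.abs_le]
  constructor <;> linarith [h1.1, h1.2, h2.1, h2.2]

lemma Lp.integrable_of_finite [IsFiniteMeasure ν] (f : Lp ℝ p ν) : Integrable f ν :=
  (Lp.memLp f).integrable Fact.out

lemma Lp.exists_integral_abs_le [IsFiniteMeasure ν] :
    ∃ C : ℝ, 0 ≤ C ∧ ∀ f : Lp ℝ p ν, ∫ x, |f x| ∂ν ≤ C * ‖f‖ := by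
  have hp : (1 : ℝ≥0∞) ≤ p := Fact.out
  refine ⟨(ν univ ^ (1 / (1 : ℝ≥0∞).toReal - 1 / p.toReal)).toReal, ENNReal.toReal_nonneg,
    fun f => ?_⟩
  have h1 := eLpNorm_le_eLpNorm_mul_rpow_measure_univ hp (Lp.aestronglyMeasurable f)
  have hfin : ν univ ^ (1 / (1 : ℝ≥0∞).toReal - 1 / p.toReal) ≠ ⊤ := by
    refine ENNReal.rpow_ne_top_of_nonneg ?_ (measure_ne_top _ _)
    simp only [ENNReal.toReal_one, div_one, sub_nonneg]
    by_cases hpt : p = ⊤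
    · simp [hpt]
    · rw [div_le_one (ENNReal.toReal_pos (by positivity) hpt)]
      have := ENNReal.toReal_mono hpt hp
      simpa using this
  have h2 : ∫ x, |f x| ∂ν = (eLpNorm f 1 ν).toReal := by
    rw [eLpNorm_one_eq_lintegral_enorm]
    exact integral_norm_eq_lintegral_enorm (Lp.aestronglyMeasurable f)
  rw [h2, Lp.norm_def, mul_comm, ← ENNReal.toReal_mul]
  exact ENNReal.toReal_mono (ENNReal.mul_ne_top (Lp.eLpNorm_ne_top f) hfin) h1

lemma Lp.tendsto_integral_mul [IsFiniteMeasure ν] {ι : Type*} {l : Filter ι}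
    [l.IsCountablyGenerated] {z : ι → Lp ℝ p ν} {z0 : Lp ℝ p ν} (hz : Tendsto z l (𝓝 z0))
    {B : ℝ} (hB : ∀ᶠ i in l, ∀ᵐ x ∂ν, |z i x| ≤ B) {g : E → ℝ} (hg : Integrable g ν) :
    Tendsto (fun i => ∫ x, g x * z i x ∂ν) l (𝓝 (∫ x, g x * z0 x ∂ν)) := by
  refine tendsto_of_subseq_tendsto fun ns hns => ?_
  have h1 : Tendsto (fun k => z (ns k)) atTop (𝓝 z0) := hz.comp hns
  obtain ⟨k0, hk0⟩ := eventually_atTop.1 (hns.eventually hB)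
  have h1' : Tendsto (fun k => z (ns (k + k0))) atTop (𝓝 z0) := (tendsto_add_atTop_iff_nat k0).2 h1
  obtain ⟨ms, hms, hlim⟩ := (tendstoInMeasure_of_tendsto_Lp h1').exists_seq_tendsto_ae
  refine ⟨fun k => ms k + k0, ?_⟩
  refine tendsto_integral_of_dominated_convergence (fun x => |g x| * B)
    (fun k => hg.aestronglyMeasurable.mul (Lp.aestronglyMeasurable _)) (hg.abs.mul_const B) ?_ ?_
  · intro k
    filter_upwards [hk0 (ms k + k0) (Nat.le_add_left _ _)] with x hx
    rw [Real.norm_eq_abs, abs_mul]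
    gcongr
  · filter_upwards [hlim] with x hx
    exact hx.const_mul (g x)

variable {T : C0ContractionSemigroup (Lp ℝ p ν)}

lemma Lp.integrable_mul_of_bdd [IsFiniteMeasure ν] (g : Lp ℝ p ν) {χ : E → ℝ} {B : ℝ}
    (hχ : AEStronglyMeasurable χ ν) (hχB : ∀ᵐ x ∂ν, |χ x| ≤ B) :
    Integrable (fun x => g x * χ x) ν :=
  (Lp.integrable_of_finite g).mul_bdd hχ hχB

lemma Lp.exists_abs_integral_mul_le [IsFiniteMeasure ν] :
    ∃ C : ℝ, 0 ≤ C ∧ ∀ (g : Lp ℝ p ν) (χ : E → ℝ) (B : ℝ), AEStronglyMeasurable χ ν →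
      (∀ᵐ x ∂ν, |χ x| ≤ B) → |∫ x, g x * χ x ∂ν| ≤ C * |B| * ‖g‖ := by
  obtain ⟨C, hC, hCb⟩ := Lp.exists_integral_abs_le (ν := ν) (p := p)
  refine ⟨C, hC, fun g χ B hχ hχB => abs_integral_le_integral_abs.trans ?_⟩
  calc ∫ x, |g x * χ x| ∂ν ≤ ∫ x, |g x| * |B| ∂ν := by
        refine integral_mono_ae (Lp.integrable_mul_of_bdd g hχ hχB).abs
          ((Lp.integrable_of_finite _).abs.mul_const _) ?_
        filter_upwards [hχB] with x h1
        rw [abs_mul]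
        exact mul_le_mul_of_nonneg_left (h1.trans (le_abs_self B)) (abs_nonneg _)
    _ ≤ _ := by
        rw [integral_mul_const]
        have := mul_le_mul_of_nonneg_right (hCb g) (abs_nonneg B)
        linarith

lemma Lp.integral_sub_mul [IsFiniteMeasure ν] (g h : Lp ℝ p ν) {χ : E → ℝ} {B : ℝ}
    (hχ : AEStronglyMeasurable χ ν) (hχB : ∀ᵐ x ∂ν, |χ x| ≤ B) :
    ∫ x, (g - h : Lp ℝ p ν) x * χ x ∂ν = ∫ x, g x * χ x ∂ν - ∫ x, h x * χ x ∂ν := by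
  rw [← integral_sub (Lp.integrable_mul_of_bdd g hχ hχB) (Lp.integrable_mul_of_bdd h hχ hχB)]
  refine integral_congr_ae ?_
  filter_upwards [Lp.coeFn_sub g h] with x hx
  rw [hx, Pi.sub_apply, sub_mul]

lemma Lp.continuous_integral_mul [IsFiniteMeasure ν] {χ : E → ℝ} {B : ℝ}
    (hχ : AEStronglyMeasurable χ ν) (hχB : ∀ᵐ x ∂ν, |χ x| ≤ B) :
    Continuous (fun g : Lp ℝ p ν => ∫ x, g x * χ x ∂ν) := by
  obtain ⟨C, hC, hCb⟩ := Lp.exists_abs_integral_mul_le (ν := ν) (p := p)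
  refine LipschitzWith.continuous (K := (C * |B|).toNNReal)
    (LipschitzWith.of_dist_le_mul fun g h => ?_)
  rw [Real.dist_eq, dist_eq_norm, Real.coe_toNNReal _ (by positivity),
    ← Lp.integral_sub_mul g h hχ hχB]
  exact hCb _ _ _ hχ hχB

lemma continuousOn_integral_op [IsFiniteMeasure ν] (f : Lp ℝ p ν) {χ : E → ℝ} {B : ℝ}
    (hχ : AEStronglyMeasurable χ ν) (hχB : ∀ᵐ x ∂ν, |χ x| ≤ B) :
    ContinuousOn (fun s => ∫ x, T.op s f x * χ x ∂ν) (Ici 0) :=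
  (Lp.continuous_integral_mul hχ hχB).comp_continuousOn (T.continuousOn_op f)

lemma continuousOn_integral_op_sq [IsFiniteMeasure ν] (hT : IsSubMarkovian T) (f : Lp ℝ p ν)
    {B : ℝ} (hB : 0 < B) (hf : ∀ᵐ x ∂ν, |f x| ≤ B) {w : E → ℝ} {D : ℝ}
    (hw : AEStronglyMeasurable w ν) (hwD : ∀ᵐ x ∂ν, |w x| ≤ D) :
    ContinuousOn (fun s => ∫ x, T.op s f x ^ 2 * w x ∂ν) (Ici 0) := by
  intro s hs
  have hb : ∀ r ∈ Ici (0 : ℝ), ∀ᵐ x ∂ν, |T.op r f x| ≤ B := fun r hr => hT.abs_le hr f hB hf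
  have hc := T.continuousOn_op f s hs
  have hd : IsBoundedUnder (· ≤ ·) (𝓝[Ici 0] s) (fun _ : ℝ => D) := isBoundedUnder_const
  refine tendsto_of_subseq_tendsto fun ns hns => ?_
  have h1 : Tendsto (fun k => T.op (ns k) f) atTop (𝓝 (T.op s f)) := Tendsto.comp hc hns
  have hmem : ∀ᶠ k in atTop, ns k ∈ Ici (0 : ℝ) := hns.eventually self_mem_nhdsWithin
  obtain ⟨k0, hk0⟩ := eventually_atTop.1 hmem
  have h1' : Tendsto (fun k => T.op (ns (k + k0)) f) atTop (𝓝 (T.op s f)) :=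
    (tendsto_add_atTop_iff_nat k0).2 h1
  obtain ⟨ms, hms, hlim⟩ := (tendstoInMeasure_of_tendsto_Lp h1').exists_seq_tendsto_ae
  refine ⟨fun k => ms k + k0, ?_⟩
  refine tendsto_integral_of_dominated_convergence (fun _ => B ^ 2 * D)
    (fun k => ((Lp.aestronglyMeasurable _).pow 2).mul hw) (integrable_const _) ?_ ?_
  · intro k
    filter_upwards [hb _ (hk0 (ms k + k0) (Nat.le_add_left _ _)), hwD] with x h1 h2
    rw [Real.norm_eq_abs, abs_mul, abs_pow]
    gcongr
  · filter_upwards [hlim] with x hx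
    exact (hx.pow 2).mul_const (w x)

lemma hasDerivWithinAt_integral_op [IsFiniteMeasure ν] (f : Lp ℝ p ν) {χ : E → ℝ} {B : ℝ}
    (hχ : AEStronglyMeasurable χ ν) (hχB : ∀ᵐ x ∂ν, |χ x| ≤ B) {s : ℝ} (hs : 0 ≤ s)
    {L : Lp ℝ p ν} (hL : T.HasGenerator (T.op s f) L) :
    HasDerivWithinAt (fun s => ∫ x, T.op s f x * χ x ∂ν) (∫ x, L x * χ x ∂ν) (Ici s) s := by
  rw [← hasDerivWithinAt_Ioi_iff_Ici, hasDerivWithinAt_iff_tendsto_slope' self_notMem_Ioi]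
  refine (((Lp.continuous_integral_mul hχ hχB).tendsto L).comp (T.tendsto_slope_op hs hL)).congr
    fun r => ?_
  rw [slope_def_module, ← Lp.integral_sub_mul _ _ hχ hχB, smul_eq_mul, ← integral_const_mul]
  refine integral_congr_ae ?_
  filter_upwards [Lp.coeFn_smul (r - s)⁻¹ (T.op r f - T.op s f)] with x hx
  rw [hx, Pi.smul_apply, smul_eq_mul, mul_assoc]

lemma hasDerivWithinAt_integral_op_sq [IsFiniteMeasure ν] (hT : IsSubMarkovian T) (f : Lp ℝ p ν)
    {B : ℝ} (hB : 0 < B) (hf : ∀ᵐ x ∂ν, |f x| ≤ B) {w : E → ℝ} {D : ℝ}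
    (hw : AEStronglyMeasurable w ν) (hwD : ∀ᵐ x ∂ν, |w x| ≤ D) {s : ℝ} (hs : 0 ≤ s)
    {L : Lp ℝ p ν} (hL : T.HasGenerator (T.op s f) L) :
    HasDerivWithinAt (fun s => ∫ x, T.op s f x ^ 2 * w x ∂ν)
      (2 * ∫ x, L x * T.op s f x * w x ∂ν) (Ici s) s := by
  obtain ⟨C, hC, hCb⟩ := Lp.exists_abs_integral_mul_le (ν := ν) (p := p)
  have hb : ∀ r, 0 ≤ r → ∀ᵐ x ∂ν, |T.op r f x| ≤ B := fun r hr => hT.abs_le hr f hB hf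
  have hbw : ∀ r, 0 ≤ r → ∀ᵐ x ∂ν, |T.op r f x * w x| ≤ B * D := fun r hr => by
    filter_upwards [hb r hr, hwD] with x h1 h2
    rw [abs_mul]; gcongr
  have hm : ∀ r, AEStronglyMeasurable (fun x => T.op r f x * w x) ν := fun r =>
    (Lp.aestronglyMeasurable _).mul hw
  rw [← hasDerivWithinAt_Ioi_iff_Ici, hasDerivWithinAt_iff_tendsto_slope' self_notMem_Ioi]
  set q : ℝ → Lp ℝ p ν := fun r => (r - s)⁻¹ • (T.op r f - T.op s f) with hq
  have hqL : Tendsto q (𝓝[>] s) (𝓝 L) := T.tendsto_slope_op hs hL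
  have h1 : Tendsto (fun r => ∫ x, q r x * (T.op s f x * w x) ∂ν) (𝓝[>] s)
      (𝓝 (∫ x, L x * (T.op s f x * w x) ∂ν)) :=
    ((Lp.continuous_integral_mul (hm s) (hbw s hs)).tendsto L).comp hqL
  have h2 : Tendsto (fun r => ∫ x, (L x * w x) * T.op r f x ∂ν) (𝓝[>] s)
      (𝓝 (∫ x, (L x * w x) * T.op s f x ∂ν)) := by
    refine Lp.tendsto_integral_mul (B := B) ?_ ?_ (Lp.integrable_mul_of_bdd L hw hwD)
    · exact (T.continuousOn_op f s hs).mono_left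
        (nhdsWithin_mono s fun r hr => hs.trans (mem_Ioi.1 hr).le)
    · filter_upwards [self_mem_nhdsWithin] with r hr
      exact hb r (hs.trans (mem_Ioi.1 hr).le)
  have h3 : Tendsto (fun r => ∫ x, (q r - L : Lp ℝ p ν) x * (T.op r f x * w x) ∂ν) (𝓝[>] s)
      (𝓝 0) := by
    refine squeeze_zero_norm' (a := fun r => C * |B * D| * ‖q r - L‖) ?_ ?_
    · filter_upwards [self_mem_nhdsWithin] with r hr
      exact hCb _ _ _ (hm r) (hbw r (hs.trans (mem_Ioi.1 hr).le))
    · have := (tendsto_iff_norm_sub_tendsto_zero.1 hqL).const_mul (C * |B * D|)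
      rwa [mul_zero] at this
  have h4 := (h1.add h2).add h3
  have e4 : ∫ x, L x * (T.op s f x * w x) ∂ν + ∫ x, (L x * w x) * T.op s f x ∂ν + 0 =
      2 * ∫ x, L x * T.op s f x * w x ∂ν := by
    have a1 : ∫ x, L x * (T.op s f x * w x) ∂ν = ∫ x, L x * T.op s f x * w x ∂ν :=
      integral_congr_ae (Eventually.of_forall fun x => by simp only; ring)
    have a2 : ∫ x, (L x * w x) * T.op s f x ∂ν = ∫ x, L x * T.op s f x * w x ∂ν :=
      integral_congr_ae (Eventually.of_forall fun x => by simp only; ring)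
    rw [a1, a2]; ring
  rw [e4] at h4
  refine h4.congr' ?_
  filter_upwards [self_mem_nhdsWithin] with r hr
  have hr0 : 0 ≤ r := hs.trans (mem_Ioi.1 hr).le
  have hi : ∀ (g : Lp ℝ p ν) (a : ℝ), 0 ≤ a → Integrable (fun x => g x * (T.op a f x * w x)) ν :=
    fun g a ha => Lp.integrable_mul_of_bdd g (hm a) (hbw a ha)
  have e5 : ∫ x, (L x * w x) * T.op r f x ∂ν = ∫ x, L x * (T.op r f x * w x) ∂ν :=
    integral_congr_ae (Eventually.of_forall fun x => by simp only; ring)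
  rw [e5, Lp.integral_sub_mul _ _ (hm r) (hbw r hr0), slope_def_module, smul_eq_mul]
  have e6 : ∫ x, q r x * (T.op s f x * w x) ∂ν + ∫ x, q r x * (T.op r f x * w x) ∂ν =
      (r - s)⁻¹ * (∫ x, T.op r f x ^ 2 * w x ∂ν - ∫ x, T.op s f x ^ 2 * w x ∂ν) := by
    have hi2 : ∀ a : ℝ, 0 ≤ a → Integrable (fun x => T.op a f x ^ 2 * w x) ν := fun a ha =>
      (hi (T.op a f) a ha).congr (Eventually.of_forall fun x => by simp only; ring)
    rw [← integral_add (hi _ _ hs) (hi _ _ hr0), ← integral_sub (hi2 r hr0) (hi2 s hs),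
      ← integral_const_mul]
    refine integral_congr_ae ?_
    filter_upwards [Lp.coeFn_smul (r - s)⁻¹ (T.op r f - T.op s f),
      Lp.coeFn_sub (T.op r f) (T.op s f)] with x h1 h2
    simp only [hq]
    rw [h1, Pi.smul_apply, h2, Pi.sub_apply, smul_eq_mul]; ring
  linarith

end Semigroup

end

noncomputable section

/-! ### Weights and cut-off functions of one real variable -/

/-- A primitive of `φ'` smoothly switched on at `R` and switched off at `b`. -/
lemma exists_truncated_primitive {φ φ' : ℝ → ℝ} {R b : ℝ}
    (hφ : ∀ r, R ≤ r → HasDerivAt φ (φ' r) r) (hc : ContinuousOn φ' (Ici R))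
    (h0 : ∀ r, R ≤ r → 0 ≤ φ' r) :
    ∃ η ψ : ℝ → ℝ, (∀ r, HasDerivAt ψ (η r * φ' (max R r)) r) ∧
      Continuous (fun r => η r * φ' (max R r)) ∧ (∀ r, 0 ≤ η r ∧ η r ≤ 1) ∧
      (∀ r, r ≤ R → η r = 0) ∧ (∀ r, b + 1 ≤ r → η r = 0) ∧ (∀ r, r ≤ R → ψ r = 0) ∧
      (∀ r, b + 1 ≤ r → ψ r = ψ (b + 1)) ∧ Monotone ψ ∧ (∀ r, R ≤ r → ψ r ≤ φ r - φ R) ∧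
      ∀ r, R + 1 ≤ r → r ≤ b → φ r - φ (R + 1) ≤ ψ r := by
  set η : ℝ → ℝ := fun r => max 0 (min 1 (r - R)) * max 0 (min 1 (b + 1 - r)) with hη
  have hcm : Continuous (fun r => φ' (max R r)) :=
    hc.comp_continuous (continuous_const.max continuous_id) fun r => mem_Ici.2 (le_max_left _ _)
  have hηc : Continuous η := by fun_prop
  have hd : Continuous (fun r => η r * φ' (max R r)) := hηc.mul hcm
  have hη01 : ∀ r, 0 ≤ η r ∧ η r ≤ 1 := fun r => by
    have h1 : max 0 (min 1 (r - R)) ≤ 1 := max_le zero_le_one (min_le_left _ _)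
    have h2 : max 0 (min 1 (b + 1 - r)) ≤ 1 := max_le zero_le_one (min_le_left _ _)
    exact ⟨mul_nonneg (le_max_left _ _) (le_max_left _ _),
      mul_le_one₀ h1 (le_max_left _ _) h2⟩
  have hηR : ∀ r, r ≤ R → η r = 0 := fun r hr => by
    rw [hη]
    simp only
    rw [max_eq_left ((min_le_right _ _).trans (by linarith : r - R ≤ 0)), zero_mul]
  have hηb : ∀ r, b + 1 ≤ r → η r = 0 := fun r hr => by
    rw [hη]
    simp only
    rw [max_eq_left ((min_le_right _ _).trans (by linarith : b + 1 - r ≤ 0)), mul_zero]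
  have hη1 : ∀ r, R + 1 ≤ r → r ≤ b → η r = 1 := fun r h1 h2 => by
    rw [hη]
    simp only
    rw [min_eq_left (by linarith), min_eq_left (by linarith)]
    norm_num
  have hd0 : ∀ r, 0 ≤ η r * φ' (max R r) := fun r =>
    mul_nonneg (hη01 r).1 (h0 _ (le_max_left _ _))
  have hI : ∀ x y, IntervalIntegrable (fun r => η r * φ' (max R r)) volume x y := fun x y =>
    hd.intervalIntegrable x y
  have hIφ : ∀ x y, IntervalIntegrable (fun r => φ' (max R r)) volume x y := fun x y =>
    hcm.intervalIntegrable x y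
  have hφi : ∀ x y, R ≤ x → x ≤ y → ∫ r in x..y, φ' (max R r) = φ y - φ x := by
    intro x y hx hxy
    refine intervalIntegral.integral_eq_sub_of_hasDerivAt (fun r hr => ?_) (hIφ x y)
    rw [uIcc_of_le hxy] at hr
    rw [max_eq_right (hx.trans hr.1)]
    exact hφ r (hx.trans hr.1)
  have hadd : ∀ x y, (∫ r in R..x, η r * φ' (max R r)) + ∫ r in x..y, η r * φ' (max R r) =
      ∫ r in R..y, η r * φ' (max R r) := fun x y =>
    intervalIntegral.integral_add_adjacent_intervals (hI _ _) (hI _ _)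
  have hmono : Monotone fun y => ∫ r in R..y, η r * φ' (max R r) := fun x y hxy => by
    have h1 := hadd x y
    have h2 : 0 ≤ ∫ r in x..y, η r * φ' (max R r) :=
      intervalIntegral.integral_nonneg hxy fun r _ => hd0 r
    show (∫ r in R..x, η r * φ' (max R r)) ≤ ∫ r in R..y, η r * φ' (max R r)
    linarith
  refine ⟨η, fun y => ∫ r in R..y, η r * φ' (max R r), fun r => ?_, hd, hη01, hηR, hηb, ?_, ?_,
    hmono, ?_, ?_⟩
  · exact intervalIntegral.integral_hasDerivAt_right (hI _ _)
      (hd.stronglyMeasurableAtFilter _ _) hd.continuousAt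
  · intro r hr
    show ∫ s in R..r, η s * φ' (max R s) = 0
    rw [intervalIntegral.integral_congr (g := fun _ => (0 : ℝ))]
    · simp
    · intro s hs
      rw [uIcc_of_ge hr] at hs
      show η s * φ' (max R s) = 0
      rw [hηR s hs.2, zero_mul]
  · intro r hr
    have h1 := hadd (b + 1) r
    have h2 : ∫ s in (b + 1)..r, η s * φ' (max R s) = 0 := by
      rw [intervalIntegral.integral_congr (g := fun _ => (0 : ℝ))]
      · simp
      · intro s hs
        rw [uIcc_of_le hr] at hs
        show η s * φ' (max R s) = 0
        rw [hηb s hs.1, zero_mul]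
    show ∫ s in R..r, η s * φ' (max R s) = _
    linarith
  · intro r hr
    rw [← hφi R r le_rfl hr]
    refine intervalIntegral.integral_mono_on hr (hI _ _) (hIφ _ _) fun s _ => ?_
    exact mul_le_of_le_one_left (h0 _ (le_max_left _ _)) (hη01 s).2
  · intro r hr hrb
    rw [← hφi (R + 1) r (by linarith) hr]
    have h1 := hadd (R + 1) r
    have h2 : (∫ s in R..R, η s * φ' (max R s)) ≤ ∫ s in R..(R + 1), η s * φ' (max R s) :=
      hmono (by linarith)
    rw [intervalIntegral.integral_same] at h2
    have h3 : ∫ s in (R + 1)..r, η s * φ' (max R s) = ∫ s in (R + 1)..r, φ' (max R s) := by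
      refine intervalIntegral.integral_congr fun s hs => ?_
      rw [uIcc_of_le hr] at hs
      show η s * φ' (max R s) = φ' (max R s)
      rw [hη1 s hs.1 (hs.2.trans hrb), one_mul]
    show _ ≤ ∫ s in R..r, η s * φ' (max R s)
    linarith

/-- Cut-off functions between `a` and `2 a`, with derivative of order `1 / a`. -/
lemma exists_cutoff_real : ∃ c : ℝ, 0 < c ∧ ∀ a : ℝ, 0 < a → ∃ X X' : ℝ → ℝ,
    (∀ r, HasDerivAt X (X' r) r) ∧ Continuous X' ∧ (∀ r, 0 ≤ X r ∧ X r ≤ 1) ∧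
      (∀ r, r ≤ a → X r = 1 ∧ X' r = 0) ∧ (∀ r, 2 * a ≤ r → X r = 0 ∧ X' r = 0) ∧
      ∀ r, |X' r| ≤ c / a := by
  have hsm : ContDiff ℝ 1 Real.smoothTransition := Real.smoothTransition.contDiff
  have hdc : Continuous (deriv Real.smoothTransition) := hsm.continuous_deriv le_rfl
  have hder : ∀ r, HasDerivAt Real.smoothTransition (deriv Real.smoothTransition r) r := fun r =>
    (hsm.differentiable one_ne_zero r).hasDerivAt
  have h0 : ∀ r, r ≤ 0 → deriv Real.smoothTransition r = 0 := by
    have h : Iio (0 : ℝ) ⊆ {r | deriv Real.smoothTransition r = 0} := fun r (hr : r < 0) => by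
      have : Real.smoothTransition =ᶠ[𝓝 r] fun _ => 0 := by
        filter_upwards [Iio_mem_nhds hr] with s hs
        exact Real.smoothTransition.zero_of_nonpos (le_of_lt hs)
      show deriv _ r = 0
      rw [this.deriv_eq, deriv_const]
    have := closure_minimal h (isClosed_eq hdc continuous_const)
    rw [closure_Iio] at this
    exact fun r hr => this hr
  have h1 : ∀ r, 1 ≤ r → deriv Real.smoothTransition r = 0 := by
    have h : Ioi (1 : ℝ) ⊆ {r | deriv Real.smoothTransition r = 0} := fun r (hr : 1 < r) => by
      have : Real.smoothTransition =ᶠ[𝓝 r] fun _ => 1 := by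
        filter_upwards [Ioi_mem_nhds hr] with s hs
        exact Real.smoothTransition.one_of_one_le (le_of_lt hs)
      show deriv _ r = 0
      rw [this.deriv_eq, deriv_const]
    have := closure_minimal h (isClosed_eq hdc continuous_const)
    rw [closure_Ioi] at this
    exact fun r hr => this hr
  obtain ⟨c, hc⟩ := (isCompact_Icc (a := (0 : ℝ)) (b := 1)).exists_bound_of_continuousOn
    hdc.continuousOn
  have hcb : ∀ r, |deriv Real.smoothTransition r| ≤ |c| + 1 := fun r => by
    rcases le_total r 0 with hr | hr
    · rw [h0 r hr, abs_zero]; positivity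
    rcases le_total 1 r with hr1 | hr1
    · rw [h1 r hr1, abs_zero]; positivity
    · have := hc r ⟨hr, hr1⟩
      rw [Real.norm_eq_abs] at this
      linarith [le_abs_self c]
  refine ⟨|c| + 1, by positivity, fun a ha => ⟨fun r => 1 - Real.smoothTransition ((r - a) / a),
    fun r => -(deriv Real.smoothTransition ((r - a) / a) * (1 / a)), fun r => ?_, by fun_prop,
    fun r => ⟨?_, ?_⟩, fun r hr => ?_, fun r hr => ?_, fun r => ?_⟩⟩
  · have h2 : HasDerivAt (fun r : ℝ => (r - a) / a) (1 / a) r :=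
      ((hasDerivAt_id r).sub_const a).div_const a
    exact ((hder _).comp r h2).const_sub 1
  · linarith [Real.smoothTransition.le_one ((r - a) / a)]
  · linarith [Real.smoothTransition.nonneg ((r - a) / a)]
  · have h2 : (r - a) / a ≤ 0 := div_nonpos_of_nonpos_of_nonneg (by linarith) ha.le
    simp only [Real.smoothTransition.zero_of_nonpos h2, h0 _ h2]
    norm_num
  · have h2 : 1 ≤ (r - a) / a := by rw [le_div_iff₀ ha]; linarith
    simp only [Real.smoothTransition.one_of_one_le h2, h1 _ h2]
    norm_num
  · rw [abs_neg, abs_mul, abs_of_pos (by positivity : 0 < 1 / a), mul_one_div]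
    gcongr
    exact hcb _

/-! ### The function `Ahat` -/

lemma integrableOn_of_Ahat_le {E : Type*} [MeasurableSpace E] {μ : Measure E} {ρ Γρ Nρ : E → ℝ}
    {φ : ℝ → ℝ} {n : ℕ} {Q : ℝ} (hQ : 0 ≤ Q) (hΓm : AEStronglyMeasurable Γρ μ)
    (hNm : AEStronglyMeasurable Nρ μ) (hΓ0 : ∀ᵐ x ∂μ, 0 ≤ Γρ x)
    (h : Ahat μ ρ Γρ Nρ φ n ≤ ENNReal.ofReal Q) :
    (IntegrableOn Γρ (sublevel ρ (4 * n) \ sublevel ρ (2 * n)) μ ∧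
      ∫ x in sublevel ρ (4 * n) \ sublevel ρ (2 * n), Γρ x ∂μ ≤ Q ^ 2) ∧
    IntegrableOn (fun x => Nρ x ^ 2) (sublevel ρ (4 * n) \ sublevel ρ (2 * n)) μ ∧
      ∫ x in sublevel ρ (4 * n) \ sublevel ρ (2 * n), Nρ x ^ 2 ∂μ ≤ Q ^ 2 := by
  set S := sublevel ρ (4 * n) \ sublevel ρ (2 * n)
  set ν := μ.restrict S with hν
  have hν0 : ∀ᵐ x ∂ν, 0 ≤ Γρ x := ae_restrict_of_ae hΓ0
  set a := essSup (fun x => ENNReal.ofReal (Γρ x)) ν with ha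
  have h1 : a ^ (1 / 2 : ℝ) * ν univ ^ (1 / 2 : ℝ) ≤ ENNReal.ofReal Q := by
    refine le_trans ?_ h
    refine le_trans ?_ le_self_add
    exact mul_le_mul_left le_self_add _
  have h2 : eLpNorm Nρ 2 ν ≤ ENNReal.ofReal Q := le_trans le_add_self h
  have hsq : ∀ y : ℝ≥0∞, y ^ (1 / 2 : ℝ) ≤ ENNReal.ofReal Q → y ≤ ENNReal.ofReal (Q ^ 2) := by
    intro y hy
    have := ENNReal.rpow_le_rpow hy (zero_le_two (α := ℝ))
    rwa [← ENNReal.rpow_mul, one_div, inv_mul_cancel₀ two_ne_zero, ENNReal.rpow_one,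
      ENNReal.ofReal_rpow_of_nonneg hQ zero_le_two, Real.rpow_two] at this
  have h3 : ∫⁻ x, ENNReal.ofReal (Γρ x) ∂ν ≤ ENNReal.ofReal (Q ^ 2) := by
    calc ∫⁻ x, ENNReal.ofReal (Γρ x) ∂ν ≤ ∫⁻ _, a ∂ν := lintegral_mono_ae (ENNReal.ae_le_essSup _)
      _ = a * ν univ := lintegral_const _
      _ ≤ _ := by
        refine hsq _ ?_
        rwa [ENNReal.mul_rpow_of_nonneg _ _ (by norm_num)]
  have h4 : ∫⁻ x, ENNReal.ofReal (Nρ x ^ 2) ∂ν ≤ ENNReal.ofReal (Q ^ 2) := by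
    refine hsq _ ?_
    rw [eLpNorm_eq_lintegral_rpow_enorm_toReal two_ne_zero ENNReal.ofNat_ne_top] at h2
    convert h2 using 2
    · simp
      refine lintegral_congr fun x => ?_
      rw [← ofReal_norm, ← ENNReal.ofReal_pow (norm_nonneg _), Real.norm_eq_abs, sq_abs]
    · simp
  have key : ∀ g : E → ℝ, AEStronglyMeasurable g ν → (∀ᵐ x ∂ν, 0 ≤ g x) →
      ∫⁻ x, ENNReal.ofReal (g x) ∂ν ≤ ENNReal.ofReal (Q ^ 2) →
      Integrable g ν ∧ ∫ x, g x ∂ν ≤ Q ^ 2 := by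
    intro g hg hg0 hgl
    refine ⟨⟨hg, (hasFiniteIntegral_iff_ofReal hg0).2 (hgl.trans_lt ENNReal.ofReal_lt_top)⟩, ?_⟩
    rw [integral_eq_lintegral_of_nonneg_ae hg0 hg]
    exact (ENNReal.toReal_le_of_le_ofReal (sq_nonneg Q) hgl)
  exact ⟨key _ hΓm.restrict hν0 h3, key _ (hNm.restrict.pow 2) (ae_of_all _ fun x => sq_nonneg _) h4⟩

end

noncomputable section

variable {E : Type*} [MetricSpace E] [LocallyCompactSpace E]
  [TopologicalSpace.SeparableSpace E] [MeasurableSpace E] [BorelSpace E] {μ : Measure E}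
  [IsFiniteMeasureOnCompacts μ] {E₀ : L2Form μ}
  {Γ : E₀.dom →ₗ[ℝ] E₀.dom →ₗ[ℝ] (E →ₘ[μ] ℝ)} {N : (E →ₘ[μ] ℝ) →ₗ.[ℝ] (E →ₘ[μ] ℝ)}
  {ρ : E → ℝ} {Γρ Nρ : E →ₘ[μ] ℝ} {K₀ : Set E} {p : ℝ≥0∞} [Fact (1 ≤ p)]

/-- The identity in (H2) for the semigroup `S` on `V`. -/
def IsGeneratorFormula (E₀ : L2Form μ) (Γ : E₀.dom →ₗ[ℝ] E₀.dom →ₗ[ℝ] (E →ₘ[μ] ℝ))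
    (N : (E →ₘ[μ] ℝ) →ₗ.[ℝ] (E →ₘ[μ] ℝ)) (V : Set E)
    (S : C0ContractionSemigroup (Lp ℝ p (μ.restrict V))) : Prop :=
  ∀ f Lf : Lp ℝ p (μ.restrict V), S.HasGenerator f Lf → EssBdd (μ.restrict V) f →
    ∃ (v : E₀.dom) (v' : N.domain), v'.1 = v.1 ∧ (∀ᵐ x ∂μ, v.1 x = V.indicator f x) ∧
      ∀ u : E₀.dom, EssBdd μ u.1 → (∀ᵐ x ∂μ, x ∉ V → u.1 x = 0) →
        -∫ x in V, Lf x * u.1 x ∂μ = ∫ x, Γ u v x ∂μ + ∫ x in V, u.1 x * N v' x ∂μ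

/-- The change of the mass of a solution of the evolution equation on `{ρ < b}`, tested with the
cut-off function `X(ρ)`, in terms of the weight `exp(2 θ ψ(ρ))`. -/
theorem abs_integral_op_sub_le (hE₀ : E₀.IsStronglyLocalRegular) (hΓ : E₀.IsCarreDuChamp Γ)
    (hN : IsDivFreeDerivation E₀ N) (H3 : HypH3 E₀ Γ N ρ Γρ Nρ K₀) {b : ℝ} (hb : 0 < b)
    {S : C0ContractionSemigroup (Lp ℝ p (μ.restrict (sublevel ρ b)))} (hS : IsSubMarkovian S)
    (hL : IsGeneratorFormula E₀ Γ N (sublevel ρ b) S) {ψ d : ℝ → ℝ}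
    (hψ : ∀ r, HasDerivAt ψ (d r) r) (hd : Continuous d) {R R' Q : ℝ} (hR : 0 ≤ R)
    (hRR' : R ≤ R') (hK : K₀ ⊆ sublevel ρ R) (hψ0 : ∀ r, 0 ≤ ψ r)
    (hψQ : ∀ r, ψ r ≤ Q)
    (hdR : ∀ r, r ≤ R → d r = 0) (hdR' : ∀ r, R' ≤ r → d r = 0) (hψR' : ∀ r, R' ≤ r → ψ r = ψ R')
    {θ Λ : ℝ} (hθ : 0 < θ) (hθ1 : θ < 1) (hΛ : 0 ≤ Λ)
    (hDe : ∀ᵐ x ∂μ, ρ x < b → d (ρ x) ^ 2 * Γρ x + d (ρ x) * Nρ x ≤ Λ)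
    {X X' : ℝ → ℝ} (hX : ∀ r, HasDerivAt X (X' r) r) (hX' : Continuous X') {CX κ : ℝ}
    (hX1 : ∀ r, |X r| ≤ CX) (hXC : ∀ r, |X' r| ≤ CX) (hX0 : ∀ r, b ≤ r → X r = 0 ∧ X' r = 0)
    (hκ : 0 < κ)
    (hκ1 : ∫ x, (Real.exp (2 * θ * ψ (ρ x)))⁻¹ * (X' (ρ x) ^ 2 * Γρ x) ∂μ ≤ κ ^ 2)
    (hi : Integrable (fun x => (Real.exp (2 * θ * ψ (ρ x)))⁻¹ * (X' (ρ x) * Nρ x) ^ 2) μ)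
    (hκ2 : ∫ x, (Real.exp (2 * θ * ψ (ρ x)))⁻¹ * (X' (ρ x) * Nρ x) ^ 2 ∂μ ≤ κ ^ 2)
    {f : Lp ℝ p (μ.restrict (sublevel ρ b))} {B t : ℝ} (hB : 0 < B)
    (hf : ∀ᵐ x ∂(μ.restrict (sublevel ρ b)), |f x| ≤ B) (ht : 0 < t)
    (hD : ∀ s, 0 < s → s ≤ t → S.op s f ∈ S.generatorDomain) :
    |∫ x in sublevel ρ b, S.op t f x * X (ρ x) ∂μ - ∫ x in sublevel ρ b, f x * X (ρ x) ∂μ| ≤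
      κ * (1 + Real.exp (2 * θ * Λ * t) *
        ∫ x in sublevel ρ b, f x ^ 2 * Real.exp (2 * θ * ψ (ρ x)) ∂μ) * t +
      κ * Real.exp (2 * θ * Λ * t) / (4 * (1 - θ)) *
        ∫ x in sublevel ρ b, f x ^ 2 * Real.exp (2 * θ * ψ (ρ x)) ∂μ := by
  have hV : IsOpen (sublevel ρ b) := H3.isOpen_sublevel b
  have hVc : IsCompact (closure (sublevel ρ b)) := H3.compact_sublevel b hb
  have hVm : MeasurableSet (sublevel ρ b) := hV.measurableSet
  have : IsFiniteMeasure (μ.restrict (sublevel ρ b)) :=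
    ⟨by rw [Measure.restrict_apply_univ]
        exact (measure_mono subset_closure).trans_lt hVc.measure_lt_top⟩
  have hψc : Continuous ψ := continuous_iff_continuousAt.2 fun r => (hψ r).continuousAt
  have hXc : Continuous X := continuous_iff_continuousAt.2 fun r => (hX r).continuousAt
  set ω : ℝ → ℝ := fun r => Real.exp (2 * θ * ψ r) with hω
  have hωc : Continuous ω := by fun_prop
  have hω1 : ∀ r, 1 ≤ ω r := fun r => Real.one_le_exp (by have := hψ0 r; positivity)
  have hωQ : ∀ r, ω r ≤ Real.exp (2 * θ * Q) := fun r =>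
    Real.exp_le_exp.2 (mul_le_mul_of_nonneg_left (hψQ r) (by positivity))
  have hωd : ∀ r, HasDerivAt ω (2 * θ * ω r * d r) r := fun r => by
    have := ((hψ r).const_mul (2 * θ)).exp
    convert this using 1
    rw [hω]; ring
  obtain ⟨Cd, hCd⟩ : ∃ Cd, ∀ r, |d r| ≤ Cd := by
    obtain ⟨C, hC⟩ := (isCompact_Icc (a := R) (b := R')).exists_bound_of_continuousOn
      hd.continuousOn
    refine ⟨|C|, fun r => ?_⟩
    rcases le_total r R with h | h
    · rw [hdR r h, abs_zero]; positivity
    rcases le_total R' r with h' | h'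
    · rw [hdR' r h', abs_zero]; positivity
    · exact (hC r ⟨h, h'⟩).trans (le_abs_self C)
  have hCd0 : 0 ≤ Cd := (abs_nonneg _).trans (hCd 0)
  set c : ℝ := ω R' with hc
  set Bω : ℝ := Real.exp (2 * θ * Q) with hBω
  have hBω0 : 0 < Bω := Real.exp_pos _
  have hg1 : ∀ r, |ω r - c| ≤ Bω := fun r => by
    rw [abs_le]
    constructor <;> linarith [hω1 r, hωQ r, hω1 R', hωQ R']
  have hg2 : ∀ r, |2 * θ * ω r * d r| ≤ 2 * θ * Bω * Cd := fun r => by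
    rw [abs_mul, abs_of_nonneg (by have := hω1 r; positivity : 0 ≤ 2 * θ * ω r)]
    have := hω1 r
    gcongr
    · exact hωQ r
    · exact hCd r
  obtain ⟨w, w', hww, hw, hwΓ, hwN⟩ := H3.exists_comp hE₀ hΓ hN (R := R') (G := fun r => ω r - c)
    (G' := fun r => 2 * θ * ω r * d r) (C := Bω + 2 * θ * Bω * Cd)
    (fun r => (hωd r).sub_const c) (by fun_prop)
    (fun r => (hg1 r).trans (by have : 0 ≤ 2 * θ * Bω * Cd := by positivity
                                linarith))
    (fun r => (hg2 r).trans (by linarith)) (hR.trans hRR')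
    (fun r hr => by
      show ω r - c = 0
      rw [hc, hω]; simp only; rw [hψR' r hr, sub_self])
    (fun r hr => by
      show 2 * θ * ω r * d r = 0
      rw [hdR' r hr, mul_zero])
  obtain ⟨χ, χ', hχχ, hχ, hχΓ, hχN⟩ := H3.exists_comp hE₀ hΓ hN (R := b) hX hX' hX1 hXC hb.le
    (fun r hr => (hX0 r hr).1) (fun r hr => (hX0 r hr).2)
  obtain ⟨CΓ, hCΓ⟩ := H3.gamma_bdd_annulus (R' := R') hK
  have hwC : ∀ᵐ x ∂μ, Γ w w x ≤ (2 * θ * Bω * Cd) ^ 2 * |CΓ| := by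
    filter_upwards [hwΓ, hCΓ, H3.gamma_nonneg hΓ] with x h1 h2 h3
    rw [h1]
    rcases le_total (ρ x) R with h | h
    · rw [hdR _ h]; simp only [mul_zero, ne_eq, OfNat.ofNat_ne_zero, not_false_eq_true, zero_pow,
        zero_mul]; positivity
    rcases le_total R' (ρ x) with h' | h'
    · rw [hdR' _ h']; simp only [mul_zero, ne_eq, OfNat.ofNat_ne_zero, not_false_eq_true, zero_pow,
        zero_mul]; positivity
    · have h4 : Γρ x ≤ |CΓ| := (le_abs_self _).trans ((h2 h h').trans (le_abs_self _))
      exact mul_le_mul (sq_le_sq' (by linarith [abs_le.1 (hg2 (ρ x))]) (abs_le.1 (hg2 (ρ x))).2)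
        h4 h3 (sq_nonneg _)
  have hXρ : AEStronglyMeasurable (fun x => X (ρ x)) (μ.restrict (sublevel ρ b)) :=
    (hXc.comp H3.continuous).aestronglyMeasurable
  have hωρ : AEStronglyMeasurable (fun x => ω (ρ x)) (μ.restrict (sublevel ρ b)) :=
    (hωc.comp H3.continuous).aestronglyMeasurable
  have step : ∀ s, s ∈ Ioo 0 t → ∃ (L : Lp ℝ p (μ.restrict (sublevel ρ b))) (F : ℝ),
      S.HasGenerator (S.op s f) L ∧ 0 ≤ F ∧
      2 * (∫ x in sublevel ρ b, L x * S.op s f x * ω (ρ x) ∂μ) ≤ -2 * (1 - θ) * F +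
        2 * θ * Λ * ∫ x in sublevel ρ b, S.op s f x ^ 2 * ω (ρ x) ∂μ ∧
      |∫ x in sublevel ρ b, L x * X (ρ x) ∂μ| ≤ κ / 2 * (1 + F) +
        κ / 2 * (1 + ∫ x in sublevel ρ b, S.op s f x ^ 2 * ω (ρ x) ∂μ) := by
    intro s hs
    obtain ⟨L, hLs⟩ := hD s hs.1 hs.2.le
    obtain ⟨v, v', hvv, hv, hid⟩ := hL _ L hLs ⟨B, hS.abs_le hs.1.le f hB hf⟩
    have hvV : ∀ᵐ x ∂μ, x ∈ sublevel ρ b → v.1 x = S.op s f x := by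
      filter_upwards [hv] with x hx hxV
      rw [hx, indicator_of_mem hxV]
    have hvV' := (ae_restrict_iff' hVm).2 hvV
    have hv0 : ∀ᵐ x ∂μ, x ∉ sublevel ρ b → v.1 x = 0 := by
      filter_upwards [hv] with x hx hxV
      rw [hx, indicator_of_notMem hxV]
    have hvb : EssBdd μ v.1 := by
      refine ⟨B, ?_⟩
      filter_upwards [hvV, hv0, (ae_restrict_iff' hVm).1 (hS.abs_le hs.1.le f hB hf)] with x h1 h2 h3
      by_cases hx : x ∈ sublevel ρ b
      · rw [h1 hx]; exact h3 hx
      · rw [h2 hx, abs_zero]; exact hB.le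
    have e1 : ∫ x in sublevel ρ b, v.1 x ^ 2 * ω (ρ x) ∂μ =
        ∫ x in sublevel ρ b, S.op s f x ^ 2 * ω (ρ x) ∂μ :=
      integral_congr_ae (by filter_upwards [hvV'] with x hx; rw [hx])
    have e2 : ∫ x in sublevel ρ b, L x * v.1 x * ω (ρ x) ∂μ =
        ∫ x in sublevel ρ b, L x * S.op s f x * ω (ρ x) ∂μ :=
      integral_congr_ae (by filter_upwards [hvV'] with x hx; rw [hx])
    have e3 : ∫ x in sublevel ρ b, L x * χ.1 x ∂μ = ∫ x in sublevel ρ b, L x * X (ρ x) ∂μ :=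
      integral_congr_ae (by filter_upwards [ae_restrict_of_ae hχ] with x hx; rw [hx])
    refine ⟨L, ∫ x, ω (ρ x) * Γ v v x ∂μ, hLs, ?_, ?_, ?_⟩
    · refine integral_nonneg_of_ae ?_
      filter_upwards [hΓ.nonneg v] with x hx
      exact mul_nonneg (by linarith [hω1 (ρ x)]) hx
    · have := energy_inequality hE₀ hΓ hN hV hVc v v' hvv hvb hv0 L hid w w' hww
        (g := fun x => ω (ρ x) - c) (c := c) ((hωc.comp H3.continuous).sub continuous_const)
        (fun x => hg1 (ρ x)) hw hwC (fun x => by linarith [hω1 (ρ x)]) hθ.le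
        (D := fun x => d (ρ x) ^ 2 * Γρ x) (e := fun x => d (ρ x) * Nρ x) (Λ := Λ)
        (by filter_upwards [H3.gamma_nonneg hΓ] with x hx; positivity)
        (by filter_upwards [hwΓ] with x hx; rw [hx]; ring)
        (by filter_upwards [hwN] with x hx; rw [hx]; ring) hDe
      simp only [sub_add_cancel] at this
      rw [e1, e2] at this
      exact this
    · have := cutoff_inequality hE₀ hΓ hN hV hVc v v' hvv hvb hv0 L hid χ χ' hχχ
        ((essBdd_of_le fun x => hX1 (ρ x)).congr hχ)
        (by filter_upwards [hχ] with x hx hxV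
            rw [hx]; exact (hX0 _ (not_lt.1 hxV)).1)
        (W := fun x => ω (ρ x)) (B := Bω) (κ := κ) (hωc.comp H3.continuous) (fun x => hω1 _)
        (fun x => hωQ _) hκ
        (le_of_eq_of_le (integral_congr_ae (by filter_upwards [hχΓ] with x hx; rw [hx])) hκ1)
        (hi.congr (by filter_upwards [hχN] with x hx; rw [hx]))
        (le_of_eq_of_le (integral_congr_ae (by filter_upwards [hχN] with x hx; rw [hx])) hκ2)
      rw [e1, e3] at this
      exact this
  choose! L F hLs hF hG' hH' using step
  have hωb : ∀ᵐ x ∂(μ.restrict (sublevel ρ b)), |ω (ρ x)| ≤ Bω := ae_of_all _ fun x => by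
    rw [abs_of_nonneg (by linarith [hω1 (ρ x)])]; exact hωQ _
  have hXb : ∀ᵐ x ∂(μ.restrict (sublevel ρ b)), |X (ρ x)| ≤ CX := ae_of_all _ fun x => hX1 _
  have main := abs_sub_le_of_weighted (G := fun s => ∫ x in sublevel ρ b, S.op s f x ^ 2 * ω (ρ x) ∂μ)
    (H := fun s => ∫ x in sublevel ρ b, S.op s f x * X (ρ x) ∂μ)
    (G' := fun s => 2 * ∫ x in sublevel ρ b, L s x * S.op s f x * ω (ρ x) ∂μ)
    (H' := fun s => ∫ x in sublevel ρ b, L s x * X (ρ x) ∂μ) (F := fun s => max (F s) 0)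
    (a := 1 - θ) (l := 2 * θ * Λ) ht (by linarith) hκ (by positivity)
    ((continuousOn_integral_op_sq hS f hB hf hωρ hωb).mono fun s hs => hs.1)
    ((continuousOn_integral_op f hXρ hXb).mono fun s hs => hs.1)
    (fun s hs => hasDerivWithinAt_integral_op_sq hS f hB hf hωρ hωb hs.1.le (hLs s hs))
    (fun s hs => hasDerivWithinAt_integral_op f hXρ hXb hs.1.le (hLs s hs))
    (fun s => le_max_right _ _)
    (fun s => integral_nonneg fun x => mul_nonneg (sq_nonneg _) (by linarith [hω1 (ρ x)]))
    (fun s hs => by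
      show _ ≤ -2 * (1 - θ) * max (F s) 0 + _
      rw [max_eq_left (hF s hs)]; exact hG' s hs)
    (fun s hs => by
      show _ ≤ κ / 2 * (1 + max (F s) 0) + _
      rw [max_eq_left (hF s hs)]; exact hH' s hs)
  simp only [S.op_zero, ContinuousLinearMap.id_apply] at main
  exact main

end

noncomputable section

lemma integral_le_of_le_indicator {E : Type*} [MeasurableSpace E] {μ : Measure E} {g h : E → ℝ}
    {S : Set E} {A Q : ℝ} (hS : MeasurableSet S) (hg : IntegrableOn g S μ)
    (hm : AEStronglyMeasurable h μ) (h0 : ∀ᵐ x ∂μ, 0 ≤ h x)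
    (hle : ∀ᵐ x ∂μ, h x ≤ S.indicator (fun x => A * g x) x) (hA : 0 ≤ A)
    (hQ : ∫ x in S, g x ∂μ ≤ Q) : Integrable h μ ∧ ∫ x, h x ∂μ ≤ A * Q := by
  have hi : Integrable (S.indicator fun x => A * g x) μ :=
    (integrable_indicator_iff hS).2 (hg.const_mul A)
  have hI : Integrable h μ := by
    refine hi.mono' hm ?_
    filter_upwards [h0, hle] with x h1 h2
    rwa [Real.norm_eq_abs, abs_of_nonneg h1]
  refine ⟨hI, (integral_mono_ae hI hi hle).trans ?_⟩
  rw [integral_indicator hS, integral_const_mul]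
  exact mul_le_mul_of_nonneg_left hQ hA

lemma monotoneOn_of_hasDerivAt_nonneg {φ φ' : ℝ → ℝ} {R : ℝ}
    (hφ : ∀ r, R ≤ r → HasDerivAt φ (φ' r) r) (h0 : ∀ r, R ≤ r → 0 ≤ φ' r) :
    MonotoneOn φ (Ici R) := by
  refine monotoneOn_of_deriv_nonneg (convex_Ici R)
    (fun r hr => (hφ r hr).continuousAt.continuousWithinAt)
    (fun r hr => ?_) fun r hr => ?_
  · rw [interior_Ici] at hr
    exact (hφ r (le_of_lt hr)).differentiableAt.differentiableWithinAt
  · rw [interior_Ici] at hr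
    rw [(hφ r (le_of_lt hr)).deriv]
    exact h0 r (le_of_lt hr)

section MassChange

variable {E : Type*} [MetricSpace E] [LocallyCompactSpace E]
  [TopologicalSpace.SeparableSpace E] [MeasurableSpace E] [BorelSpace E] {μ : Measure E}
  [IsFiniteMeasureOnCompacts μ] {E₀ : L2Form μ}
  {Γ : E₀.dom →ₗ[ℝ] E₀.dom →ₗ[ℝ] (E →ₘ[μ] ℝ)} {N : (E →ₘ[μ] ℝ) →ₗ.[ℝ] (E →ₘ[μ] ℝ)}
  {ρ : E → ℝ} {Γρ Nρ : E →ₘ[μ] ℝ} {K₀ : Set E} {p : ℝ≥0∞} [Fact (1 ≤ p)]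

/-- The change of the mass on `{ρ < 4 n}` up to a cut-off, in terms of `Ahat`. -/
theorem abs_integral_op_sub_le_of_Ahat (hE₀ : E₀.IsStronglyLocalRegular)
    (hΓ : E₀.IsCarreDuChamp Γ)
    (hN : IsDivFreeDerivation E₀ N) (H3 : HypH3 E₀ Γ N ρ Γρ Nρ K₀) {n : ℕ}
    {S : C0ContractionSemigroup (Lp ℝ p (μ.restrict (sublevel ρ (4 * n))))}
    (hS : IsSubMarkovian S) (hL : IsGeneratorFormula E₀ Γ N (sublevel ρ (4 * n)) S)
    {φ φ' φ₁ : ℝ → ℝ} {R M : ℝ} (hR : 0 ≤ R) (hRn : R + 1 ≤ 2 * n) (hK : K₀ ⊆ sublevel ρ R)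
    (hφ : ∀ r, R ≤ r → HasDerivAt φ (φ' r) r) (hc : ContinuousOn φ' (Ici R))
    (h0 : ∀ r, R ≤ r → 0 ≤ φ' r) (hφ0 : ∀ r, R ≤ r → 0 ≤ φ r) (hM : 0 ≤ M)
    (hDe : ∀ᵐ x ∂μ, R ≤ ρ x → φ' (ρ x) ^ 2 * Γρ x + φ' (ρ x) * Nρ x ≤ M * (1 + φ (ρ x)))
    {q : ℝ} (hA : Ahat μ ρ Γρ Nρ φ₁ n ≤ ENNReal.ofReal (n * Real.exp q))
    {θ : ℝ} (hθ : 0 < θ) (hθ1 : θ < 1) {X X' : ℝ → ℝ} (hX : ∀ r, HasDerivAt X (X' r) r)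
    (hX' : Continuous X') {c : ℝ} (hc0 : 0 < c) (hX1 : ∀ r, 0 ≤ X r ∧ X r ≤ 1)
    (hXa : ∀ r : ℝ, r ≤ 2 * n → X r = 1 ∧ X' r = 0) (hXb : ∀ r : ℝ, 2 * (2 * n) ≤ r → X r = 0 ∧ X' r = 0)
    (hXc : ∀ r, |X' r| ≤ c / (2 * n))
    {f : Lp ℝ p (μ.restrict (sublevel ρ (4 * n)))} {B k t : ℝ} (hB : 0 < B)
    (hf : ∀ᵐ x ∂(μ.restrict (sublevel ρ (4 * n))), |f x| ≤ B) (hk : R ≤ k)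
    (hfk : ∀ᵐ x ∂(μ.restrict (sublevel ρ (4 * n))), x ∉ sublevel ρ k → f x = 0) (ht : 0 < t)
    (hD : ∀ s, 0 < s → s ≤ t → S.op s f ∈ S.generatorDomain) :
    |∫ x in sublevel ρ (4 * n), S.op t f x * X (ρ x) ∂μ -
        ∫ x in sublevel ρ (4 * n), f x * X (ρ x) ∂μ| ≤
      c / 2 * Real.exp (q - θ * (φ (2 * n) - φ (R + 1))) *
        Real.exp (2 * θ * (M * (1 + φ (4 * n))) * t) *
        (t + (t + 1 / (4 * (1 - θ))) *
          (B ^ 2 * Real.exp (2 * θ * (φ k - φ R)) * μ.real (sublevel ρ k))) := by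
  have hn : (0 : ℝ) < n := by linarith
  have hmono := monotoneOn_of_hasDerivAt_nonneg hφ h0
  have hφ4 : 0 ≤ φ (4 * n) := hφ0 _ (by linarith)
  have hV : IsOpen (sublevel ρ (4 * n)) := H3.isOpen_sublevel _
  have hVc : IsCompact (closure (sublevel ρ (4 * n))) := H3.compact_sublevel _ (by linarith)
  have : IsFiniteMeasure (μ.restrict (sublevel ρ (4 * n))) :=
    ⟨by rw [Measure.restrict_apply_univ]
        exact (measure_mono subset_closure).trans_lt hVc.measure_lt_top⟩
  have hkfin : μ (sublevel ρ k) ≠ ⊤ := by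
    refine ((measure_mono ?_).trans_lt (H3.compact_sublevel (k + 1) (by linarith)).measure_lt_top).ne
    exact (show sublevel ρ k ⊆ sublevel ρ (k + 1) from fun x (hx : ρ x < k) =>
      show ρ x < k + 1 by linarith).trans subset_closure
  obtain ⟨η, ψ, hψ, hd, hη, hηR, hηb, hψR, hψb, hψm, hψle, hψge⟩ :=
    exists_truncated_primitive (b := 4 * n) hφ hc h0
  have hψ0 : ∀ r, 0 ≤ ψ r := fun r => by
    rw [← hψR (min r R) (min_le_right _ _)]; exact hψm (min_le_left _ _)
  have hψc : Continuous ψ := continuous_iff_continuousAt.2 fun r => (hψ r).continuousAt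
  set m : ℝ := φ (2 * n) - φ (R + 1) with hm
  have hψm2 : ∀ r : ℝ, 2 * n ≤ r → m ≤ ψ r := fun r hr =>
    (hψge _ hRn (by linarith)).trans (hψm hr)
  set κ : ℝ := c / 2 * Real.exp (q - θ * m) with hκ
  have hκ0 : 0 < κ := by positivity
  have hκ2 : κ ^ 2 = (Real.exp (2 * θ * m))⁻¹ * (c / (2 * n)) ^ 2 * (n * Real.exp q) ^ 2 := by
    rw [← Real.exp_neg, hκ, mul_pow, mul_pow, ← Real.exp_nat_mul, ← Real.exp_nat_mul,
      show ((2 : ℕ) : ℝ) * (q - θ * m) = -(2 * θ * m) + (2 : ℕ) * q by push_cast; ring, Real.exp_add]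
    field_simp
  have hSm : MeasurableSet (sublevel ρ (4 * n) \ sublevel ρ (2 * n)) :=
    hV.measurableSet.diff (H3.isOpen_sublevel _).measurableSet
  obtain ⟨⟨hΓi, hΓQ⟩, hNi, hNQ⟩ := integrableOn_of_Ahat_le (by positivity)
    Γρ.aestronglyMeasurable Nρ.aestronglyMeasurable (H3.gamma_nonneg hΓ) hA
  have hρm : AEStronglyMeasurable (fun x => (Real.exp (2 * θ * ψ (ρ x)))⁻¹) μ := by
    have hρc := H3.continuous
    refine Continuous.aestronglyMeasurable (Continuous.inv₀ (by fun_prop) fun x => ?_)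
    exact (Real.exp_pos _).ne'
  have hX'm : AEStronglyMeasurable (fun x => X' (ρ x)) μ :=
    (hX'.comp H3.continuous).aestronglyMeasurable
  have hpt : ∀ x (y : ℝ), 0 ≤ y → (Real.exp (2 * θ * ψ (ρ x)))⁻¹ * (X' (ρ x) ^ 2 * y) ≤
      (sublevel ρ (4 * n) \ sublevel ρ (2 * n)).indicator
        (fun _ => (Real.exp (2 * θ * m))⁻¹ * (c / (2 * n)) ^ 2 * y) x := by
    intro x y hy
    by_cases hx : x ∈ sublevel ρ (4 * n) \ sublevel ρ (2 * n)
    · rw [indicator_of_mem hx, mul_assoc _ _ y]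
      have h2 : 2 * (n : ℝ) ≤ ρ x := not_lt.1 hx.2
      have h3 : X' (ρ x) ^ 2 ≤ (c / (2 * n)) ^ 2 :=
        sq_le_sq' (by linarith [abs_le.1 (hXc (ρ x))]) (abs_le.1 (hXc (ρ x))).2
      have h4 : (Real.exp (2 * θ * ψ (ρ x)))⁻¹ ≤ (Real.exp (2 * θ * m))⁻¹ :=
        inv_anti₀ (Real.exp_pos _)
          (Real.exp_le_exp.2 (mul_le_mul_of_nonneg_left (hψm2 _ h2) (by positivity)))
      exact mul_le_mul h4 (mul_le_mul_of_nonneg_right h3 hy) (by positivity) (by positivity)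
    · rw [indicator_of_notMem hx]
      have : X' (ρ x) = 0 := by
        by_cases h : ρ x < 4 * n
        · refine (hXa _ ?_).2
          by_contra h'
          exact hx ⟨h, fun h'' => h' (le_of_lt h'')⟩
        · exact (hXb _ (by linarith)).2
      rw [this]; simp
  have hκ1 := integral_le_of_le_indicator hSm hΓi
    (hρm.mul ((hX'm.pow 2).mul Γρ.aestronglyMeasurable))
    (A := (Real.exp (2 * θ * m))⁻¹ * (c / (2 * n)) ^ 2)
    (by filter_upwards [H3.gamma_nonneg hΓ] with x hx
        show 0 ≤ (Real.exp (2 * θ * ψ (ρ x)))⁻¹ * (X' (ρ x) ^ 2 * Γρ x)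
        positivity)
    (by filter_upwards [H3.gamma_nonneg hΓ] with x hx
        refine (hpt x _ hx).trans (le_of_eq ?_)
        simp only [indicator]) (by positivity) hΓQ
  have hκ3 := integral_le_of_le_indicator hSm hNi
    (hρm.mul ((hX'm.mul Nρ.aestronglyMeasurable).pow 2))
    (A := (Real.exp (2 * θ * m))⁻¹ * (c / (2 * n)) ^ 2)
    (ae_of_all _ fun x => by
        show 0 ≤ (Real.exp (2 * θ * ψ (ρ x)))⁻¹ * (X' (ρ x) * Nρ x) ^ 2
        positivity)
    (ae_of_all _ fun x => by
        show (Real.exp (2 * θ * ψ (ρ x)))⁻¹ * (X' (ρ x) * Nρ x) ^ 2 ≤ _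
        rw [mul_pow]
        refine (hpt x _ (sq_nonneg _)).trans (le_of_eq ?_)
        simp only [indicator]) (by positivity) hNQ
  rw [← hκ2] at hκ1 hκ3
  have hDe' : ∀ᵐ x ∂μ, ρ x < 4 * n →
      (η (ρ x) * φ' (max R (ρ x))) ^ 2 * Γρ x + η (ρ x) * φ' (max R (ρ x)) * Nρ x ≤
        M * (1 + φ (4 * n)) := by
    filter_upwards [hDe, H3.gamma_nonneg hΓ] with x hx hΓx hxn
    rcases le_total (ρ x) R with h | h
    · rw [hηR _ h]
      have : 0 ≤ M * (1 + φ (4 * n)) := by positivity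
      simpa using this
    rw [max_eq_right h]
    have h1 := hx h
    have h2 : M * (1 + φ (ρ x)) ≤ M * (1 + φ (4 * n)) := by
      have := hmono (show R ≤ ρ x from h) (show R ≤ 4 * (n : ℝ) by linarith) hxn.le
      gcongr
    obtain ⟨e0, e1⟩ := hη (ρ x)
    have h3 : η (ρ x) * (φ' (ρ x) ^ 2 * Γρ x + φ' (ρ x) * Nρ x) ≤ η (ρ x) * (M * (1 + φ (4 * n))) :=
      mul_le_mul_of_nonneg_left (h1.trans h2) e0
    have h4 : η (ρ x) * (M * (1 + φ (4 * n))) ≤ M * (1 + φ (4 * n)) :=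
      mul_le_of_le_one_left (by positivity) e1
    have h5 : η (ρ x) ^ 2 * (φ' (ρ x) ^ 2 * Γρ x) ≤ η (ρ x) * (φ' (ρ x) ^ 2 * Γρ x) :=
      mul_le_mul_of_nonneg_right (by nlinarith) (by positivity)
    nlinarith
  have hmain := abs_integral_op_sub_le hE₀ hΓ hN H3 (by linarith) hS hL hψ hd hR
    (R' := 4 * n + 1) (Q := ψ (4 * n + 1)) (by linarith) hK hψ0
    (fun r => by
      rcases le_total r (4 * n + 1) with h | h
      · exact hψm h
      · rw [hψb r h])
    (fun r hr => by rw [hηR r hr, zero_mul]) (fun r hr => by rw [hηb r hr, zero_mul]) hψb hθ hθ1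
    (by positivity) hDe' hX hX' (CX := 1 + c / (2 * n))
    (fun r => by
      have : 0 < c / (2 * n) := by positivity
      rw [abs_of_nonneg (hX1 r).1]; linarith [(hX1 r).2])
    (fun r => by linarith [hXc r])
    (fun r hr => hXb r (by linarith)) hκ0 hκ1.2 hκ3.1 hκ3.2 hB hf ht hD
  set G0 := ∫ x in sublevel ρ (4 * n), f x ^ 2 * Real.exp (2 * θ * ψ (ρ x)) ∂μ with hG0
  have hG0n : 0 ≤ G0 := integral_nonneg fun x => by positivity
  have hG0le : G0 ≤ B ^ 2 * Real.exp (2 * θ * (φ k - φ R)) * μ.real (sublevel ρ k) := by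
    have hρc := H3.continuous
    refine (integral_le_of_le_indicator (μ := μ.restrict (sublevel ρ (4 * n))) (g := fun _ => 1)
      (H3.isOpen_sublevel k).measurableSet (integrable_const _) ?_ ?_ ?_ (by positivity) ?_).2
    · refine ((Lp.aestronglyMeasurable f).pow 2).mul ?_
      exact Continuous.aestronglyMeasurable (by fun_prop)
    · exact ae_of_all _ fun x => by positivity
    · filter_upwards [hf, hfk] with x h1 h2
      by_cases hx : x ∈ sublevel ρ k
      · rw [indicator_of_mem hx, mul_one]
        have h3 : f x ^ 2 ≤ B ^ 2 := sq_le_sq' (abs_le.1 h1).1 (abs_le.1 h1).2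
        have h4 : ψ (ρ x) ≤ φ k - φ R := (hψm (le_of_lt hx)).trans (hψle k hk)
        gcongr
      · rw [indicator_of_notMem hx, h2 hx]; simp
    · rw [setIntegral_const, smul_eq_mul, mul_one]
      exact ENNReal.toReal_mono hkfin (Measure.restrict_apply_le _ _)
  set G1 := B ^ 2 * Real.exp (2 * θ * (φ k - φ R)) * μ.real (sublevel ρ k) with hG1
  refine hmain.trans ?_
  set l := Real.exp (2 * θ * (M * (1 + φ (4 * n))) * t) with hl
  have hl1 : 1 ≤ l := Real.one_le_exp (by positivity)
  have h1θ : 0 < 1 - θ := by linarith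
  have e1 : κ * (1 + l * G0) * t ≤ κ * (l + l * G1) * t := by gcongr
  have e2 : κ * l / (4 * (1 - θ)) * G0 ≤ κ * l / (4 * (1 - θ)) * G1 := by gcongr
  calc _ ≤ κ * (l + l * G1) * t + κ * l / (4 * (1 - θ)) * G1 := add_le_add e1 e2
    _ = _ := by ring

end MassChange

end

noncomputable section

section Conservativeness

variable {E : Type*} [MeasurableSpace E] {μ : Measure E}
  {T : C0ContractionSemigroup (Lp ℝ 2 μ)}

/-- The image of an increasing sequence with limit at most `1`. -/
lemma IsSubMarkovian.monotone_op (hT : IsSubMarkovian T) {s : ℝ} (hs : 0 < s)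
    {F : ℕ → Lp ℝ 2 μ} (hF : ∀ᵐ x ∂μ, (∀ n, 0 ≤ F n x) ∧ Monotone (fun n => F n x) ∧
      Tendsto (fun n => F n x) atTop (𝓝 1)) :
    ∀ᵐ x ∂μ, (∀ n, 0 ≤ T.op s (F n) x ∧ T.op s (F n) x ≤ 1) ∧
      Monotone (fun n => T.op s (F n) x) := by
  have h1 : ∀ n, ∀ᵐ x ∂μ, 0 ≤ T.op s (F n) x ∧ T.op s (F n) x ≤ 1 := fun n => by
    refine hT s hs (F n) ?_
    filter_upwards [hF] with x hx
    exact ⟨hx.1 n, hx.2.1.ge_of_tendsto hx.2.2 n⟩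
  have h2 : ∀ n, ∀ᵐ x ∂μ, T.op s (F n) x ≤ T.op s (F (n + 1)) x := fun n => by
    have h3 : ∀ᵐ x ∂μ, 0 ≤ T.op s (F (n + 1) - F n) x ∧ T.op s (F (n + 1) - F n) x ≤ 1 := by
      refine hT s hs _ ?_
      filter_upwards [hF, Lp.coeFn_sub (F (n + 1)) (F n)] with x hx hx'
      rw [hx', Pi.sub_apply]
      have := hx.2.1 n.le_succ
      exact ⟨by simpa using this, by linarith [hx.1 n, hx.2.1.ge_of_tendsto hx.2.2 (n + 1)]⟩
    rw [map_sub] at h3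
    filter_upwards [h3, Lp.coeFn_sub (T.op s (F (n + 1))) (T.op s (F n))] with x hx hx'
    rw [hx', Pi.sub_apply] at hx
    linarith [hx.1]
  filter_upwards [ae_all_iff.2 h1, ae_all_iff.2 h2] with x hx1 hx2
  exact ⟨hx1, monotone_nat_of_le_succ hx2⟩

lemma IsSubMarkovian.isMonotoneExtension_add (hT : IsSubMarkovian T) {s r : ℝ} (hs : 0 < s)
    (hr : 0 < r) (h1 : IsMonotoneExtension (T.op s) (fun _ => 1) (fun _ => 1))
    (h2 : IsMonotoneExtension (T.op r) (fun _ => 1) (fun _ => 1)) :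
    IsMonotoneExtension (T.op (s + r)) (fun _ => 1) (fun _ => 1) := by
  intro F hFb hF
  rw [T.op_add s r hs.le hr.le]
  have h3 := hT.monotone_op hr hF
  refine h1 (fun n => T.op r (F n)) (fun n => ⟨1, ?_⟩) ?_
  · filter_upwards [h3] with x hx
    rw [abs_of_nonneg (hx.1 n).1]
    exact (hx.1 n).2
  · filter_upwards [h3, h2 F hFb hF] with x hx hx'
    exact ⟨fun n => (hx.1 n).1, hx.2, hx'⟩

/-- A sub-Markovian semigroup is conservative if it is so for small times. -/
lemma IsSubMarkovian.isConservative_of_small (hT : IsSubMarkovian T) {t₀ : ℝ} (ht₀ : 0 < t₀)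
    (h : ∀ s, 0 < s → s ≤ t₀ → IsMonotoneExtension (T.op s) (fun _ => 1) (fun _ => 1)) :
    IsConservative T := by
  intro t ht
  obtain ⟨m, hm⟩ := exists_nat_ge (t / t₀)
  have hm0 : (0 : ℝ) < m + 1 := by positivity
  set s := t / (m + 1) with hs
  have hs0 : 0 < s := by positivity
  have hst : s ≤ t₀ := by
    rw [hs, div_le_iff₀ hm0]
    rw [div_le_iff₀ ht₀] at hm
    nlinarith
  have key : ∀ k : ℕ, IsMonotoneExtension (T.op ((k + 1 : ℕ) * s)) (fun _ => 1) (fun _ => 1) := by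
    intro k
    induction k with
    | zero => simpa using h s hs0 hst
    | succ k ih =>
      have := hT.isMonotoneExtension_add (by positivity) hs0 ih (h s hs0 hst)
      convert this using 2
      push_cast
      ring
  have := key m
  have e : ((m + 1 : ℕ) : ℝ) * s = t := by
    rw [hs]; push_cast; field_simp
  rwa [e] at this

lemma integral_adjoint_mul (S : Lp ℝ 2 μ →L[ℝ] Lp ℝ 2 μ) (f g : Lp ℝ 2 μ) :
    ∫ x, ContinuousLinearMap.adjoint S f x * g x ∂μ = ∫ x, f x * S g x ∂μ := by
  have h := ContinuousLinearMap.adjoint_inner_left S g f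
  rw [L2.inner_def, L2.inner_def] at h
  simpa [mul_comm] using h

/-- `T_s 1 = 1` if the adjoint of `T_s` preserves the integrals of a dense set of functions. -/
theorem IsSubMarkovian.isMonotoneExtension_one_of_dense [SigmaFinite μ] (hT : IsSubMarkovian T)
    {s : ℝ} (hs : 0 < s) {D : Set (Lp ℝ 1 μ)} (hD : Dense D)
    (h : ∀ f ∈ D, ∃ f₁ f₂ : Lp ℝ 2 μ, (∀ᵐ x ∂μ, f x = f₁ x - f₂ x) ∧ Integrable f₁ μ ∧
      Integrable f₂ μ ∧ Integrable (ContinuousLinearMap.adjoint (T.op s) f₁) μ ∧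
      Integrable (ContinuousLinearMap.adjoint (T.op s) f₂) μ ∧
      ∫ x, ContinuousLinearMap.adjoint (T.op s) f₁ x ∂μ -
        ∫ x, ContinuousLinearMap.adjoint (T.op s) f₂ x ∂μ = ∫ x, f x ∂μ) :
    IsMonotoneExtension (T.op s) (fun _ => 1) (fun _ => 1) := by
  intro F hFb hF
  have hm := hT.monotone_op hs hF
  set g : E → ℝ := fun x => ⨆ n, T.op s (F n) x with hg
  have hlim : ∀ᵐ x ∂μ, Tendsto (fun n => T.op s (F n) x) atTop (𝓝 (g x)) := by
    filter_upwards [hm] with x hx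
    exact tendsto_atTop_ciSup hx.2 ⟨1, by rintro _ ⟨n, rfl⟩; exact (hx.1 n).2⟩
  have hgm : AEStronglyMeasurable g μ :=
    aestronglyMeasurable_of_tendsto_ae atTop (fun n => Lp.aestronglyMeasurable _) hlim
  have hg01 : ∀ᵐ x ∂μ, 0 ≤ g x ∧ g x ≤ 1 := by
    filter_upwards [hm, hlim] with x hx hx'
    exact ⟨ge_of_tendsto' hx' fun n => (hx.1 n).1, le_of_tendsto' hx' fun n => (hx.1 n).2⟩
  have hpair : ∀ f : Lp ℝ 2 μ, Integrable f μ →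
      Integrable (ContinuousLinearMap.adjoint (T.op s) f) μ →
      ∫ x, f x * g x ∂μ = ∫ x, ContinuousLinearMap.adjoint (T.op s) f x ∂μ := by
    intro f hf hf'
    have h1 : Tendsto (fun n => ∫ x, f x * T.op s (F n) x ∂μ) atTop (𝓝 (∫ x, f x * g x ∂μ)) := by
      refine tendsto_integral_of_dominated_convergence (fun x => |f x|)
        (fun n => hf.aestronglyMeasurable.mul (Lp.aestronglyMeasurable _)) hf.abs (fun n => ?_) ?_
      · filter_upwards [hm] with x hx
        rw [Real.norm_eq_abs, abs_mul, abs_of_nonneg (hx.1 n).1]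
        exact mul_le_of_le_one_right (abs_nonneg _) (hx.1 n).2
      · filter_upwards [hlim] with x hx
        exact hx.const_mul _
    have h2 : Tendsto (fun n => ∫ x, ContinuousLinearMap.adjoint (T.op s) f x * F n x ∂μ) atTop
        (𝓝 (∫ x, ContinuousLinearMap.adjoint (T.op s) f x * 1 ∂μ)) := by
      refine tendsto_integral_of_dominated_convergence
        (fun x => |ContinuousLinearMap.adjoint (T.op s) f x|)
        (fun n => hf'.aestronglyMeasurable.mul (Lp.aestronglyMeasurable _)) hf'.abs (fun n => ?_) ?_
      · filter_upwards [hF] with x hx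
        rw [Real.norm_eq_abs, abs_mul, abs_of_nonneg (hx.1 n)]
        exact mul_le_of_le_one_right (abs_nonneg _) (hx.2.1.ge_of_tendsto hx.2.2 n)
      · filter_upwards [hF] with x hx
        exact hx.2.2.const_mul _
    simp only [integral_adjoint_mul, mul_one] at h2
    exact tendsto_nhds_unique h1 h2
  have hgi : ∀ f : E → ℝ, Integrable f μ → Integrable (fun x => f x * (1 - g x)) μ := fun f hf => by
    refine hf.mul_bdd (c := 1) (aestronglyMeasurable_const.sub hgm) ?_
    filter_upwards [hg01] with x hx
    rw [Real.norm_eq_abs, _root_.abs_le]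
    constructor <;> linarith
  have hgi' : ∀ f : E → ℝ, Integrable f μ → Integrable (fun x => f x * g x) μ := fun f hf => by
    refine hf.mul_bdd (c := 1) hgm ?_
    filter_upwards [hg01] with x hx
    rw [Real.norm_eq_abs, _root_.abs_le]
    constructor <;> linarith
  have hzero : ∀ f ∈ D, ∫ x, f x * (1 - g x) ∂μ = 0 := by
    intro f hf
    obtain ⟨f₁, f₂, hff, hi1, hi2, hi1', hi2', hint⟩ := h f hf
    have hfi : Integrable f μ := L1.integrable_coeFn f
    have e1 : ∫ x, f x * g x ∂μ = ∫ x, f₁ x * g x ∂μ - ∫ x, f₂ x * g x ∂μ := by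
      rw [← integral_sub (hgi' _ hi1) (hgi' _ hi2)]
      refine integral_congr_ae ?_
      filter_upwards [hff] with x hx
      rw [hx, sub_mul]
    have e2 : ∫ x, f x * (1 - g x) ∂μ = ∫ x, f x ∂μ - ∫ x, f x * g x ∂μ := by
      rw [← integral_sub hfi (hgi' _ hfi)]
      exact integral_congr_ae (ae_of_all _ fun x => by ring)
    rw [e2, e1, hpair _ hi1 hi1', hpair _ hi2 hi2', hint, sub_self]
  have hset : ∀ A : Set E, MeasurableSet A → μ A ≠ ⊤ → ∀ᵐ x ∂μ, x ∈ A → g x = 1 := by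
    intro A hA hAfin
    have h1i : Integrable (fun x => 1 - g x) (μ.restrict A) := by
      have := (hgi _ ((integrable_indicator_iff hA).2 (integrableOn_const (C := (1 : ℝ)) hAfin)))
      refine (integrable_indicator_iff hA).1 (this.congr (ae_of_all _ fun x => ?_))
      by_cases hx : x ∈ A <;> simp [hx]
    have h1n : 0 ≤ᵐ[μ.restrict A] fun x => 1 - g x := by
      filter_upwards [ae_restrict_of_ae hg01] with x hx
      show 0 ≤ 1 - g x
      linarith
    have hle : ∫ x in A, (1 - g x) ∂μ ≤ 0 := by
      refine le_of_forall_pos_le_add fun ε hε => ?_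
      set φ : Lp ℝ 1 μ := indicatorConstLp 1 hA hAfin (1 : ℝ)
      obtain ⟨f, hf, hfε⟩ := Metric.mem_closure_iff.1 (hD φ) ε hε
      have hφx : φ =ᵐ[μ] A.indicator fun _ => (1 : ℝ) := indicatorConstLp_coeFn
      have e1 : ∫ x in A, (1 - g x) ∂μ = ∫ x, φ x * (1 - g x) ∂μ := by
        rw [← integral_indicator hA]
        refine integral_congr_ae ?_
        filter_upwards [hφx] with x hx
        rw [hx]
        by_cases hxA : x ∈ A <;> simp [hxA]
      have hfi : Integrable f μ := L1.integrable_coeFn f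
      have hφi : Integrable φ μ := L1.integrable_coeFn φ
      have hdi : Integrable (φ - f : Lp ℝ 1 μ) μ := L1.integrable_coeFn _
      have e2 : ∫ x, φ x * (1 - g x) ∂μ = ∫ x, (φ - f : Lp ℝ 1 μ) x * (1 - g x) ∂μ := by
        rw [← sub_zero (∫ x, φ x * (1 - g x) ∂μ), ← hzero f hf,
          ← integral_sub (hgi _ hφi) (hgi _ hfi)]
        refine integral_congr_ae ?_
        filter_upwards [Lp.coeFn_sub φ f] with x hx
        rw [hx, Pi.sub_apply, sub_mul]
      have e3 : ∫ x, (φ - f : Lp ℝ 1 μ) x * (1 - g x) ∂μ ≤ ∫ x, ‖(φ - f : Lp ℝ 1 μ) x‖ ∂μ := by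
        refine integral_mono_ae (hgi _ hdi) hdi.norm ?_
        filter_upwards [hg01] with x hx
        rw [Real.norm_eq_abs]
        refine (mul_le_mul_of_nonneg_right (le_abs_self _) (by linarith)).trans ?_
        exact mul_le_of_le_one_right (abs_nonneg _) (by linarith)
      rw [← L1.norm_eq_integral_norm, ← dist_eq_norm] at e3
      rw [e1, e2]
      linarith
    have h0 : ∫ x in A, (1 - g x) ∂μ = 0 := le_antisymm hle (integral_nonneg_of_ae h1n)
    have := (integral_eq_zero_iff_of_nonneg_ae h1n h1i).1 h0
    filter_upwards [(ae_restrict_iff' hA).1 this] with x hx hxA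
    have h3 : 1 - g x = 0 := hx hxA
    linarith
  have hall : ∀ᵐ x ∂μ, ∀ i, x ∈ spanningSets μ i → g x = 1 := ae_all_iff.2 fun i =>
    hset _ (measurableSet_spanningSets μ i) (measure_spanningSets_lt_top μ i).ne
  filter_upwards [hall, hlim] with x hx hx'
  rwa [hx _ (mem_spanningSetsIndex μ x)] at hx'

/-- The adjoint of a sub-Markovian operator maps non-negative integrable functions to integrable
functions. -/
lemma IsSubMarkovian.integrable_adjoint [SigmaFinite μ] (hT : IsSubMarkovian T) {s : ℝ}
    (hs : 0 < s) {f : Lp ℝ 2 μ} (hf : Integrable f μ) (hf0 : ∀ᵐ x ∂μ, 0 ≤ f x)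
    (hf0' : ∀ᵐ x ∂μ, 0 ≤ ContinuousLinearMap.adjoint (T.op s) f x) :
    Integrable (ContinuousLinearMap.adjoint (T.op s) f) μ := by
  set h := ContinuousLinearMap.adjoint (T.op s) f
  have hbound : ∀ A, MeasurableSet A → μ A ≠ ⊤ →
      ∫⁻ x in A, ENNReal.ofReal (h x) ∂μ ≤ ENNReal.ofReal (∫ x, f x ∂μ) := by
    intro A hA hAfin
    set φ : Lp ℝ 2 μ := indicatorConstLp 2 hA hAfin (1 : ℝ)
    have hφx : φ =ᵐ[μ] A.indicator fun _ => (1 : ℝ) := indicatorConstLp_coeFn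
    have hφ01 : ∀ᵐ x ∂μ, 0 ≤ φ x ∧ φ x ≤ 1 := by
      filter_upwards [hφx] with x hx
      rw [hx]
      by_cases hxA : x ∈ A <;> simp [hxA]
    have hTφ := hT s hs φ hφ01
    have hfin : IsFiniteMeasure (μ.restrict A) := ⟨by
      rw [Measure.restrict_apply_univ]; exact hAfin.lt_top⟩
    have hhi : Integrable h (μ.restrict A) :=
      ((Lp.memLp h).restrict A).integrable (by norm_num)
    rw [← ofReal_integral_eq_lintegral_ofReal hhi (ae_restrict_of_ae hf0')]
    refine ENNReal.ofReal_le_ofReal ?_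
    have e1 : ∫ x in A, h x ∂μ = ∫ x, h x * φ x ∂μ := by
      rw [← integral_indicator hA]
      refine integral_congr_ae ?_
      filter_upwards [hφx] with x hx
      rw [hx]
      by_cases hxA : x ∈ A <;> simp [hxA]
    rw [e1, integral_adjoint_mul]
    refine integral_mono_of_nonneg ?_ hf ?_
    · filter_upwards [hf0, hTφ] with x h1 h2
      exact mul_nonneg h1 h2.1
    · filter_upwards [hf0, hTφ] with x h1 h2
      exact mul_le_of_le_one_right h1 h2.2
  refine ⟨Lp.aestronglyMeasurable h, ?_⟩
  rw [hasFiniteIntegral_iff_ofReal hf0']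
  have hsup : ∫⁻ x, ENNReal.ofReal (h x) ∂μ ≤ ENNReal.ofReal (∫ x, f x ∂μ) := by
    rw [← setLIntegral_univ, ← iUnion_spanningSets μ,
      setLIntegral_iUnion_of_directed _ (monotone_spanningSets μ).directed_le]
    exact iSup_le fun i => hbound _ (measurableSet_spanningSets μ i)
      (measure_spanningSets_lt_top μ i).ne
  exact hsup.trans_lt ENNReal.ofReal_lt_top

end Conservativeness

end

noncomputable section

lemma ae_eq_zero_of_notMem_essSupport {E : Type*} [MeasurableSpace E] [TopologicalSpace E]
    [OpensMeasurableSpace E] [SecondCountableTopology E] {μ : Measure E} {u : E → ℝ}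
    (hu : AEStronglyMeasurable u μ) : ∀ᵐ x ∂μ, x ∉ essSupport μ u → u x = 0 := by
  have h : (μ.withDensity fun x => ‖u x‖ₑ) (essSupport μ u)ᶜ = 0 := Measure.measure_compl_support
  have hm : MeasurableSet (essSupport μ u)ᶜ :=
    (show IsClosed (essSupport μ u) from Measure.isClosed_support).measurableSet.compl
  rw [withDensity_apply _ hm, lintegral_eq_zero_iff' hu.enorm.restrict, EventuallyEq,
    ae_restrict_iff' hm] at h
  filter_upwards [h] with x hx hxs
  simpa using hx hxs

/-- Convergence of the integrals of the local semigroups, with cut-off functions. -/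
lemma HypH1.tendsto_integral {E : Type*} [MeasurableSpace E] {μ : Measure E} [SigmaFinite μ]
    {T : C0ContractionSemigroup (Lp ℝ 2 μ)} (hT : IsSubMarkovian T) {V : ℕ → Set E} {p : ℝ≥0∞}
    [Fact (1 ≤ p)] {That : ∀ n : ℕ, C0ContractionSemigroup (Lp ℝ p (μ.restrict (V n)))}
    (H1 : HypH1 T V p That) (hV : ∀ n, MeasurableSet (V n)) {s : ℝ} (hs : 0 < s)
    {f : Lp ℝ 2 μ} (hf0 : ∀ᵐ x ∂μ, 0 ≤ f x) (hf : Integrable f μ) {B : ℝ} (hB : 0 < B)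
    (hfB : ∀ᵐ x ∂μ, |f x| ≤ B) {fV : ∀ n : ℕ, Lp ℝ p (μ.restrict (V n))}
    (hfV : ∀ n, fV n =ᵐ[μ.restrict (V n)] f) {X : ℕ → E → ℝ}
    (hXm : ∀ n, 0 < n → AEStronglyMeasurable (X n) μ)
    (hX : ∀ n, 0 < n → ∀ x, 0 ≤ X n x ∧ X n x ≤ 1) (hX1 : ∀ x, ∀ᶠ n in atTop, X n x = 1) :
    Integrable (ContinuousLinearMap.adjoint (T.op s) f) μ ∧
      Tendsto (fun n => ∫ x in V n, (That n).op s (fV n) x * X n x ∂μ) atTop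
        (𝓝 (∫ x, ContinuousLinearMap.adjoint (T.op s) f x ∂μ)) := by
  have hmain := H1.2 s hs f hf0 hf ⟨B, hfB⟩ fV hfV
  have hpos : ∀ n, 0 < n → ∀ᵐ x ∂μ, 0 ≤ (V n).indicator ((That n).op s (fV n)) x := by
    intro n hn
    have h1 := (H1.1 n hn).mem_Icc hs (fV n) hB (by
      filter_upwards [hfV n, ae_restrict_of_ae hf0, ae_restrict_of_ae hfB] with x h1 h2 h3
      rw [h1]
      exact ⟨h2, (le_abs_self _).trans h3⟩)
    filter_upwards [(ae_restrict_iff' (hV n)).1 h1] with x hx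
    by_cases hxV : x ∈ V n
    · rw [indicator_of_mem hxV]; exact (hx hxV).1
    · rw [indicator_of_notMem hxV]
  have hpos' : ∀ᵐ x ∂μ, ∀ n, 0 < n → 0 ≤ (V n).indicator ((That n).op s (fV n)) x :=
    ae_all_iff.2 fun n => by
      by_cases hn : 0 < n
      · filter_upwards [hpos n hn] with x hx _ using hx
      · exact ae_of_all _ fun x h => absurd h hn
  have hle : ∀ᵐ x ∂μ, ∀ n, 0 < n → (V n).indicator ((That n).op s (fV n)) x ≤
      ContinuousLinearMap.adjoint (T.op s) f x := by
    filter_upwards [hmain] with x hx n hn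
    have hmono : Monotone fun k => (V (k + 1)).indicator ((That (k + 1)).op s (fV (k + 1))) x :=
      monotone_nat_of_le_succ fun k => hx.1 (k + 1) (Nat.succ_pos k)
    obtain ⟨m, rfl⟩ := Nat.exists_eq_add_one.2 hn
    exact hmono.ge_of_tendsto (hx.2.comp (tendsto_add_atTop_nat 1)) m
  have hadj0 : ∀ᵐ x ∂μ, 0 ≤ ContinuousLinearMap.adjoint (T.op s) f x := by
    filter_upwards [hpos', hle] with x h1 h2
    exact (h1 1 one_pos).trans (h2 1 one_pos)
  have hint := hT.integrable_adjoint hs hf hf0 hadj0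
  refine ⟨hint, ?_⟩
  have e : ∀ n, ∫ x in V n, (That n).op s (fV n) x * X n x ∂μ =
      ∫ x, (V n).indicator ((That n).op s (fV n)) x * X n x ∂μ := fun n => by
    rw [← integral_indicator (hV n)]
    refine integral_congr_ae (ae_of_all _ fun x => ?_)
    by_cases hx : x ∈ V n <;> simp [hx]
  simp only [e]
  refine tendsto_integral_filter_of_dominated_convergence
    (fun x => ContinuousLinearMap.adjoint (T.op s) f x) ?_ ?_ hint ?_
  · filter_upwards [eventually_gt_atTop 0] with n hn
    exact ((aestronglyMeasurable_indicator_iff (hV n)).2 (Lp.aestronglyMeasurable _)).mul (hXm n hn)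
  · filter_upwards [eventually_gt_atTop 0] with n hn
    filter_upwards [hpos', hle] with x h1 h2
    have := hX n hn x
    rw [Real.norm_eq_abs, abs_of_nonneg (mul_nonneg (h1 n hn) this.1)]
    exact (mul_le_of_le_one_right (h1 n hn) this.2).trans (h2 n hn)
  · filter_upwards [hmain] with x hx
    refine hx.2.congr' ?_
    filter_upwards [hX1 x] with n hn
    rw [hn, mul_one]

section General

variable {E : Type*} [MetricSpace E] [LocallyCompactSpace E]
  [TopologicalSpace.SeparableSpace E] [MeasurableSpace E] [BorelSpace E] {μ : Measure E}
  [IsFiniteMeasureOnCompacts μ] {E₀ : L2Form μ}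
  {Γ : E₀.dom →ₗ[ℝ] E₀.dom →ₗ[ℝ] (E →ₘ[μ] ℝ)} {N : (E →ₘ[μ] ℝ) →ₗ.[ℝ] (E →ₘ[μ] ℝ)}
  {ρ : E → ℝ} {Γρ Nρ : E →ₘ[μ] ℝ} {K₀ : Set E} {p : ℝ≥0∞} [Fact (1 ≤ p)]
  {That : ∀ n : ℕ, C0ContractionSemigroup (Lp ℝ p (μ.restrict (sublevel ρ (4 * n))))}

/-- For small times the local semigroups asymptotically preserve the mass. -/
theorem tendsto_integral_op_sub (hE₀ : E₀.IsStronglyLocalRegular)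
    (hΓ : E₀.IsCarreDuChamp Γ) (hN : IsDivFreeDerivation E₀ N)
    (H3 : HypH3 E₀ Γ N ρ Γρ Nρ K₀) (hS : ∀ n : ℕ, 1 ≤ n → IsSubMarkovian (That n))
    (hL : ∀ n : ℕ, 1 ≤ n → IsGeneratorFormula E₀ Γ N (sublevel ρ (4 * n)) (That n))
    {φ φ' φ₁ : ℝ → ℝ} {R M α D : ℝ} (hR : 0 ≤ R) (hK : K₀ ⊆ sublevel ρ R)
    (hφ : ∀ r, R ≤ r → HasDerivAt φ (φ' r) r) (hc : ContinuousOn φ' (Ici R))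
    (h0 : ∀ r, R ≤ r → 0 ≤ φ' r) (hφ0 : ∀ r, R ≤ r → 0 ≤ φ r) (hM : 0 ≤ M)
    (hDe : ∀ᵐ x ∂μ, R ≤ ρ x → φ' (ρ x) ^ 2 * Γρ x + φ' (ρ x) * Nρ x ≤ M * (1 + φ (ρ x)))
    (hα0 : 0 < α) (hα1 : α < 1) (hA : ∀ᶠ n : ℕ in atTop,
      Ahat μ ρ Γρ Nρ φ₁ n ≤ ENNReal.ofReal (n * Real.exp (α * φ (2 * n))))
    (hD0 : 0 ≤ D) (hD : ∀ᶠ n : ℕ in atTop, φ (4 * n) ≤ D * (1 + φ (2 * n)))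
    (hinf : Tendsto (fun n : ℕ => φ (2 * n)) atTop atTop) :
    ∃ t₀ : ℝ, 0 < t₀ ∧ ∃ X : ℕ → ℝ → ℝ, (∀ n, 0 < n → Continuous (X n)) ∧
      (∀ n, 0 < n → ∀ r, 0 ≤ X n r ∧ X n r ≤ 1) ∧
      (∀ n : ℕ, 0 < n → ∀ r : ℝ, r ≤ 2 * n → X n r = 1) ∧
      ∀ (t : ℝ) (f : E → ℝ) (B k : ℝ), 0 < t → t ≤ t₀ → 0 < B → R ≤ k →
        (∀ᵐ x ∂μ, |f x| ≤ B) → (∀ᵐ x ∂μ, x ∉ sublevel ρ k → f x = 0) →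
        ∀ fV : ∀ n : ℕ, Lp ℝ p (μ.restrict (sublevel ρ (4 * n))),
        (∀ n : ℕ, fV n =ᵐ[μ.restrict (sublevel ρ (4 * n))] f) →
        (∀ᶠ n : ℕ in atTop, ∀ s, 0 < s → s ≤ t → (That n).op s (fV n) ∈ (That n).generatorDomain) →
        Tendsto (fun n : ℕ => ∫ x in sublevel ρ (4 * n), (That n).op t (fV n) x * X n (ρ x) ∂μ -
          ∫ x in sublevel ρ (4 * n), fV n x * X n (ρ x) ∂μ) atTop (𝓝 0) := by
  obtain ⟨c, hc0, hX⟩ := exists_cutoff_real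
  have hX' : ∀ n : ℕ, ∃ X X' : ℝ → ℝ, 0 < n → (∀ r, HasDerivAt X (X' r) r) ∧ Continuous X' ∧
      (∀ r, 0 ≤ X r ∧ X r ≤ 1) ∧ (∀ r : ℝ, r ≤ 2 * n → X r = 1 ∧ X' r = 0) ∧
      (∀ r : ℝ, 2 * (2 * n) ≤ r → X r = 0 ∧ X' r = 0) ∧ ∀ r, |X' r| ≤ c / (2 * n) := by
    intro n
    rcases Nat.eq_zero_or_pos n with hn | hn
    · exact ⟨0, 0, fun h => absurd hn h.ne'⟩
    · obtain ⟨X, X', h⟩ := hX (2 * n) (by positivity)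
      exact ⟨X, X', fun _ => h⟩
  choose X X' hXX using hX'
  set θ : ℝ := (1 + α) / 2 with hθ
  have hθ0 : 0 < θ := by positivity
  have hθ1 : θ < 1 := by linarith
  set δ : ℝ := (θ - α) / 2 with hδ
  have hδ0 : 0 < δ := by rw [hδ, hθ]; linarith
  refine ⟨δ / (2 * θ * M * D + 1), by positivity, X, fun n hn =>
    continuous_iff_continuousAt.2 fun r => ((hXX n hn).1 r).continuousAt, fun n hn =>
    (hXX n hn).2.2.1, fun n hn r hr => ((hXX n hn).2.2.2.1 r hr).1, ?_⟩
  intro t f B k ht htt hB hk hfB hfk fV hfV hdom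
  set G1 := B ^ 2 * Real.exp (2 * θ * (φ k - φ R)) * μ.real (sublevel ρ k) with hG1
  have hG1n : 0 ≤ G1 := by positivity
  have h1θ : 0 < 1 - θ := by linarith
  set A1 := t + (t + 1 / (4 * (1 - θ))) * G1 with hA1
  have hA1n : 0 ≤ A1 := by positivity
  set A2 := c / 2 * Real.exp (θ * φ (R + 1) + 2 * θ * M * (1 + D) * t) * A1 with hA2
  have hlim : Tendsto (fun n : ℕ => A2 * Real.exp (-(δ * φ (2 * n)))) atTop (𝓝 0) := by
    have h1 : Tendsto (fun n : ℕ => δ * φ (2 * n)) atTop atTop := hinf.const_mul_atTop hδ0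
    have h2 := (Real.tendsto_exp_neg_atTop_nhds_zero.comp h1).const_mul A2
    simpa using h2
  refine squeeze_zero_norm' ?_ hlim
  obtain ⟨n0, hn0⟩ := exists_nat_ge (R + 1)
  filter_upwards [hA, hD, hdom, eventually_ge_atTop n0, eventually_gt_atTop 0] with n h1 h2 h3 h4 h5
  obtain ⟨hXd, hXc', hX1, hXa, hXb, hXc⟩ := hXX n h5
  have hn0' : (n0 : ℝ) ≤ n := by exact_mod_cast h4
  have hRn : R + 1 ≤ 2 * n := by linarith
  have hm : ∀ᵐ x ∂(μ.restrict (sublevel ρ (4 * n))), |fV n x| ≤ B := by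
    filter_upwards [hfV n, ae_restrict_of_ae hfB] with x e1 e2
    rwa [e1]
  have hm' : ∀ᵐ x ∂(μ.restrict (sublevel ρ (4 * n))), x ∉ sublevel ρ k → fV n x = 0 := by
    filter_upwards [hfV n, ae_restrict_of_ae hfk] with x e1 e2
    rwa [e1]
  have := abs_integral_op_sub_le_of_Ahat hE₀ hΓ hN H3 (hS n h5) (hL n h5) hR hRn hK hφ hc h0 hφ0 hM
    hDe h1 hθ0 hθ1 hXd hXc' hc0 hX1 hXa hXb hXc hB hm hk hm' ht h3
  rw [Real.norm_eq_abs]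
  refine this.trans ?_
  rw [← hG1, ← hA1, mul_assoc (c / 2), ← Real.exp_add, hA2,
    mul_right_comm (c / 2 * Real.exp (θ * φ (R + 1) + 2 * θ * M * (1 + D) * t)) A1,
    mul_assoc (c / 2) (Real.exp _) (Real.exp _), ← Real.exp_add]
  have hφ2 : 0 ≤ φ (2 * n) := hφ0 _ (by linarith)
  refine mul_le_mul_of_nonneg_right (mul_le_mul_of_nonneg_left (Real.exp_le_exp.2 ?_)
    (by positivity)) hA1n
  have e1 : 2 * θ * (M * (1 + φ (4 * n))) * t ≤
      2 * θ * (M * (1 + D * (1 + φ (2 * n)))) * t := by gcongr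
  have e2 : 2 * θ * M * D * t ≤ δ := by
    rw [le_div_iff₀ (by positivity)] at htt
    nlinarith
  have e3 : 2 * θ * M * D * t * φ (2 * n) ≤ δ * φ (2 * n) := mul_le_mul_of_nonneg_right e2 hφ2
  have e4 : θ = α + 2 * δ := by rw [hδ]; ring
  have e5 : θ * φ (2 * n) = α * φ (2 * n) + 2 * (δ * φ (2 * n)) := by
    nth_rewrite 1 [e4]; ring
  nlinarith

/-- The general criterion. -/
theorem isConservative_of_weight {T : C0ContractionSemigroup (Lp ℝ 2 μ)} (hT : IsSubMarkovian T)
    (hE₀ : E₀.IsStronglyLocalRegular) (hΓ : E₀.IsCarreDuChamp Γ)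
    (H1 : HypH1 T (fun n => sublevel ρ (4 * n)) p That)
    (H2 : HypH2 E₀ Γ N (fun n => sublevel ρ (4 * n)) p That)
    (H3 : HypH3 E₀ Γ N ρ Γρ Nρ K₀) {t : ℝ} (ht : 0 < t) {K : Set E}
    (H4 : Dense (domD0 μ ρ K (fun n => sublevel ρ (4 * n)) p That t))
    {φ φ' φ₁ : ℝ → ℝ} {R M α D : ℝ} (hR : 0 ≤ R) {K' : Set E} (hK' : IsCompact K')
    (hφ : ∀ r, R ≤ r → HasDerivAt φ (φ' r) r) (hc : ContinuousOn φ' (Ici R))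
    (h0 : ∀ r, R ≤ r → 0 ≤ φ' r) (hφ0 : ∀ r, R ≤ r → 0 ≤ φ r) (hM : 0 ≤ M)
    (hDe : ∀ᵐ x ∂μ, x ∉ K' → R ≤ ρ x →
      φ' (ρ x) ^ 2 * Γρ x + φ' (ρ x) * Nρ x ≤ M * (1 + φ (ρ x)))
    (hα0 : 0 < α) (hα1 : α < 1) (hA : ∀ᶠ n : ℕ in atTop,
      Ahat μ ρ Γρ Nρ φ₁ n ≤ ENNReal.ofReal (n * Real.exp (α * φ (2 * n))))
    (hD0 : 0 ≤ D) (hD : ∀ᶠ n : ℕ in atTop, φ (4 * n) ≤ D * (1 + φ (2 * n)))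
    (hinf : Tendsto (fun n : ℕ => φ (2 * n)) atTop atTop) : IsConservative T := by
  have : SecondCountableTopology E := UniformSpace.secondCountable_of_separable E
  have hV : ∀ n : ℕ, MeasurableSet (sublevel ρ (4 * n)) := fun n =>
    (H3.isOpen_sublevel _).measurableSet
  have hfin : ∀ n : ℕ, IsFiniteMeasure (μ.restrict (sublevel ρ (4 * n))) := fun n => ⟨by
    rw [Measure.restrict_apply_univ]
    refine (measure_mono ?_).trans_lt
      (H3.compact_sublevel (4 * n + 1) (by positivity)).measure_lt_top
    exact (show sublevel ρ (4 * n) ⊆ sublevel ρ (4 * n + 1) from fun x (hx : ρ x < 4 * n) =>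
      show ρ x < 4 * n + 1 by linarith).trans subset_closure⟩
  obtain ⟨R₁, hR₁0, hR₁⟩ := H3.exists_subset_sublevel (H3.compact_K₀.union hK')
  set R₂ := max R R₁ with hR₂
  have hRR₂ : R ≤ R₂ := le_max_left _ _
  have hKK := hR₁ R₂ (le_max_right _ _)
  obtain ⟨t₀, ht₀, X, hXc, hX01, hX1, hlim⟩ := tendsto_integral_op_sub hE₀ hΓ H2.1 H3 H1.1 H2.2
    (hR.trans hRR₂) (subset_union_left.trans hKK) (fun r hr => hφ r (hRR₂.trans hr))
    (hc.mono (Ici_subset_Ici.2 hRR₂)) (fun r hr => h0 r (hRR₂.trans hr))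
    (fun r hr => hφ0 r (hRR₂.trans hr)) hM
    (by filter_upwards [hDe] with x hx hRx
        exact hx (fun hxK => absurd (hKK (Or.inr hxK)) (not_lt.2 hRx)) (hRR₂.trans hRx))
    hα0 hα1 hA hD0 hD hinf
  refine hT.isConservative_of_small (lt_min ht ht₀) fun s hs hst => ?_
  refine hT.isMonotoneExtension_one_of_dense hs H4 fun f hf => ?_
  obtain ⟨⟨B', hB'⟩, hfc, hfdom⟩ := hf
  obtain ⟨B, hB, hfB⟩ : ∃ B, 0 < B ∧ ∀ᵐ x ∂μ, |f x| ≤ B :=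
    ⟨|B'| + 1, by positivity, by filter_upwards [hB'] with x hx; linarith [le_abs_self B']⟩
  obtain ⟨R₃, hR₃0, hR₃⟩ := H3.exists_subset_sublevel hfc
  have hfk : ∀ᵐ x ∂μ, x ∉ sublevel ρ (max R₂ R₃) → f x = 0 := by
    filter_upwards [ae_eq_zero_of_notMem_essSupport (Lp.aestronglyMeasurable f)] with x hx hxk
    exact hx fun h => hxk (hR₃ _ (le_max_right _ _) h)
  have hfi : Integrable f μ := L1.integrable_coeFn f
  have hmem : ∀ g : E → ℝ, AEStronglyMeasurable g μ → (∀ᵐ x ∂μ, |g x| ≤ |f x|) →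
      MemLp g 2 μ ∧ Integrable g μ ∧ (∀ᵐ x ∂μ, |g x| ≤ B) ∧
        ∀ n : ℕ, MemLp g p (μ.restrict (sublevel ρ (4 * n))) := by
    intro g hg hgf
    have hgB : ∀ᵐ x ∂μ, |g x| ≤ B := by
      filter_upwards [hgf, hfB] with x h1 h2 using h1.trans h2
    have hgi : Integrable g μ := hfi.mono hg hgf
    refine ⟨?_, hgi, hgB, fun n => MemLp.of_bound hg.restrict B (ae_restrict_of_ae hgB)⟩
    refine (memLp_two_iff_integrable_sq hg).2 ?_
    have := hgi.mul_bdd (c := B) hg hgB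
    simpa only [sq] using this
  obtain ⟨m1, i1, b1, v1⟩ := hmem (fun x => max (f x) 0)
    ((Lp.aestronglyMeasurable f).sup aestronglyMeasurable_const)
    (ae_of_all _ fun x => by
      rw [abs_of_nonneg (le_max_right _ _)]; exact max_le (le_abs_self _) (abs_nonneg _))
  obtain ⟨m2, i2, b2, v2⟩ := hmem (fun x => max (-f x) 0)
    ((Lp.aestronglyMeasurable f).neg.sup aestronglyMeasurable_const)
    (ae_of_all _ fun x => by
      rw [abs_of_nonneg (le_max_right _ _)]; exact max_le (neg_le_abs _) (abs_nonneg _))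
  have c1 := m1.coeFn_toLp
  have c2 := m2.coeFn_toLp
  have hXρm : ∀ n, 0 < n → AEStronglyMeasurable (fun x => X n (ρ x)) μ := fun n hn =>
    ((hXc n hn).comp H3.continuous).aestronglyMeasurable
  have hXρ1 : ∀ x, ∀ᶠ n in atTop, X n (ρ x) = 1 := fun x => by
    obtain ⟨k, hk⟩ := exists_nat_ge (ρ x)
    filter_upwards [eventually_ge_atTop k, eventually_gt_atTop 0] with n hn hn0
    have : (k : ℝ) ≤ n := by exact_mod_cast hn
    exact hX1 n hn0 _ (by linarith [H3.nonneg x])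
  obtain ⟨a1, l1⟩ := H1.tendsto_integral hT hV hs (f := m1.toLp _)
    (by filter_upwards [c1] with x hx; rw [hx]; exact le_max_right _ _) (i1.congr c1.symm) hB
    (by filter_upwards [c1, b1] with x hx hx'; rw [hx]; exact hx')
    (fV := fun n => (v1 n).toLp _)
    (fun n => (v1 n).coeFn_toLp.trans (ae_restrict_of_ae c1.symm))
    (X := fun n x => X n (ρ x)) hXρm (fun n hn x => hX01 n hn (ρ x)) hXρ1
  obtain ⟨a2, l2⟩ := H1.tendsto_integral hT hV hs (f := m2.toLp _)
    (by filter_upwards [c2] with x hx; rw [hx]; exact le_max_right _ _) (i2.congr c2.symm) hB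
    (by filter_upwards [c2, b2] with x hx hx'; rw [hx]; exact hx')
    (fV := fun n => (v2 n).toLp _)
    (fun n => (v2 n).coeFn_toLp.trans (ae_restrict_of_ae c2.symm))
    (X := fun n x => X n (ρ x)) hXρm (fun n hn x => hX01 n hn (ρ x)) hXρ1
  have hff : ∀ y : ℝ, y = max y 0 - max (-y) 0 := fun y => by
    rcases le_total y 0 with h | h
    · rw [max_eq_right h, max_eq_left (by linarith)]; ring
    · rw [max_eq_left h, max_eq_right (by linarith)]; ring
  have hfV : ∀ n : ℕ, ((v1 n).toLp _ - (v2 n).toLp _ : Lp ℝ p (μ.restrict (sublevel ρ (4 * n))))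
      =ᵐ[μ.restrict (sublevel ρ (4 * n))] f := fun n => by
    filter_upwards [Lp.coeFn_sub ((v1 n).toLp _) ((v2 n).toLp _), (v1 n).coeFn_toLp,
      (v2 n).coeFn_toLp] with x h1 h2 h3
    rw [h1, Pi.sub_apply, h2, h3]
    exact (hff _).symm
  have l3 := hlim s f B (max R₂ R₃) hs (hst.trans (min_le_right _ _)) hB (le_max_left _ _) hfB hfk
    (fun n => (v1 n).toLp _ - (v2 n).toLp _) hfV (by
      filter_upwards [eventually_ge_atTop (kIndex μ ρ K f)] with n hn r hr hrs
      exact hfdom n hn r hr (hrs.trans (hst.trans (min_le_left _ _))) _ (hfV n))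
  have l4 : Tendsto (fun n : ℕ => ∫ x in sublevel ρ (4 * n),
      ((v1 n).toLp _ - (v2 n).toLp _ : Lp ℝ p (μ.restrict (sublevel ρ (4 * n)))) x * X n (ρ x) ∂μ)
      atTop (𝓝 (∫ x, f x ∂μ)) := by
    refine Tendsto.congr (fun n => integral_congr_ae (f := fun x => f x * X n (ρ x)) ?_) ?_
    · filter_upwards [hfV n] with x hx
      rw [hx]
    have e : ∀ n : ℕ, ∫ x in sublevel ρ (4 * n), f x * X n (ρ x) ∂μ =
        ∫ x, (sublevel ρ (4 * n)).indicator (fun x => f x * X n (ρ x)) x ∂μ := fun n =>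
      (integral_indicator (hV n)).symm
    simp only [e]
    refine tendsto_integral_filter_of_dominated_convergence (fun x => |f x|) ?_ ?_ hfi.abs ?_
    · filter_upwards [eventually_gt_atTop 0] with n hn
      exact (hfi.aestronglyMeasurable.mul (hXρm n hn)).indicator (hV n)
    · filter_upwards [eventually_gt_atTop 0] with n hn
      refine ae_of_all _ fun x => (norm_indicator_le_norm_self _ _).trans ?_
      rw [Real.norm_eq_abs, abs_mul, abs_of_nonneg (hX01 n hn (ρ x)).1]
      exact mul_le_of_le_one_right (abs_nonneg _) (hX01 n hn (ρ x)).2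
    · refine ae_of_all _ fun x => tendsto_const_nhds.congr' ?_
      obtain ⟨k, hk⟩ := exists_nat_gt (ρ x)
      filter_upwards [hXρ1 x, eventually_ge_atTop k] with n hn hkn
      have : (k : ℝ) ≤ n := by exact_mod_cast hkn
      have hxm : x ∈ sublevel ρ (4 * n) := show ρ x < 4 * n by linarith [H3.nonneg x]
      rw [indicator_of_mem hxm, hn, mul_one]
  refine ⟨m1.toLp _, m2.toLp _, ?_, i1.congr c1.symm, i2.congr c2.symm, a1, a2, ?_⟩
  · filter_upwards [c1, c2] with x h1 h2
    rw [h1, h2]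
    exact hff _
  · have l5 := l3.add l4
    simp only [sub_add_cancel, zero_add] at l5
    refine tendsto_nhds_unique ((l1.sub l2).congr' ?_) l5
    filter_upwards [eventually_gt_atTop 0] with n hn
    have hXb : ∀ᵐ x ∂(μ.restrict (sublevel ρ (4 * n))), |X n (ρ x)| ≤ 1 := ae_of_all _ fun x => by
      rw [abs_of_nonneg (hX01 n hn (ρ x)).1]; exact (hX01 n hn (ρ x)).2
    have := hfin n
    rw [map_sub, Lp.integral_sub_mul _ _ (hXρm n hn).restrict hXb]

end General

end

lemma sq_mul_add_mul_le {a Γ N B : ℝ} (ha : 0 < a) (h : Γ + N / a ≤ B) :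
    a ^ 2 * Γ + a * N ≤ a ^ 2 * B := by
  have h1 : a ^ 2 * (Γ + N / a) ≤ a ^ 2 * B := mul_le_mul_of_nonneg_left h (sq_nonneg a)
  have h2 : a ^ 2 * (Γ + N / a) = a ^ 2 * Γ + a * N := by field_simp
  linarith

lemma hasDerivAt_log_add_one {r : ℝ} (hr : 1 ≤ r) :
    HasDerivAt (fun r : ℝ => Real.log (r + 1)) (1 / (r + 1)) r :=
  ((hasDerivAt_id r).add_const 1).log (by simp only [id]; linarith)

lemma log_add_one_pos {r : ℝ} (hr : 1 ≤ r) : 0 < Real.log (r + 1) :=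
  Real.log_pos (by linarith)

lemma log_four_mul_add_one_le (n : ℕ) :
    Real.log (4 * (n : ℝ) + 1) ≤ 2 * Real.log (2 * (n : ℝ) + 1) := by
  have h : 2 * Real.log (2 * (n : ℝ) + 1) = Real.log ((2 * (n : ℝ) + 1) ^ 2) := by
    rw [Real.log_pow]; norm_num
  rw [h]
  exact Real.log_le_log (by positivity) (by nlinarith [sq_nonneg (n : ℝ)])

lemma tendsto_log_two_mul_add_one :
    Tendsto (fun n : ℕ => Real.log (2 * (n : ℝ) + 1)) atTop atTop := by
  refine Real.tendsto_log_atTop.comp (tendsto_atTop_add_const_right _ _ ?_)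
  exact tendsto_natCast_atTop_atTop.const_mul_atTop two_pos

theorem mainTheorem2 {E : Type*} [MetricSpace E] [LocallyCompactSpace E]
    [TopologicalSpace.SeparableSpace E] [MeasurableSpace E] [BorelSpace E]
    (μ : Measure E) [IsFiniteMeasureOnCompacts μ] [μ.IsOpenPosMeasure]
    -- the generalized Dirichlet form and its semigroup
    (𝓔 : GeneralizedDirichletForm μ) (T : C0ContractionSemigroup (Lp ℝ 2 μ))
    (hT : 𝓔.IsAssociated T)
    -- the strongly local regular form with its carré du champ, the operator `N`, the function `ρ`
    (E₀ : L2Form μ) (hE₀ : E₀.IsStronglyLocalRegular)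
    (Γ : E₀.dom →ₗ[ℝ] E₀.dom →ₗ[ℝ] (E →ₘ[μ] ℝ)) (hΓ : E₀.IsCarreDuChamp Γ)
    (N : (E →ₘ[μ] ℝ) →ₗ.[ℝ] (E →ₘ[μ] ℝ))
    (ρ : E → ℝ) (Γρ Nρ : E →ₘ[μ] ℝ) (K₀ : Set E)
    -- the local semigroups on `L^p(V_n, μ)`, `V_n = E_{4n}`
    (p : ℝ≥0∞) [Fact (1 ≤ p)] (hp : p = 1 ∨ p = 2)
    (That : ∀ n : ℕ, C0ContractionSemigroup (Lp ℝ p (μ.restrict (sublevel ρ (4 * n)))))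
    (H1 : HypH1 T (fun n => sublevel ρ (4 * n)) p That)
    (H2 : HypH2 E₀ Γ N (fun n => sublevel ρ (4 * n)) p That)
    (H3 : HypH3 E₀ Γ N ρ Γρ Nρ K₀)
    (t : ℝ) (ht : 0 < t) (K : Set E) (hK : IsCompact K) (hK₀ : K₀ ⊆ K)
    (H4 : Dense (domD0 μ ρ K (fun n => sublevel ρ (4 * n)) p That t)) :
    -- (i)
    (∀ M C α β : ℝ, 0 < M → 0 < C → 0 < α → α < 1 → 0 ≤ β → β < 2 →
      (∃ K' : Set E, IsCompact K' ∧ K₀ ⊆ K' ∧ ∀ᵐ x ∂μ, x ∉ K' →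
        |Γρ x + (ρ x + 1) * Nρ x / (C * (2 - β) * Real.log (ρ x + 1) ^ (1 - β))| ≤
          M * (ρ x + 1) ^ 2 * Real.log (ρ x + 1) ^ β) →
      (∀ᶠ n : ℕ in atTop, Ahat μ ρ Γρ Nρ (fun r => C * Real.log (r + 1) ^ (2 - β)) n ≤
        ENNReal.ofReal (n * Real.exp (α * C * Real.log (n + 1) ^ (2 - β)))) →
      IsConservative T) ∧
    -- (ii)
    (∀ M C α : ℝ, 0 < M → 0 < C → 0 < α → α < 1 →
      (∃ K' : Set E, IsCompact K' ∧ K₀ ⊆ K' ∧ ∀ᵐ x ∂μ, x ∉ K' →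
        |Γρ x + 1 / C * ((ρ x + 1) * Real.log (ρ x + 1) * Nρ x)| ≤
          M * (ρ x + 1) ^ 2 * Real.log (ρ x + 1) ^ 2) →
      (∀ᶠ n : ℕ in atTop, Ahat μ ρ Γρ Nρ (fun r => C * Real.log (Real.log (r + 1) + 1)) n ≤
        ENNReal.ofReal (n * Real.log (n + 1) ^ (C * α))) →
      IsConservative T) ∧
    -- (iii)
    (∀ M C α : ℝ, 0 < M → 0 < C → 0 < α → α < 2 →
      (∃ K' : Set E, IsCompact K' ∧ K₀ ⊆ K' ∧ ∀ᵐ x ∂μ, x ∉ K' →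
        |Γρ x + Nρ x / (C * ρ x)| ≤ M) →
      (∀ᶠ n : ℕ in atTop, Ahat μ ρ Γρ Nρ (fun r => C * r ^ 2 / 2) n ≤
        ENNReal.ofReal (n * Real.exp (α * C * (n : ℝ) ^ 2))) →
      IsConservative T) := by
  have hgen := fun φ φ' R M α D K' => isConservative_of_weight (φ := φ) (φ' := φ') (φ₁ := φ)
    (R := R) (M := M) (α := α) (D := D) (K' := K') hT.1 hE₀ hΓ H1 H2 H3 ht H4
  refine ⟨?_, ?_, ?_⟩
  · rintro M C α β hM hC hα hα1 hβ hβ2 ⟨K', hK', -, hDe⟩ hA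
    have h2β : 0 < 2 - β := by linarith
    refine hgen (fun r => C * Real.log (r + 1) ^ (2 - β))
      (fun r => C * (2 - β) * Real.log (r + 1) ^ (1 - β) / (r + 1)) 1 (C * (2 - β) ^ 2 * M) α
      (2 ^ (2 - β)) K' zero_le_one hK' (fun r hr => ?_) (fun r hr => ?_) (fun r hr => ?_)
      (fun r hr => ?_) (by positivity) ?_ hα hα1 ?_ (by positivity) ?_ ?_
    · have := ((hasDerivAt_log_add_one hr).rpow_const (p := 2 - β)
        (Or.inl (log_add_one_pos hr).ne')).const_mul C
      refine this.congr_deriv ?_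
      rw [show 2 - β - 1 = 1 - β by ring]
      ring
    · have hr1 : (1 : ℝ) ≤ r := hr
      have h1 : ContinuousAt (fun r : ℝ => Real.log (r + 1) ^ (1 - β)) r :=
        (hasDerivAt_log_add_one hr1).continuousAt.rpow_const (Or.inl (log_add_one_pos hr1).ne')
      exact ((h1.const_mul _).div (by fun_prop) (by linarith)).continuousWithinAt
    · have := log_add_one_pos hr
      positivity
    · have := log_add_one_pos hr
      positivity
    · filter_upwards [hDe] with x hx hxK hx1
      have hl := log_add_one_pos hx1
      have hρ1 : 0 < ρ x + 1 := by linarith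
      set l := Real.log (ρ x + 1)
      have h1 := sq_mul_add_mul_le (N := Nρ x) (a := C * (2 - β) * l ^ (1 - β) / (ρ x + 1)) (by positivity)
        (le_of_eq_of_le (by congr 1; field_simp) ((le_abs_self _).trans (hx hxK)))
      refine h1.trans ?_
      have e : l ^ (1 - β) * l ^ (1 - β) * l ^ β = l ^ (2 - β) := by
        rw [← Real.rpow_add hl, ← Real.rpow_add hl]
        ring_nf
      have e2 : (C * (2 - β) * l ^ (1 - β) / (ρ x + 1)) ^ 2 * (M * (ρ x + 1) ^ 2 * l ^ β) =
          C * (2 - β) ^ 2 * M * (C * l ^ (2 - β)) := by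
        rw [← e]; field_simp
      rw [e2]
      exact mul_le_mul_of_nonneg_left (by linarith) (by positivity)
    · filter_upwards [hA] with n hn
      refine hn.trans (ENNReal.ofReal_le_ofReal ?_)
      have hlog : Real.log ((n : ℝ) + 1) ≤ Real.log (2 * n + 1) :=
        Real.log_le_log (by positivity) (by linarith [(Nat.cast_nonneg n : (0 : ℝ) ≤ n)])
      have h0 : 0 ≤ Real.log ((n : ℝ) + 1) :=
        Real.log_nonneg (by linarith [(Nat.cast_nonneg n : (0 : ℝ) ≤ n)])
      rw [← mul_assoc]
      gcongr
    · refine Eventually.of_forall fun n => ?_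
      have h0 : 0 ≤ Real.log (2 * (n : ℝ) + 1) :=
        Real.log_nonneg (by linarith [(Nat.cast_nonneg n : (0 : ℝ) ≤ n)])
      have h0' : 0 ≤ Real.log (4 * (n : ℝ) + 1) :=
        Real.log_nonneg (by linarith [(Nat.cast_nonneg n : (0 : ℝ) ≤ n)])
      have h1 := Real.rpow_le_rpow h0' (log_four_mul_add_one_le n) h2β.le
      rw [Real.mul_rpow zero_le_two h0] at h1
      have h2 : (0 : ℝ) < 2 ^ (2 - β) := by positivity
      nlinarith [mul_le_mul_of_nonneg_left h1 hC.le]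
    · exact ((tendsto_rpow_atTop h2β).comp tendsto_log_two_mul_add_one).const_mul_atTop hC
  · rintro M C α hM hC hα hα1 ⟨K', hK', -, hDe⟩ hA
    have hlog0 : ∀ y : ℝ, 0 ≤ y → 0 ≤ Real.log (y + 1) := fun y hy =>
      Real.log_nonneg (by linarith)
    refine hgen (fun r => C * Real.log (Real.log (r + 1) + 1))
      (fun r => C * (1 / (r + 1) / (Real.log (r + 1) + 1))) 1 (C ^ 2 * M) α 2 K' zero_le_one hK'
      (fun r hr => ?_) (fun r hr => ?_) (fun r hr => ?_)
      (fun r hr => ?_) (by positivity) ?_ hα hα1 ?_ (by positivity) ?_ ?_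
    · exact (((hasDerivAt_log_add_one hr).add_const 1).log
        (by have := log_add_one_pos hr; positivity)).const_mul C
    · have hr1 : (1 : ℝ) ≤ r := hr
      have hl := log_add_one_pos hr1
      have h1 : ContinuousAt (fun r : ℝ => 1 / (r + 1)) r :=
        continuousAt_const.div (by fun_prop) (by linarith)
      have h2 : ContinuousAt (fun r : ℝ => Real.log (r + 1) + 1) r :=
        (hasDerivAt_log_add_one hr1).continuousAt.add continuousAt_const
      exact ((h1.div h2 (by positivity)).const_mul _).continuousWithinAt
    · have := log_add_one_pos hr
      positivity
    · exact mul_nonneg hC.le (hlog0 _ (log_add_one_pos hr).le)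
    · filter_upwards [hDe, H3.gamma_nonneg hΓ] with x hx hΓx hxK hx1
      have hl := log_add_one_pos hx1
      have hρ1 : 0 < ρ x + 1 := by linarith
      have hφ := hlog0 _ hl.le
      set l := Real.log (ρ x + 1)
      set a := C / ((ρ x + 1) * l) with ha
      have ha0 : 0 < a := by positivity
      have hb : C * (1 / (ρ x + 1) / (l + 1)) = a * (l / (l + 1)) := by
        rw [ha]; field_simp
      have hs0 : 0 ≤ l / (l + 1) := by positivity
      have hs1 : l / (l + 1) ≤ 1 := by rw [div_le_one (by positivity)]; linarith
      have h1 := sq_mul_add_mul_le (N := Nρ x) (a := a) ha0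
        (le_of_eq_of_le (by rw [ha]; congr 1; field_simp) ((le_abs_self _).trans (hx hxK)))
      have e2 : a ^ 2 * (M * (ρ x + 1) ^ 2 * l ^ 2) = C ^ 2 * M := by
        rw [ha]; field_simp
      rw [e2] at h1
      have h2 : 0 ≤ C ^ 2 * M * (C * Real.log (l + 1)) := by positivity
      have h3 : (l / (l + 1)) ^ 2 * (a ^ 2 * Γρ x) ≤ l / (l + 1) * (a ^ 2 * Γρ x) :=
        mul_le_mul_of_nonneg_right (by nlinarith) (by positivity)
      have h4 : l / (l + 1) * (a ^ 2 * Γρ x + a * Nρ x) ≤ l / (l + 1) * (C ^ 2 * M) :=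
        mul_le_mul_of_nonneg_left h1 hs0
      have h5 : l / (l + 1) * (C ^ 2 * M) ≤ C ^ 2 * M := mul_le_of_le_one_left (by positivity) hs1
      rw [hb]
      nlinarith
    · filter_upwards [hA, eventually_gt_atTop 0] with n hn hn0
      refine hn.trans (ENNReal.ofReal_le_ofReal ?_)
      have hn1 : (1 : ℝ) ≤ n := by exact_mod_cast hn0
      have hl := log_add_one_pos hn1
      rw [Real.rpow_def_of_pos hl]
      have h1 : Real.log ((n : ℝ) + 1) ≤ Real.log (2 * n + 1) + 1 := by
        have : Real.log ((n : ℝ) + 1) ≤ Real.log (2 * n + 1) :=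
          Real.log_le_log (by positivity) (by linarith)
        linarith
      have h2 := Real.log_le_log hl h1
      have h3 : Real.log (Real.log ((n : ℝ) + 1)) * (C * α) ≤
          α * (C * Real.log (Real.log (2 * n + 1) + 1)) := by
        nlinarith [mul_le_mul_of_nonneg_left h2 (by positivity : 0 ≤ α * C)]
      gcongr
    · refine Eventually.of_forall fun n => ?_
      have h0 := hlog0 (2 * n) (by positivity)
      have h0' := hlog0 (4 * n) (by positivity)
      have h1 : Real.log (Real.log (4 * (n : ℝ) + 1) + 1) ≤
          2 * Real.log (Real.log (2 * (n : ℝ) + 1) + 1) := by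
        have e : 2 * Real.log (Real.log (2 * (n : ℝ) + 1) + 1) =
            Real.log ((Real.log (2 * (n : ℝ) + 1) + 1) ^ 2) := by
          rw [Real.log_pow]; norm_num
        rw [e]
        exact Real.log_le_log (by positivity) (by nlinarith [log_four_mul_add_one_le n])
      nlinarith
    · exact (Real.tendsto_log_atTop.comp
        (tendsto_atTop_add_const_right _ _ tendsto_log_two_mul_add_one)).const_mul_atTop hC
  · rintro M C α hM hC hα hα1 ⟨K', hK', -, hDe⟩ hA
    refine hgen (fun r => C * r ^ 2 / 2) (fun r => C * r) 1 (2 * C * M) (α / 2) 4 K' zero_le_one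
      hK' (fun r hr => ?_) (by fun_prop) (fun r hr => by positivity)
      (fun r hr => by positivity) (by positivity) ?_ (by positivity) (by linarith) ?_
      (by norm_num) ?_ ?_
    · have := ((hasDerivAt_pow 2 r).const_mul C).div_const 2
      refine this.congr_deriv ?_
      push_cast
      ring
    · filter_upwards [hDe] with x hx hxK hx1
      have h1 := sq_mul_add_mul_le (N := Nρ x) (a := C * ρ x) (by positivity)
        ((le_abs_self _).trans (hx hxK))
      refine h1.trans ?_
      have : 0 < 2 * C * M := by positivity
      nlinarith
    · filter_upwards [hA] with n hn
      refine hn.trans (le_of_eq ?_)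
      congr 3
      ring
    · refine Eventually.of_forall fun n => ?_
      nlinarith
    · refine Tendsto.atTop_div_const two_pos (Tendsto.const_mul_atTop hC ?_)
      exact (tendsto_pow_atTop two_ne_zero).comp
        (tendsto_natCast_atTop_atTop.const_mul_atTop two_pos)
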